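/- A dyadic interval is an interval $[j2^k,(j+1)2^k)\subset\mathbb R$ with $j,k\in\mathbb Z$; its ($L^\infty$-normalized) Haar function is $h_I=-\mathbf 1_{I_{\mathrm{left}}}+\mathbf 1_{I_{\mathrm{right}}}$, where $I_{\mathrm{left}},I_{\mathrm{right}}$ are the left and right halves of $I$. A dyadic rectangle in $\mathbb R^3$ is a product $R=R_1\times R_2\times R_3$ of dyadic intervals, $|R|$ is its volume, and $h_R(x_1,x_2,x_3)=h_{R_1}(x_1)h_{R_2}(x_2)h_{R_3}(x_3)$. **Theorem.** There are absolute constants $\epsilon>0$ and $K>0$ such that for every integer $n\ge 1$ and all real coefficients $\alpha_R$, indexed by the dyadic rectangles $R\subset[0,1]^3$ with $|R|=2^{-n}$, $$2^{-n}\sum_{|R|=2^{-n}}|\alpha_R|\;\le\;K\,n^{1-\epsilon}\,\Bigl\|\sum_{|R|=2^{-n}}\alpha_R h_R\Bigr\|_{L^\infty},$$ where both sums run over the dyadic rectangles $R\subset[0,1]^3$ with $|R|=2^{-n}$. -/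

import Mathlib

open scoped ENNReal

noncomputable section

/-- The dyadic interval `[j 2^k, (j+1) 2^k)`, recorded by the integers `k` and `j`,
which the interval determines. -/
@[ext]
structure DyadicInterval where
  /-- The exponent `k` of the length `2^k`. -/
  scale : ℤ
  /-- The position `j`. -/
  pos : ℤ

namespace DyadicInterval

/-- The length `2^k`. -/
def length (I : DyadicInterval) : ℝ := (2 : ℝ) ^ I.scale

/-- The set of points `[j 2^k, (j+1) 2^k)`. -/
def toSet (I : DyadicInterval) : Set ℝ :=
  Set.Ico ((I.pos : ℝ) * (2 : ℝ) ^ I.scale) (((I.pos : ℝ) + 1) * (2 : ℝ) ^ I.scale)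

/-- The left half `[2j 2^(k-1), (2j+1) 2^(k-1))`. -/
def left (I : DyadicInterval) : DyadicInterval := ⟨I.scale - 1, 2 * I.pos⟩

/-- The right half `[(2j+1) 2^(k-1), (2j+2) 2^(k-1))`. -/
def right (I : DyadicInterval) : DyadicInterval := ⟨I.scale - 1, 2 * I.pos + 1⟩

/-- The Haar function `-1` on the left half, `+1` on the right half, `0` elsewhere. -/
def haar (I : DyadicInterval) (x : ℝ) : ℝ :=
  -(I.left.toSet.indicator 1 x) + I.right.toSet.indicator 1 x

end DyadicInterval

/-- A dyadic rectangle in `ℝ^d`: a product of `d` dyadic intervals, its sides. -/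
abbrev DyadicRectangle (d : ℕ) : Type := Fin d → DyadicInterval

namespace DyadicRectangle

variable {d : ℕ}

/-- The set of points of the rectangle. -/
def toSet (R : DyadicRectangle d) : Set (Fin d → ℝ) := Set.univ.pi fun i => (R i).toSet

/-- The volume `|R|`, the product of the side lengths. -/
def vol (R : DyadicRectangle d) : ℝ := ∏ i, (R i).length

/-- The tensor product Haar function, normalized in `L^∞`. -/
def haar (R : DyadicRectangle d) (x : Fin d → ℝ) : ℝ := ∏ i, (R i).haar (x i)

/-- The dyadic rectangles of volume `2^(-n)` in the unit cube `[0,1]^d`. -/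
def hyperbolicSet (d n : ℕ) : Set (DyadicRectangle d) :=
  {R | R.toSet ⊆ Set.Icc 0 1 ∧ R.vol = (2 : ℝ) ^ (-(n : ℤ))}

theorem side_bounds {I : DyadicInterval} (h : I.toSet ⊆ Set.Icc 0 1) :
    0 ≤ I.pos ∧ ((I.pos : ℝ) + 1) * (2 : ℝ) ^ I.scale ≤ 1 := by
  have hp : (0 : ℝ) < (2 : ℝ) ^ I.scale := by positivity
  have hlt : (I.pos : ℝ) * (2 : ℝ) ^ I.scale < ((I.pos : ℝ) + 1) * (2 : ℝ) ^ I.scale := by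
    nlinarith
  have h2 := closure_mono h
  rw [DyadicInterval.toSet, closure_Ico hlt.ne, isClosed_Icc.closure_eq,
    Set.Icc_subset_Icc_iff hlt.le] at h2
  refine ⟨?_, h2.2⟩
  have : (0 : ℝ) ≤ (I.pos : ℝ) := nonneg_of_mul_nonneg_left h2.1 hp
  exact_mod_cast this

theorem hyperbolicSet_finite (d n : ℕ) : (hyperbolicSet d n).Finite := by
  have key : ∀ R ∈ hyperbolicSet d n, ∀ i, R i ∈
      (fun p : ℤ × ℤ => DyadicInterval.mk p.1 p.2) ''
        (Set.Icc (-(n : ℤ)) 0 ×ˢ Set.Icc 0 ((2 : ℤ) ^ n)) := by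
    rintro R ⟨hR, hv⟩
    have hne : ∀ i, ((R i).toSet).Nonempty := fun i => by
      refine Set.nonempty_Ico.2 ?_
      have hp : (0 : ℝ) < (2 : ℝ) ^ (R i).scale := by positivity
      nlinarith
    have hside : ∀ i, (R i).toSet ⊆ Set.Icc 0 1 := by
      intro i x hx
      choose y hy using hne
      have := hR (show Function.update y i x ∈ toSet R by
        intro k _
        by_cases hk : k = i
        · subst hk; simpa using hx
        · simpa [hk] using hy k)
      have h0 := this.1 i
      have h1 := this.2 i
      simp only [Function.update_self, Pi.zero_apply, Pi.one_apply] at h0 h1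
      exact ⟨h0, h1⟩
    have hk0 : ∀ i, (R i).scale ≤ 0 := by
      intro i
      obtain ⟨hj, hb⟩ := side_bounds (hside i)
      have hj' : (0 : ℝ) ≤ ((R i).pos : ℝ) := by exact_mod_cast hj
      have hp : (0 : ℝ) < (2 : ℝ) ^ (R i).scale := by positivity
      have : (2 : ℝ) ^ (R i).scale ≤ (2 : ℝ) ^ (0 : ℤ) := by
        rw [zpow_zero]; nlinarith
      exact (zpow_le_zpow_iff_right₀ (by norm_num)).1 this
    have hk1 : ∀ i, -(n : ℤ) ≤ (R i).scale := by
      intro i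
      have hle : (2 : ℝ) ^ (-(n : ℤ)) ≤ (2 : ℝ) ^ (R i).scale := by
        rw [← hv, vol, ← Finset.mul_prod_erase Finset.univ _ (Finset.mem_univ i)]
        refine mul_le_of_le_one_right (zpow_nonneg (by norm_num) _) ?_
        refine Finset.prod_le_one (fun k _ => zpow_nonneg (by norm_num) _) fun k _ => ?_
        exact zpow_le_one_of_nonpos₀ (by norm_num) (hk0 k)
      exact (zpow_le_zpow_iff_right₀ (by norm_num)).1 hle
    intro i
    obtain ⟨hj, hb⟩ := side_bounds (hside i)
    refine ⟨((R i).scale, (R i).pos), ⟨⟨hk1 i, hk0 i⟩, hj, ?_⟩, rfl⟩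
    have hj' : (0 : ℝ) ≤ ((R i).pos : ℝ) := by exact_mod_cast hj
    have hle : (2 : ℝ) ^ (-(n : ℤ)) ≤ (2 : ℝ) ^ (R i).scale :=
      (zpow_le_zpow_iff_right₀ (by norm_num)).2 (hk1 i)
    have h3 : ((R i).pos : ℝ) * (2 : ℝ) ^ (-(n : ℤ)) ≤ 1 := by
      have hp : (0 : ℝ) < (2 : ℝ) ^ (R i).scale := by positivity
      nlinarith
    rw [zpow_neg, zpow_natCast, ← div_eq_mul_inv, div_le_one (by positivity)] at h3
    exact_mod_cast h3
  refine (Set.Finite.pi' (fun _ : Fin d => ?_)).subset key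
  exact ((Set.finite_Icc _ _).prod (Set.finite_Icc _ _)).image _

/-- The finite set of dyadic rectangles of volume `2^(-n)` in the unit cube `[0,1]^d`. -/
def hyperbolic (d n : ℕ) : Finset (DyadicRectangle d) := (hyperbolicSet_finite d n).toFinset

end DyadicRectangle

/-- The hyperbolic Haar sum `∑_{|R| = 2^(-n)} α_R h_R`. -/
def hyperbolicHaarSum {d : ℕ} (n : ℕ) (α : DyadicRectangle d → ℝ) (x : Fin d → ℝ) : ℝ :=
  ∑ R ∈ DyadicRectangle.hyperbolic d n, α R * R.haar x

end

/-! The proof is by duality. On the grid of cells of side 2^(-(n+1)), the part of the Haar sum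
coming from rectangles of one shape r = (r 0, r 1, r 2), with r 0 + r 1 + r 2 = n, is a function H_r
that ignores the binary digits of coordinate i beyond digit r i and is odd in that digit. Replacing
α by its signs gives f_r with f_r² = 1 and H_r f_r = |H_r|. The left side of the inequality is at
most ∑ avg |H_r|, so it suffices to find Ψ with avg (H_r Ψ) = ρ avg (H_r f_r) for every r and avg
|Ψ| bounded, where ρ exceeds 1/n by a power of n.

Ψ is cut out of a Riesz product ∏ (1 + ρ F_w), where F_w sums the f_r with r 0 in the w-th of q
blocks. Scales from different blocks differ in the first coordinate but may coincide in the second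
or third. `mainPart` keeps the terms in which the largest second coordinate and the largest third
coordinate are each attained in only one block. Against H_s, oddness forces these maxima to be s 1
and s 2. Every scale that does not attain both then has first coordinate above s 0 and averages out,
so only s itself survives (`avg_haar_mul_mainPart`).

The bound avg |Ψ| ≤ 7 is `avg_abs_mainPart_le_seven`. The full product has mean 1 and is negative
only on a tiny set, and its second moment is not too large (`avg_abs_rieszProd_le`,
`avg_rieszProd_sq_le`). `mainPart_eq` expresses Ψ by inclusion and exclusion through the full
product and the parts with a repeated maximum. Fixing the maximum in a block makes its factor of
size at most σ, which is n^(-1/2) up to a small power of n. A maximum shared by three blocks costs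
σ³ for each of n values, which is summable by brute force. A maximum shared by two blocks is
critical, since n σ² does not decay. There the sum over the common value c has square-root
cancellation (`avg_coincidence_pow_le`, used in `avg_abs_sum_rieszTerm_pair_le`).

All moment bounds rest on one vector valued square function inequality for sums of functions odd in
successive digits, `avg_pow_le_avg_square_pow`. -/

/-! ### Averages on a finite probability space -/

section Averages

variable {Ω : Type*} [Fintype Ω]

/-- The average of a function on a finite type. -/
noncomputable def avg (f : Ω → ℝ) : ℝ := (∑ ω, f ω) / Fintype.card Ω

theorem avg_mono {f g : Ω → ℝ} (h : ∀ ω, f ω ≤ g ω) : avg f ≤ avg g := by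
  unfold avg
  gcongr with ω
  exact h ω

theorem avg_nonneg {f : Ω → ℝ} (h : ∀ ω, 0 ≤ f ω) : 0 ≤ avg f :=
  div_nonneg (Finset.sum_nonneg fun ω _ => h ω) (by positivity)

theorem avg_add (f g : Ω → ℝ) : avg (fun ω => f ω + g ω) = avg f + avg g := by
  simp only [avg, Finset.sum_add_distrib, add_div]

theorem avg_const_mul (c : ℝ) (f : Ω → ℝ) : avg (fun ω => c * f ω) = c * avg f := by
  simp only [avg, ← Finset.mul_sum, mul_div_assoc]

theorem avg_neg (f : Ω → ℝ) : avg (fun ω => -f ω) = -avg f := by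
  simp only [avg, Finset.sum_neg_distrib, neg_div]

theorem avg_sum {ι : Type*} (s : Finset ι) (f : ι → Ω → ℝ) :
    avg (fun ω => ∑ i ∈ s, f i ω) = ∑ i ∈ s, avg (f i) := by
  simp only [avg, Finset.sum_div]
  exact Finset.sum_comm

theorem avg_const [Nonempty Ω] (c : ℝ) : avg (fun _ : Ω => c) = c := by
  simp [avg]

theorem avg_le_of_le [Nonempty Ω] {f : Ω → ℝ} {c : ℝ} (h : ∀ ω, f ω ≤ c) : avg f ≤ c :=
  (avg_mono h).trans_eq (avg_const c)

theorem avg_comp_perm (T : Equiv.Perm Ω) (f : Ω → ℝ) : avg (fun ω => f (T ω)) = avg f := by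
  unfold avg
  rw [Equiv.sum_comp T f]

/-- Source of the orthogonality relations below, with `T` a digit flip. -/
theorem avg_eq_zero_of_odd (T : Equiv.Perm Ω) {f : Ω → ℝ} (h : ∀ ω, f (T ω) = -f ω) :
    avg f = 0 := by
  have := avg_comp_perm T f
  simp only [h, avg_neg] at this
  linarith

theorem abs_avg_le (f : Ω → ℝ) : |avg f| ≤ avg fun ω => |f ω| := by
  unfold avg
  rw [abs_div, abs_of_nonneg (by positivity : (0 : ℝ) ≤ Fintype.card Ω)]
  gcongr
  exact Finset.abs_sum_le_sum_abs _ _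

theorem avg_mul_sq_le (f g : Ω → ℝ) :
    avg (fun ω => f ω * g ω) ^ 2 ≤ avg (fun ω => f ω ^ 2) * avg fun ω => g ω ^ 2 := by
  unfold avg
  rw [div_pow, div_mul_div_comm, ← pow_two]
  gcongr
  exact Finset.sum_mul_sq_le_sq_mul_sq _ _ _

end Averages

/-! ### Even moments of sums of odd differences -/

section SquareFunction

/-- Chebyshev's sum inequality: `x - y` and `x ^ m - y ^ m` have the same sign. -/
theorem mul_add_pow_le {x y : ℝ} (hx : 0 ≤ x) (hy : 0 ≤ y) (m : ℕ) :
    (x + y) * (x ^ m + y ^ m) ≤ 2 * (x ^ (m + 1) + y ^ (m + 1)) := by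
  have h : 0 ≤ (x - y) * (x ^ m - y ^ m) := by
    rcases le_total x y with h | h
    · exact mul_nonneg_of_nonpos_of_nonpos (by linarith)
        (by linarith [pow_le_pow_left₀ hx h m])
    · exact mul_nonneg (by linarith) (by linarith [pow_le_pow_left₀ hy h m])
  have e1 : x ^ (m + 1) = x * x ^ m := pow_succ' x m
  have e2 : y ^ (m + 1) = y * y ^ m := pow_succ' y m
  rw [e1, e2]
  nlinarith

theorem sub_mul_pow_sub_le {x y : ℝ} (hx : 0 ≤ x) (hy : 0 ≤ y) (m : ℕ) :
    2 * ((x - y) * (x ^ (m + 1) - y ^ (m + 1))) ≤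
      (m + 1) * ((x - y) ^ 2 * (x ^ m + y ^ m)) := by
  induction m with
  | zero => simp; nlinarith
  | succ m ih =>
    have h1 : 0 ≤ (x - y) * (x ^ (m + 1) - y ^ (m + 1)) := by
      rcases le_total x y with h | h
      · exact mul_nonneg_of_nonpos_of_nonpos (by linarith)
          (by linarith [pow_le_pow_left₀ hx h (m + 1)])
      · exact mul_nonneg (by linarith) (by linarith [pow_le_pow_left₀ hy h (m + 1)])
    have h2 := mul_add_pow_le hx hy m
    have h3 : (x + y) * (2 * ((x - y) * (x ^ (m + 1) - y ^ (m + 1)))) ≤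
        (x + y) * ((m + 1) * ((x - y) ^ 2 * (x ^ m + y ^ m))) :=
      mul_le_mul_of_nonneg_left ih (by linarith)
    have h4 : (m + 1 : ℝ) * (x - y) ^ 2 * ((x + y) * (x ^ m + y ^ m)) ≤
        (m + 1 : ℝ) * (x - y) ^ 2 * (2 * (x ^ (m + 1) + y ^ (m + 1))) :=
      mul_le_mul_of_nonneg_left h2 (by positivity)
    have e : 2 * ((x - y) * (x ^ (m + 1 + 1) - y ^ (m + 1 + 1))) =
        (x + y) * ((x - y) * (x ^ (m + 1) - y ^ (m + 1))) +
          (x - y) ^ 2 * (x ^ (m + 1) + y ^ (m + 1)) := by ring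
    push_cast
    rw [e]
    nlinarith

/-- The pointwise inequality behind the moment bound for conditionally symmetric differences. -/
theorem parallelogram_pow_le {x y a e : ℝ} (hx : 0 ≤ x) (hy : 0 ≤ y) (ha : 0 ≤ a) (he : 0 ≤ e)
    (hs : x + y = 2 * (a + e)) (hd : (x - y) ^ 2 ≤ 16 * (a * e)) (m : ℕ) :
    x ^ (m + 1) + y ^ (m + 1) ≤
      2 * a ^ (m + 1) + 2 * ((m : ℝ) + 1) ^ 2 * (e * (x ^ m + y ^ m)) := by
  induction m with
  | zero => simp; nlinarith
  | succ m ih =>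
    have h1 := mul_add_pow_le hx hy m
    have h2 := sub_mul_pow_sub_le hx hy m
    have hp : 0 ≤ x ^ m + y ^ m := by positivity
    have hp1 : 0 ≤ x ^ (m + 1) + y ^ (m + 1) := by positivity
    have h3 : a * (x ^ m + y ^ m) ≤ x ^ (m + 1) + y ^ (m + 1) := by
      have : 2 * (a + e) * (x ^ m + y ^ m) ≤ 2 * (x ^ (m + 1) + y ^ (m + 1)) := hs ▸ h1
      nlinarith [mul_nonneg he hp]
    have h4 : (x - y) ^ 2 * (x ^ m + y ^ m) ≤ 16 * e * (x ^ (m + 1) + y ^ (m + 1)) := by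
      calc (x - y) ^ 2 * (x ^ m + y ^ m) ≤ 16 * (a * e) * (x ^ m + y ^ m) := by gcongr
        _ = 16 * e * (a * (x ^ m + y ^ m)) := by ring
        _ ≤ _ := by gcongr
    have h5 : (m + 1 : ℝ) * ((x - y) ^ 2 * (x ^ m + y ^ m)) ≤
        (m + 1 : ℝ) * (16 * e * (x ^ (m + 1) + y ^ (m + 1))) := by gcongr
    have h6 : a * (x ^ (m + 1) + y ^ (m + 1)) ≤
        a * (2 * a ^ (m + 1) + 2 * ((m : ℝ) + 1) ^ 2 * (e * (x ^ m + y ^ m))) := by gcongr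
    have h7 : 2 * ((m : ℝ) + 1) ^ 2 * e * (a * (x ^ m + y ^ m)) ≤
        2 * ((m : ℝ) + 1) ^ 2 * e * (x ^ (m + 1) + y ^ (m + 1)) := by gcongr
    have e1 : x ^ (m + 1 + 1) + y ^ (m + 1 + 1) =
        (x + y) / 2 * (x ^ (m + 1) + y ^ (m + 1)) +
          (x - y) * (x ^ (m + 1) - y ^ (m + 1)) / 2 := by ring
    have e2 : 2 * a ^ (m + 1 + 1) = a * (2 * a ^ (m + 1)) := by ring
    rw [e1, e2, hs]
    push_cast
    -- The coefficients of `e * (x ^ (m + 1) + y ^ (m + 1))` add up to 1 + 4(m+1) + 2(m+1)², coming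
    -- from `hs`, from the difference term and from induction. This is at most 2(m+2)².
    have h8 : 0 ≤ e * (x ^ (m + 1) + y ^ (m + 1)) := by positivity
    nlinarith

theorem two_mul_pow_le_add_pow {x y a : ℝ} (hx : 0 ≤ x) (hy : 0 ≤ y) (ha : 0 ≤ a)
    (hs : 2 * a ≤ x + y) (m : ℕ) : 2 * a ^ m ≤ x ^ m + y ^ m := by
  induction m with
  | zero => norm_num
  | succ m ih =>
    have h1 := mul_add_pow_le hx hy m
    have h2 := mul_le_mul_of_nonneg_left ih ha
    have h3 : 2 * a * (x ^ m + y ^ m) ≤ (x + y) * (x ^ m + y ^ m) := by gcongr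
    have e : 2 * a ^ (m + 1) = a * (2 * a ^ m) := by ring
    linarith

/-- Young's inequality with exponents m+1 and (m+1)/m, cleared of denominators; each induction step
leaves a nonnegative multiple of (a - b)². -/
theorem young_pow {a b : ℝ} (ha : 0 ≤ a) (hb : 0 ≤ b) (m : ℕ) :
    ((m : ℝ) + 1) * (a * b ^ m) ≤ a ^ (m + 1) + m * b ^ (m + 1) := by
  induction m with
  | zero => simp
  | succ m ih =>
    have h1 := mul_le_mul_of_nonneg_left ih ha
    have h2 : 0 ≤ ((m : ℝ) + 1) * b ^ m * (a - b) ^ 2 := by positivity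
    push_cast
    have e : a ^ (m + 1 + 1) + (m + 1) * b ^ (m + 1 + 1) - (m + 1 + 1) * (a * b ^ (m + 1)) =
      (a * (a ^ (m + 1) + m * b ^ (m + 1)) - a * ((m + 1) * (a * b ^ m))) +
        ((m : ℝ) + 1) * b ^ m * (a - b) ^ 2 := by ring
    linarith

variable {Ω : Type*} [Fintype Ω] {ι κ : Type*}

/-- Symmetrization: an inequality between averages may be checked pointwise on the pairs `ω`, `T ω`.
-/
theorem avg_eq_half_add (T : Equiv.Perm Ω) (f : Ω → ℝ) :
    avg f = avg fun ω => (f ω + f (T ω)) / 2 := by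
  have h1 : avg (fun ω => (f ω + f (T ω)) / 2) = avg fun ω => 2⁻¹ * (f ω + f (T ω)) := by
    congr 1; ext ω; ring
  rw [h1, avg_const_mul, avg_add, avg_comp_perm]
  ring

/-- One martingale step: an upper bound for the increase of the moment. -/
theorem avg_step_le (T : Equiv.Perm Ω) (J : Finset κ) (F d : κ → Ω → ℝ)
    (hF : ∀ j ∈ J, ∀ ω, F j (T ω) = F j ω) (hd : ∀ j ∈ J, ∀ ω, d j (T ω) = -d j ω) (m : ℕ) :
    avg (fun ω => (∑ j ∈ J, (F j ω + d j ω) ^ 2) ^ (m + 1)) ≤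
      avg (fun ω => (∑ j ∈ J, F j ω ^ 2) ^ (m + 1)) +
        2 * ((m : ℝ) + 1) ^ 2 *
          avg fun ω => (∑ j ∈ J, d j ω ^ 2) * (∑ j ∈ J, (F j ω + d j ω) ^ 2) ^ m := by
  rw [avg_eq_half_add T, avg_eq_half_add T fun ω => (∑ j ∈ J, d j ω ^ 2) * _, ← avg_const_mul,
    ← avg_add]
  refine avg_mono fun ω => ?_
  have e1 : ∑ j ∈ J, (F j (T ω) + d j (T ω)) ^ 2 = ∑ j ∈ J, (F j ω - d j ω) ^ 2 :=
    Finset.sum_congr rfl fun j hj => by rw [hF j hj, hd j hj]; ring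
  have e2 : ∑ j ∈ J, d j (T ω) ^ 2 = ∑ j ∈ J, d j ω ^ 2 :=
    Finset.sum_congr rfl fun j hj => by rw [hd j hj]; ring
  simp only [e1, e2]
  have key := parallelogram_pow_le (x := ∑ j ∈ J, (F j ω + d j ω) ^ 2)
    (y := ∑ j ∈ J, (F j ω - d j ω) ^ 2) (a := ∑ j ∈ J, F j ω ^ 2) (e := ∑ j ∈ J, d j ω ^ 2)
    (Finset.sum_nonneg fun _ _ => sq_nonneg _) (Finset.sum_nonneg fun _ _ => sq_nonneg _)
    (Finset.sum_nonneg fun _ _ => sq_nonneg _) (Finset.sum_nonneg fun _ _ => sq_nonneg _)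
    (by rw [← Finset.sum_add_distrib, ← Finset.sum_add_distrib, Finset.mul_sum]
        exact Finset.sum_congr rfl fun j _ => by ring)
    (by
      have h := Finset.sum_mul_sq_le_sq_mul_sq J (fun j => F j ω) (fun j => d j ω)
      have e : ∑ j ∈ J, (F j ω + d j ω) ^ 2 - ∑ j ∈ J, (F j ω - d j ω) ^ 2 =
          4 * ∑ j ∈ J, F j ω * d j ω := by
        rw [← Finset.sum_sub_distrib, Finset.mul_sum]
        exact Finset.sum_congr rfl fun j _ => by ring
      rw [e]
      nlinarith) m
  linarith

/-- One martingale step: weighted moments do not decrease. -/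
theorem avg_step_ge (T : Equiv.Perm Ω) (J : Finset κ) (F d : κ → Ω → ℝ) (w : Ω → ℝ)
    (hF : ∀ j ∈ J, ∀ ω, F j (T ω) = F j ω) (hd : ∀ j ∈ J, ∀ ω, d j (T ω) = -d j ω)
    (hw : ∀ ω, w (T ω) = w ω) (hw0 : ∀ ω, 0 ≤ w ω) (m : ℕ) :
    avg (fun ω => w ω * (∑ j ∈ J, F j ω ^ 2) ^ m) ≤
      avg fun ω => w ω * (∑ j ∈ J, (F j ω + d j ω) ^ 2) ^ m := by
  rw [avg_eq_half_add T fun ω => w ω * (∑ j ∈ J, (F j ω + d j ω) ^ 2) ^ m]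
  refine avg_mono fun ω => ?_
  have e1 : ∑ j ∈ J, (F j (T ω) + d j (T ω)) ^ 2 = ∑ j ∈ J, (F j ω - d j ω) ^ 2 :=
    Finset.sum_congr rfl fun j hj => by rw [hF j hj, hd j hj]; ring
  simp only [e1, hw]
  have hx : 0 ≤ ∑ j ∈ J, (F j ω + d j ω) ^ 2 := Finset.sum_nonneg fun _ _ => sq_nonneg _
  have hy : 0 ≤ ∑ j ∈ J, (F j ω - d j ω) ^ 2 := Finset.sum_nonneg fun _ _ => sq_nonneg _
  have ha : 0 ≤ ∑ j ∈ J, F j ω ^ 2 := Finset.sum_nonneg fun _ _ => sq_nonneg _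
  have hs : 2 * ∑ j ∈ J, F j ω ^ 2 ≤
      ∑ j ∈ J, (F j ω + d j ω) ^ 2 + ∑ j ∈ J, (F j ω - d j ω) ^ 2 := by
    rw [← Finset.sum_add_distrib, Finset.mul_sum]
    exact Finset.sum_le_sum fun j _ => by nlinarith [sq_nonneg (d j ω)]
  nlinarith [mul_le_mul_of_nonneg_left (two_mul_pow_le_add_pow hx hy ha hs m) (hw0 ω)]

/-- The difference with the largest key is removed first, since its flip fixes all the others.
`avg_step_le` bounds the growth of the moment, and `avg_step_ge` allows the partial sum inside the
weighted terms of the earlier steps to be replaced by the larger sum. -/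
theorem avg_pow_le_avg_square_mul (T : ℕ → Equiv.Perm Ω) (s : Finset ι) (key : ι → ℕ)
    (hinj : Set.InjOn key s) (J : Finset κ) (d : ι → κ → Ω → ℝ)
    (hodd : ∀ i ∈ s, ∀ j ∈ J, ∀ ω, d i j (T (key i) ω) = -d i j ω)
    (hinv : ∀ i ∈ s, ∀ j ∈ J, ∀ l, key i < l → ∀ ω, d i j (T l ω) = d i j ω) (m : ℕ) :
    avg (fun ω => (∑ j ∈ J, (∑ i ∈ s, d i j ω) ^ 2) ^ (m + 1)) ≤
      2 * ((m : ℝ) + 1) ^ 2 *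
        avg fun ω => (∑ i ∈ s, ∑ j ∈ J, d i j ω ^ 2) *
          (∑ j ∈ J, (∑ i ∈ s, d i j ω) ^ 2) ^ m := by
  classical
  induction s using Finset.induction_on_max_value key with
  | empty => simp [avg]
  | insert i s his hmax ih =>
    have hlt : ∀ i' ∈ s, key i' < key i := fun i' hi' =>
      lt_of_le_of_ne (hmax i' hi') fun h => his <| by
        rw [← hinj (by simp [hi']) (by simp) h]; exact hi'
    have ih' := ih (hinj.mono (by simp)) (fun i' h => hodd i' (by simp [h]))
      (fun i' h => hinv i' (by simp [h]))
    have hF : ∀ j ∈ J, ∀ ω, ∑ i' ∈ s, d i' j (T (key i) ω) = ∑ i' ∈ s, d i' j ω :=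
      fun j hj ω => Finset.sum_congr rfl fun i' hi' =>
        hinv i' (by simp [hi']) j hj _ (hlt i' hi') ω
    have hd : ∀ j ∈ J, ∀ ω, d i j (T (key i) ω) = -d i j ω := hodd i (by simp)
    have h1 := avg_step_le (T (key i)) J (fun j ω => ∑ i' ∈ s, d i' j ω) (d i) hF hd m
    have h2 := avg_step_ge (T (key i)) J (fun j ω => ∑ i' ∈ s, d i' j ω) (d i)
      (fun ω => ∑ i' ∈ s, ∑ j ∈ J, d i' j ω ^ 2) hF hd
      (fun ω => Finset.sum_congr rfl fun i' hi' => Finset.sum_congr rfl fun j hj => by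
        rw [hinv i' (by simp [hi']) j hj _ (hlt i' hi')])
      (fun ω => Finset.sum_nonneg fun _ _ => Finset.sum_nonneg fun _ _ => sq_nonneg _) m
    have e : ∀ j ω, ∑ i' ∈ insert i s, d i' j ω = ∑ i' ∈ s, d i' j ω + d i j ω := fun j ω => by
      rw [Finset.sum_insert his, add_comm]
    simp only [e, Finset.sum_insert his, add_mul]
    rw [avg_add, mul_add]
    have h3 := mul_le_mul_of_nonneg_left h2 (by positivity : 0 ≤ 2 * ((m : ℝ) + 1) ^ 2)
    linarith

/-- The moment inequality for vector valued Haar martingales: the moments of a sum of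
conditionally symmetric differences are controlled by those of the square function. -/
theorem avg_pow_le_avg_square_pow (T : ℕ → Equiv.Perm Ω) (s : Finset ι) (key : ι → ℕ)
    (hinj : Set.InjOn key s) (J : Finset κ) (d : ι → κ → Ω → ℝ)
    (hodd : ∀ i ∈ s, ∀ j ∈ J, ∀ ω, d i j (T (key i) ω) = -d i j ω)
    (hinv : ∀ i ∈ s, ∀ j ∈ J, ∀ l, key i < l → ∀ ω, d i j (T l ω) = d i j ω) (m : ℕ) :
    avg (fun ω => (∑ j ∈ J, (∑ i ∈ s, d i j ω) ^ 2) ^ m) ≤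
      (2 * (m : ℝ) ^ 2) ^ m * avg fun ω => (∑ i ∈ s, ∑ j ∈ J, d i j ω ^ 2) ^ m := by
  rcases m with _ | m
  · simp
  have h1 := avg_pow_le_avg_square_mul T s key hinj J d hodd hinv m
  set c : ℝ := 2 * ((m : ℝ) + 1) ^ 2 with hc
  -- Young's inequality returns m of the m+1 copies of the moment being estimated; these are
  -- absorbed at the end.
  have h2 : ((m : ℝ) + 1) * (c * avg fun ω => (∑ i ∈ s, ∑ j ∈ J, d i j ω ^ 2) *
        (∑ j ∈ J, (∑ i ∈ s, d i j ω) ^ 2) ^ m) ≤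
      c ^ (m + 1) * avg (fun ω => (∑ i ∈ s, ∑ j ∈ J, d i j ω ^ 2) ^ (m + 1)) +
        m * avg fun ω => (∑ j ∈ J, (∑ i ∈ s, d i j ω) ^ 2) ^ (m + 1) := by
    rw [← avg_const_mul, ← avg_const_mul, ← avg_const_mul, ← avg_const_mul, ← avg_add]
    refine avg_mono fun ω => ?_
    have := young_pow (a := c * ∑ i ∈ s, ∑ j ∈ J, d i j ω ^ 2)
      (b := ∑ j ∈ J, (∑ i ∈ s, d i j ω) ^ 2)
      (mul_nonneg (by positivity)
        (Finset.sum_nonneg fun _ _ => Finset.sum_nonneg fun _ _ => sq_nonneg _))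
      (Finset.sum_nonneg fun _ _ => sq_nonneg _) m
    rw [mul_pow] at this
    linarith
  have h3 := mul_le_mul_of_nonneg_left h1 (by positivity : 0 ≤ (m : ℝ) + 1)
  push_cast
  rw [← hc]
  linarith

/-- The scalar case of `avg_pow_le_avg_square_pow`. -/
theorem avg_sum_pow_le (T : ℕ → Equiv.Perm Ω) (s : Finset ι) (key : ι → ℕ)
    (hinj : Set.InjOn key s) (d : ι → Ω → ℝ)
    (hodd : ∀ i ∈ s, ∀ ω, d i (T (key i) ω) = -d i ω)
    (hinv : ∀ i ∈ s, ∀ l, key i < l → ∀ ω, d i (T l ω) = d i ω) (m : ℕ) :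
    avg (fun ω => (∑ i ∈ s, d i ω) ^ (2 * m)) ≤
      (2 * (m : ℝ) ^ 2) ^ m * avg fun ω => (∑ i ∈ s, d i ω ^ 2) ^ m := by
  have := avg_pow_le_avg_square_pow T s key hinj ({()} : Finset Unit) (fun i _ => d i)
    (fun i hi _ _ => hodd i hi) (fun i hi _ _ => hinv i hi) m
  simpa [pow_mul] using this

end SquareFunction

/-! ### Sign functions indexed by scales, and the gain from coincidences -/

section HaarFamilies

variable {Ω : Type*}

/-- `g` behaves like a Haar function of scale `r` with respect to the digit flips `T i k`:
it ignores the digits finer than `r i`, and changes sign with digit `r i`. -/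
def IsHaar (T : Fin 3 → ℕ → Equiv.Perm Ω) (r : Fin 3 → ℕ) (g : Ω → ℝ) : Prop :=
  ∀ i, (∀ k, r i < k → ∀ ω, g (T i k ω) = g ω) ∧ ∀ ω, g (T i (r i) ω) = -g ω

/-- A choice, for every scale `r` of order `n`, of a sign valued function of that scale. -/
def IsSignFamily (T : Fin 3 → ℕ → Equiv.Perm Ω) (n : ℕ) (f : (Fin 3 → ℕ) → Ω → ℝ) : Prop :=
  ∀ r, ∑ i, r i = n → IsHaar T r (f r) ∧ ∀ ω, f r ω ^ 2 = 1

variable {T : Fin 3 → ℕ → Equiv.Perm Ω} {n : ℕ} {f : (Fin 3 → ℕ) → Ω → ℝ}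

theorem IsSignFamily.inv (hf : IsSignFamily T n f) {r : Fin 3 → ℕ} (hr : ∑ i, r i = n)
    (i : Fin 3) {k : ℕ} (hk : r i < k) (ω : Ω) : f r (T i k ω) = f r ω :=
  ((hf r hr).1 i).1 k hk ω

theorem IsSignFamily.odd (hf : IsSignFamily T n f) {r : Fin 3 → ℕ} (hr : ∑ i, r i = n)
    (i : Fin 3) (ω : Ω) : f r (T i (r i) ω) = -f r ω :=
  ((hf r hr).1 i).2 ω

theorem IsSignFamily.odd' (hf : IsSignFamily T n f) {r : Fin 3 → ℕ} (hr : ∑ i, r i = n)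
    (i : Fin 3) {k : ℕ} (hk : r i = k) (ω : Ω) : f r (T i k ω) = -f r ω :=
  hk ▸ hf.odd hr i ω

theorem IsSignFamily.sq (hf : IsSignFamily T n f) {r : Fin 3 → ℕ} (hr : ∑ i, r i = n)
    (ω : Ω) : f r ω ^ 2 = 1 :=
  (hf r hr).2 ω

theorem IsSignFamily.abs_le (hf : IsSignFamily T n f) {r : Fin 3 → ℕ} (hr : ∑ i, r i = n)
    (ω : Ω) : |f r ω| ≤ 1 :=
  (sq_le_one_iff_abs_le_one _).1 (hf.sq hr ω).le

theorem eq_of_two_coords {r s : Fin 3 → ℕ} (hr : ∑ i, r i = n) (hs : ∑ i, s i = n)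
    (h0 : r 0 = s 0) (h1 : r 1 = s 1) : r = s := by
  rw [Fin.sum_univ_three] at hr hs
  ext i
  fin_cases i
  · exact h0
  · exact h1
  · change r 2 = s 2
    omega

variable [Fintype Ω]

/-- Moments of a sum of sign functions over an arbitrary set of scales. -/
theorem IsSignFamily.avg_sum_pow_le (hf : IsSignFamily T n f) (A : Finset (Fin 3 → ℕ))
    (hA : ∀ r ∈ A, ∑ i, r i = n) [Nonempty Ω] (m : ℕ) :
    avg (fun ω => (∑ r ∈ A, f r ω) ^ (2 * m)) ≤ (4 * (m : ℝ) ^ 4 * A.card) ^ m := by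
  classical
  set S0 := A.image fun r => r 0
  set S1 := A.image fun r => r 1
  have e0 : ∀ ω, ∑ r ∈ A, f r ω = ∑ a ∈ S0, ∑ r ∈ A with r 0 = a, f r ω := fun ω =>
    (Finset.sum_fiberwise_of_maps_to (fun r hr => Finset.mem_image_of_mem _ hr) _).symm
  have e1 : ∀ a ω, ∑ r ∈ A with r 0 = a, f r ω =
      ∑ b ∈ S1, ∑ r ∈ A with r 0 = a ∧ r 1 = b, f r ω := fun a ω => by
    rw [← Finset.sum_fiberwise_of_maps_to (g := fun r => r 1) (t := S1)
      (fun r hr => Finset.mem_image_of_mem _ (Finset.mem_filter.1 hr).1)]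
    simp only [Finset.filter_filter]
  -- The square function is taken in the first coordinate. The resulting vector, indexed by `S0`, is
  -- then expanded in the second coordinate; this is where the vector valued inequality is needed.
  have h1 := _root_.avg_sum_pow_le (T 0) S0 id Function.injective_id.injOn
    (fun a ω => ∑ r ∈ A with r 0 = a, f r ω)
    (fun a _ ω => by
      rw [← Finset.sum_neg_distrib]
      refine Finset.sum_congr rfl fun r hr => ?_
      obtain ⟨hr, h⟩ := Finset.mem_filter.1 hr
      exact hf.odd' (hA r hr) 0 h ω)
    (fun a _ l hl ω => by
      refine Finset.sum_congr rfl fun r hr => ?_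
      obtain ⟨hr, h⟩ := Finset.mem_filter.1 hr
      exact hf.inv (hA r hr) 0 (h ▸ hl) ω) m
  have h2 := avg_pow_le_avg_square_pow (T 1) S1 id Function.injective_id.injOn S0
    (fun b a ω => ∑ r ∈ A with r 0 = a ∧ r 1 = b, f r ω)
    (fun b _ a _ ω => by
      rw [← Finset.sum_neg_distrib]
      refine Finset.sum_congr rfl fun r hr => ?_
      obtain ⟨hr, _, h⟩ := Finset.mem_filter.1 hr
      exact hf.odd' (hA r hr) 1 h ω)
    (fun b _ a _ l hl ω => by
      refine Finset.sum_congr rfl fun r hr => ?_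
      obtain ⟨hr, _, h⟩ := Finset.mem_filter.1 hr
      exact hf.inv (hA r hr) 1 (h ▸ hl) ω) m
  -- Two coordinates determine a scale, so each fibre has at most one element and the double square
  -- function is constant.
  have h3 : ∀ ω, ∑ b ∈ S1, ∑ a ∈ S0, (∑ r ∈ A with r 0 = a ∧ r 1 = b, f r ω) ^ 2 = A.card := by
    intro ω
    have hfib : ∀ b a, (∑ r ∈ A with r 0 = a ∧ r 1 = b, f r ω) ^ 2 =
        ∑ r ∈ A with r 0 = a ∧ r 1 = b, f r ω ^ 2 := by
      intro b a
      rcases Finset.eq_empty_or_nonempty {r ∈ A | r 0 = a ∧ r 1 = b} with h | ⟨r, hr⟩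
      · simp [h]
      · have : ({r ∈ A | r 0 = a ∧ r 1 = b} : Finset _) = {r} := by
          refine Finset.eq_singleton_iff_unique_mem.2 ⟨hr, fun s hs => ?_⟩
          obtain ⟨hr, h0, h1⟩ := Finset.mem_filter.1 hr
          obtain ⟨hs, h0', h1'⟩ := Finset.mem_filter.1 hs
          exact eq_of_two_coords (hA s hs) (hA r hr) (h0'.trans h0.symm) (h1'.trans h1.symm)
        simp [this]
    simp only [hfib]
    rw [Finset.sum_comm]
    have e2 : ∀ a, ∑ b ∈ S1, ∑ r ∈ A with r 0 = a ∧ r 1 = b, f r ω ^ 2 =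
        ∑ r ∈ A with r 0 = a, f r ω ^ 2 := fun a => by
      rw [← Finset.sum_fiberwise_of_maps_to (g := fun r => r 1) (t := S1)
        (fun r hr => Finset.mem_image_of_mem _ (Finset.mem_filter.1 hr).1)
        (fun r => f r ω ^ 2)]
      simp only [Finset.filter_filter]
    simp only [e2]
    rw [Finset.sum_fiberwise_of_maps_to (g := fun r : Fin 3 → ℕ => r 0) (t := S0)
      (fun r hr => Finset.mem_image_of_mem _ hr) (fun r => f r ω ^ 2),
      Finset.sum_congr rfl fun r hr => hf.sq (hA r hr) ω]
    simp
  simp only [h3, avg_const] at h2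
  simp only [← e1] at h2
  simp only [← e0] at h1
  calc _ ≤ _ := h1
    _ ≤ (2 * (m : ℝ) ^ 2) ^ m * ((2 * (m : ℝ) ^ 2) ^ m * (A.card : ℝ) ^ m) := by gcongr
    _ = _ := by rw [← mul_pow, ← mul_pow]; ring_nf

/-- Off-diagonal sums in the estimate for coinciding scales. -/
theorem avg_offdiag_pow_le (T : ℕ → Equiv.Perm Ω) [Nonempty Ω] (S : Finset ℕ) (χ : ℕ → ℝ)
    (hχ : ∀ s, |χ s| ≤ 1) (h : ℕ → ℕ → Ω → ℝ) (hh : ∀ c s ω, |h c s ω| ≤ 1)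
    (hzero : ∀ c s, n < c + s → ∀ ω, h c s ω = 0)
    (hinv : ∀ c s l, n < c + s + l → ∀ ω, h c s (T l ω) = h c s ω)
    (hodd : ∀ c s l, c + s + l = n → ∀ ω, h c s (T l ω) = -h c s ω)
    {c c' : ℕ} (hc : c < c') (m : ℕ) :
    avg (fun ω => (∑ s ∈ S, χ s * (h c s ω * h c' s ω)) ^ (2 * m)) ≤
      (2 * (m : ℝ) ^ 2 * S.card) ^ m := by
  have e : ∀ ω, ∑ s ∈ S, χ s * (h c s ω * h c' s ω) =
      ∑ s ∈ S with c + s ≤ n, χ s * (h c s ω * h c' s ω) := by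
    intro ω
    rw [Finset.sum_filter]
    refine Finset.sum_congr rfl fun s _ => ?_
    split_ifs with hs
    · rfl
    · rw [hzero c s (by omega)]; ring
  simp only [e]
  -- As `c < c'`, the finer digit of the product is `n - c - s`, contributed by `h c s` alone.
  -- Distinct `s` give distinct digits because the truncated subtraction is exact on the filtered
  -- set.
  refine (_root_.avg_sum_pow_le T _ (fun s => n - c - s) ?_ _ ?_ ?_ m).trans ?_
  · intro s hs s' hs' hss
    simp only [Finset.coe_filter, Set.mem_ofPred_eq] at hs hs'
    simp only at hss
    omega
  · intro s hs ω
    have := (Finset.mem_filter.1 hs).2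
    rw [hodd c s _ (by omega), hinv c' s _ (by omega)]
    ring
  · intro s hs l hl ω
    have := (Finset.mem_filter.1 hs).2
    rw [hinv c s _ (by omega), hinv c' s _ (by omega)]
  · rw [mul_pow _ (S.card : ℝ)]
    gcongr
    refine avg_le_of_le fun ω => ?_
    refine pow_le_pow_left₀ (Finset.sum_nonneg fun _ _ => sq_nonneg _) ?_ m
    refine (Finset.sum_le_card_nsmul _ _ 1 fun s _ => ?_).trans ?_
    · rw [sq_le_one_iff_abs_le_one, abs_mul, abs_mul]
      exact mul_le_one₀ (hχ s) (by positivity)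
        (mul_le_one₀ (hh c s ω) (abs_nonneg _) (hh c' s ω))
    · rw [nsmul_one]
      exact_mod_cast Finset.card_filter_le _ _

/-- Cauchy–Schwarz against the constant 1; it also covers odd `m`. -/
theorem avg_abs_pow_le_of_avg_pow_two_mul_le [Nonempty Ω] {Y : Ω → ℝ} {v τ : ℝ} {m : ℕ}
    (hY : avg (fun ω => Y ω ^ (2 * m)) ≤ v ^ m) (hv : 0 ≤ v) (hτ : 0 ≤ τ) (hvτ : v ≤ τ ^ 2) :
    avg (fun ω => |Y ω| ^ m) ≤ τ ^ m := by
  have h := avg_mul_sq_le (fun ω => |Y ω| ^ m) (fun _ => 1)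
  simp only [mul_one, one_pow, avg_const, ← pow_mul] at h
  have e : ∀ ω, |Y ω| ^ (m * 2) = Y ω ^ (2 * m) := fun ω => by
    rw [mul_comm, pow_mul, sq_abs, ← pow_mul]
  simp only [e] at h
  refine le_of_sq_le_sq ?_ (by positivity)
  calc _ ≤ _ := h
    _ ≤ v ^ m := hY
    _ ≤ (τ ^ 2) ^ m := by gcongr
    _ = _ := by rw [← pow_mul, ← pow_mul, mul_comm]

/-- The power mean inequality, which needs no independence between the summands. -/
theorem avg_sum_pow_le_card_mul [Nonempty Ω] {ι : Type*} (I : Finset ι) (Y : ι → Ω → ℝ)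
    (hY0 : ∀ i ω, 0 ≤ Y i ω) {τ : ℝ} {m : ℕ} (hm : m ≠ 0)
    (hY : ∀ i ∈ I, avg (fun ω => Y i ω ^ m) ≤ τ ^ m) :
    avg (fun ω => (∑ i ∈ I, Y i ω) ^ m) ≤ (I.card * τ) ^ m := by
  obtain ⟨m, rfl⟩ := Nat.exists_eq_succ_of_ne_zero hm
  rcases I.eq_empty_or_nonempty with rfl | hI
  · simp [avg]
  have hc : (0 : ℝ) < I.card := by exact_mod_cast hI.card_pos
  calc avg (fun ω => (∑ i ∈ I, Y i ω) ^ (m + 1))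
      ≤ avg (fun ω => (I.card : ℝ) ^ m * ∑ i ∈ I, Y i ω ^ (m + 1)) := by
        refine avg_mono fun ω => ?_
        have := pow_sum_div_card_le_sum_pow (s := I) (f := fun i => Y i ω)
          (fun i _ => hY0 i ω) m
        rwa [div_le_iff₀' (by positivity)] at this
    _ = (I.card : ℝ) ^ m * ∑ i ∈ I, avg (fun ω => Y i ω ^ (m + 1)) := by
        rw [avg_const_mul, avg_sum]
    _ ≤ (I.card : ℝ) ^ m * ∑ i ∈ I, τ ^ (m + 1) := by
        gcongr with i hi
        exact hY i hi
    _ = _ := by rw [Finset.sum_const, nsmul_eq_mul, mul_pow, Nat.succ_eq_add_one]; ring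

/-- Gain from coinciding scales: the functions `g c κ`, `h c σ` stand for sign functions of the
scales `(n - c - κ, c, κ)` and `(σ, c, n - c - σ)`, which share the coordinate `c`. -/
theorem avg_coincidence_pow_le [Nonempty Ω] (Tj Tk : ℕ → Equiv.Perm Ω) (C K S : Finset ℕ)
    (χ : ℕ → ℕ → ℕ → ℝ) (hχ : ∀ c κ s, |χ c κ s| ≤ 1)
    (hχ0 : ∀ c κ s, χ c κ s ≠ 0 → n < c + κ + s)
    (g h : ℕ → ℕ → Ω → ℝ)
    (hg : ∀ c κ ω, |g c κ ω| ≤ 1) (hh : ∀ c s ω, |h c s ω| ≤ 1)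
    (hgj : ∀ c κ l, n < c + κ + l → ∀ ω, g c κ (Tj l ω) = g c κ ω)
    (hgk : ∀ c κ l, κ < l → ∀ ω, g c κ (Tk l ω) = g c κ ω)
    (hgk' : ∀ c κ ω, g c κ (Tk κ ω) = -g c κ ω)
    (hhj : ∀ c s l, s < l → ∀ ω, h c s (Tj l ω) = h c s ω)
    (hhj' : ∀ c s ω, h c s (Tj s ω) = -h c s ω)
    (hzero : ∀ c s, n < c + s → ∀ ω, h c s ω = 0)
    (hhk : ∀ c s l, n < c + s + l → ∀ ω, h c s (Tk l ω) = h c s ω)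
    (hhk' : ∀ c s l, c + s + l = n → ∀ ω, h c s (Tk l ω) = -h c s ω)
    {m : ℕ} (hm : m ≠ 0) {τ : ℝ} (hτ : 0 ≤ τ) (hτS : 2 * (m : ℝ) ^ 2 * S.card ≤ τ ^ 2) :
    avg (fun ω => (∑ s ∈ S, ∑ κ ∈ K, ∑ c ∈ C, χ c κ s * (g c κ ω * h c s ω)) ^ (2 * m)) ≤
      (8 * (m : ℝ) ^ 4 * (C.card * K.card * S.card + C.card ^ 2 * K.card * τ)) ^ m := by
  classical
  -- Where `χ` is nonzero, `n < c + κ + s`. So the finer digit is `s`, from `h`, in direction `Tj`,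
  -- and `κ`, from `g`, in direction `Tk`. Taking square functions in both directions leaves only
  -- the sum over `c` inside the square.
  have h1 := _root_.avg_sum_pow_le Tj S id Function.injective_id.injOn
    (fun s ω => ∑ κ ∈ K, ∑ c ∈ C, χ c κ s * (g c κ ω * h c s ω))
    (fun s _ ω => by
      simp only [← Finset.sum_neg_distrib]
      refine Finset.sum_congr rfl fun κ _ => Finset.sum_congr rfl fun c _ => ?_
      by_cases h0 : χ c κ s = 0
      · simp [h0]
      · rw [id, hgj c κ s (hχ0 c κ s h0), hhj']; ring)
    (fun s _ l hl ω => by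
      refine Finset.sum_congr rfl fun κ _ => Finset.sum_congr rfl fun c _ => ?_
      by_cases h0 : χ c κ s = 0
      · simp [h0]
      · have := hχ0 c κ s h0
        rw [id] at hl
        rw [hgj c κ l (by omega), hhj c s l hl]) m
  have h2 := avg_pow_le_avg_square_pow Tk K id Function.injective_id.injOn S
    (fun κ s ω => ∑ c ∈ C, χ c κ s * (g c κ ω * h c s ω))
    (fun κ _ s _ ω => by
      simp only [← Finset.sum_neg_distrib]
      refine Finset.sum_congr rfl fun c _ => ?_
      by_cases h0 : χ c κ s = 0
      · simp [h0]
      · have := hχ0 c κ s h0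
        rw [id, hgk', hhk c s κ (by omega)]; ring)
    (fun κ _ s _ l hl ω => by
      refine Finset.sum_congr rfl fun c _ => ?_
      by_cases h0 : χ c κ s = 0
      · simp [h0]
      · have := hχ0 c κ s h0
        rw [id] at hl
        rw [hgk c κ l hl, hhk c s l (by omega)]) m
  set Y : (ℕ × ℕ) × ℕ → Ω → ℝ := fun i ω =>
    ∑ s ∈ S, (χ i.1.1 i.2 s * χ i.1.2 i.2 s) * (h i.1.1 s ω * h i.1.2 s ω) with hYdef
  set I := C.offDiag ×ˢ K
  set D : ℝ := C.card * K.card * S.card with hD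
  -- Expanding the square in `c`, the diagonal is bounded trivially by `D`. Off the diagonal the
  -- factors `g` do not depend on `s` and are bounded by 1, so the cancellation in `s` is kept in
  -- `Y`.
  have hpt : ∀ ω, ∑ κ ∈ K, ∑ s ∈ S, (∑ c ∈ C, χ c κ s * (g c κ ω * h c s ω)) ^ 2 ≤
      D + ∑ i ∈ I, |Y i ω| := by
    intro ω
    have ex : ∀ κ, ∑ s ∈ S, (∑ c ∈ C, χ c κ s * (g c κ ω * h c s ω)) ^ 2 =
        ∑ p ∈ C ×ˢ C, g p.1 κ ω * g p.2 κ ω * Y (p, κ) ω := by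
      intro κ
      simp only [pow_two, Finset.sum_mul_sum]
      rw [Finset.sum_comm, Finset.sum_product]
      simp only [hYdef, Finset.mul_sum]
      refine Finset.sum_congr rfl fun c _ => ?_
      rw [Finset.sum_comm]
      refine Finset.sum_congr rfl fun c' _ => Finset.sum_congr rfl fun s _ => ?_
      ring
    have hle : ∀ c c' κ, g c κ ω * g c' κ ω * Y ((c, c'), κ) ω ≤ |Y ((c, c'), κ) ω| := by
      intro c c' κ
      refine (le_abs_self _).trans ?_
      rw [abs_mul, abs_mul]
      exact mul_le_of_le_one_left (abs_nonneg _)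
        (mul_le_one₀ (hg _ _ _) (abs_nonneg _) (hg _ _ _))
    have hS : ∀ c c' κ, |Y ((c, c'), κ) ω| ≤ S.card := by
      intro c c' κ
      refine (Finset.abs_sum_le_sum_abs _ _).trans ?_
      refine (Finset.sum_le_card_nsmul _ _ 1 fun s _ => ?_).trans (by simp)
      rw [abs_mul, abs_mul, abs_mul]
      exact mul_le_one₀ (mul_le_one₀ (hχ _ _ _) (abs_nonneg _) (hχ _ _ _)) (by positivity)
        (mul_le_one₀ (hh _ _ _) (abs_nonneg _) (hh _ _ _))
    have e2 : ∑ i ∈ I, |Y i ω| = ∑ κ ∈ K, ∑ p ∈ C.offDiag, |Y (p, κ) ω| := by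
      rw [Finset.sum_product, Finset.sum_comm]
    have e3 : D = ∑ κ ∈ K, ∑ c ∈ C.diag, (S.card : ℝ) := by
      simp [hD]; ring
    rw [e2, e3, ← Finset.sum_add_distrib]
    refine Finset.sum_le_sum fun κ _ => ?_
    rw [ex, ← Finset.diag_union_offDiag, Finset.sum_union (Finset.disjoint_diag_offDiag C)]
    exact add_le_add (Finset.sum_le_sum fun p _ => (hle p.1 p.2 κ).trans (hS _ _ _))
      (Finset.sum_le_sum fun p _ => hle p.1 p.2 κ)
  have hY : ∀ i ∈ I, avg (fun ω => |Y i ω| ^ m) ≤ τ ^ m := by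
    rintro ⟨⟨c, c'⟩, κ⟩ hi
    have hne : c ≠ c' := (Finset.mem_offDiag.1 (Finset.mem_product.1 hi).1).2.2
    refine avg_abs_pow_le_of_avg_pow_two_mul_le (v := 2 * (m : ℝ) ^ 2 * S.card) ?_
      (by positivity) hτ hτS
    have hχχ : ∀ s, |χ c κ s * χ c' κ s| ≤ 1 := fun s => by
      rw [abs_mul]; exact mul_le_one₀ (hχ _ _ _) (abs_nonneg _) (hχ _ _ _)
    rcases lt_or_gt_of_ne hne with hlt | hlt
    · exact avg_offdiag_pow_le Tk S _ hχχ h hh hzero hhk hhk' hlt m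
    · have := avg_offdiag_pow_le Tk S _ hχχ h hh hzero hhk hhk' hlt m
      simpa only [hYdef, mul_comm (h c' _ _)] using this
  have h3 := avg_sum_pow_le_card_mul I (fun i ω => |Y i ω|) (fun _ _ => abs_nonneg _) hm hY
  have hIc : (I.card : ℝ) ≤ C.card ^ 2 * K.card := by
    rw [Finset.card_product, Nat.cast_mul]
    gcongr
    rw [Finset.offDiag_card]
    exact_mod_cast (Nat.sub_le _ _).trans (by rw [pow_two])
  have h4 : avg (fun ω => (∑ κ ∈ K, ∑ s ∈ S, (∑ c ∈ C, χ c κ s * (g c κ ω * h c s ω)) ^ 2) ^ m) ≤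
      (2 * (D + C.card ^ 2 * K.card * τ)) ^ m := by
    have hD0 : 0 ≤ D := by positivity
    calc _ ≤ avg (fun ω => 2 ^ (m - 1) * (D ^ m + (∑ i ∈ I, |Y i ω|) ^ m)) := by
          refine avg_mono fun ω => (pow_le_pow_left₀ (Finset.sum_nonneg fun _ _ =>
            Finset.sum_nonneg fun _ _ => sq_nonneg _) (hpt ω) m).trans ?_
          exact add_pow_le hD0 (Finset.sum_nonneg fun _ _ => abs_nonneg _) m
      _ = 2 ^ (m - 1) * (D ^ m + avg fun ω => (∑ i ∈ I, |Y i ω|) ^ m) := by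
          rw [avg_const_mul, avg_add, avg_const]
      _ ≤ 2 ^ (m - 1) * ((D + C.card ^ 2 * K.card * τ) ^ m +
            (D + C.card ^ 2 * K.card * τ) ^ m) := by
          gcongr
          · exact le_add_of_nonneg_right (by positivity)
          · refine h3.trans ?_
            gcongr
            refine (mul_le_mul_of_nonneg_right hIc hτ).trans (le_add_of_nonneg_left hD0)
      _ = _ := by
          obtain ⟨m, rfl⟩ := Nat.exists_eq_succ_of_ne_zero hm
          rw [mul_pow 2, Nat.succ_eq_add_one, Nat.add_sub_cancel]
          ring
  calc _ ≤ _ := h1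
    _ ≤ (2 * (m : ℝ) ^ 2) ^ m * ((2 * (m : ℝ) ^ 2) ^ m *
        (2 * (D + C.card ^ 2 * K.card * τ)) ^ m) := by
        gcongr
        exact h2.trans (by gcongr)
    _ = _ := by rw [← mul_pow, ← mul_pow, hD]; ring_nf

end HaarFamilies

/-! ### Riesz products over blocks of the first coordinate -/

section RieszProducts

variable {Ω : Type*} {T : Fin 3 → ℕ → Equiv.Perm Ω} {n : ℕ} {f : (Fin 3 → ℕ) → Ω → ℝ}

theorem sum_coords {i j k : Fin 3} (hij : i ≠ j) (hik : i ≠ k) (hjk : j ≠ k) (r : Fin 3 → ℕ) :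
    ∑ x, r x = r i + r j + r k := by
  rw [Fin.sum_univ_three]
  fin_cases i <;> fin_cases j <;> fin_cases k <;> simp at * <;> omega

/-- The scale with coordinates `a` at `i`, `c` at `k`, and `b` at the remaining place. -/
def mkScale (i k : Fin 3) (a b c : ℕ) : Fin 3 → ℕ :=
  fun x => if x = i then a else if x = k then c else b

theorem eq_mkScale {i j k : Fin 3} (hij : i ≠ j) (hik : i ≠ k) (hjk : j ≠ k)
    (r : Fin 3 → ℕ) : r = mkScale i k (r i) (r j) (r k) := by
  ext x
  have hx : x = i ∨ x = j ∨ x = k := by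
    fin_cases i <;> fin_cases j <;> fin_cases k <;> fin_cases x <;> simp at *
  unfold mkScale
  rcases hx with rfl | rfl | rfl
  · simp
  · simp [hij.symm, hjk]
  · simp [hik.symm]

/-- The sum of the functions whose scales lie in `A`. -/
noncomputable def signSum (f : (Fin 3 → ℕ) → Ω → ℝ) (A : Finset (Fin 3 → ℕ)) (ω : Ω) : ℝ :=
  ∑ r ∈ A, f r ω

/-- The sets `A w` consist of scales of order `n` whose first coordinate lies in block `w`. -/
def IsBlocked (n : ℕ) (blk : ℕ → ℕ) (A : ℕ → Finset (Fin 3 → ℕ)) : Prop :=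
  ∀ w, ∀ r ∈ A w, ∑ i, r i = n ∧ blk (r 0) = w

/-- The Riesz product over the blocks in `W`. -/
noncomputable def rieszProd (f : (Fin 3 → ℕ) → Ω → ℝ) (ρ : ℝ) (ε : ℕ → ℝ)
    (A : ℕ → Finset (Fin 3 → ℕ)) (W : Finset ℕ) (ω : Ω) : ℝ :=
  ∏ w ∈ W, (ε w + ρ * signSum f (A w) ω)

variable {blk : ℕ → ℕ} {A : ℕ → Finset (Fin 3 → ℕ)} {ρ : ℝ} {ε : ℕ → ℝ}

theorem rieszProd_inv (hf : IsSignFamily T n f) (hA : IsBlocked n blk A) (W : Finset ℕ)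
    (i : Fin 3) (l : ℕ) (hl : ∀ w ∈ W, ∀ r ∈ A w, r i < l) (ω : Ω) :
    rieszProd f ρ ε A W (T i l ω) = rieszProd f ρ ε A W ω := by
  refine Finset.prod_congr rfl fun w hw => ?_
  congr 2
  exact Finset.sum_congr rfl fun r hr => hf.inv (hA w r hr).1 i (hl w hw r hr) ω

theorem IsBlocked.lt (hA : IsBlocked n blk A) (hblk : Monotone blk) {w w' : ℕ} (h : w < w')
    {r s : Fin 3 → ℕ} (hr : r ∈ A w) (hs : s ∈ A w') : r 0 < s 0 := by
  refine hblk.reflect_lt ?_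
  rw [(hA w r hr).2, (hA w' s hs).2]
  exact h

variable [Fintype Ω]

/-- Moments of sums over pairs of scales that coincide in coordinate `i`. -/
theorem IsSignFamily.avg_pair_pow_le [Nonempty Ω] (hf : IsSignFamily T n f) {i j k : Fin 3}
    (hij : i ≠ j) (hik : i ≠ k) (hjk : j ≠ k) (E : Finset ((Fin 3 → ℕ) × (Fin 3 → ℕ)))
    (hE : ∀ p ∈ E, ∑ x, p.1 x = n ∧ ∑ x, p.2 x = n ∧ p.1 i = p.2 i ∧ p.1 j < p.2 j)
    (C K : Finset ℕ) (hC : ∀ p ∈ E, p.1 i ∈ C) (hK : ∀ p ∈ E, p.1 k ∈ K)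
    {m : ℕ} (hm : m ≠ 0) {τ : ℝ} (hτ : 0 ≤ τ) (hτS : 2 * (m : ℝ) ^ 2 * (n + 1) ≤ τ ^ 2) :
    avg (fun ω => (∑ p ∈ E, f p.1 ω * f p.2 ω) ^ (2 * m)) ≤
      (8 * (m : ℝ) ^ 4 * (C.card * K.card * (n + 1) + C.card ^ 2 * K.card * τ)) ^ m := by
  classical
  -- The two scales of a pair are parametrized by the common coordinate `c`, by `κ = p.1 k` and by
  -- `s = p.2 j`. Extension by zero makes the invariance and oddness hypotheses hold for all
  -- indices.
  set g : ℕ → ℕ → Ω → ℝ := fun c κ ω =>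
    if c + κ ≤ n then f (mkScale i k c (n - c - κ) κ) ω else 0 with hg
  set h : ℕ → ℕ → Ω → ℝ := fun c s ω =>
    if c + s ≤ n then f (mkScale i k c s (n - c - s)) ω else 0 with hh
  set χ : ℕ → ℕ → ℕ → ℝ := fun c κ s =>
    if (mkScale i k c (n - c - κ) κ, mkScale i k c s (n - c - s)) ∈ E then 1 else 0 with hχ
  have vi : ∀ a b c, mkScale i k a b c i = a := fun a b c => by simp [mkScale]
  have vk : ∀ a b c, mkScale i k a b c k = c := fun a b c => by simp [mkScale, hik.symm]
  have vj : ∀ a b c, mkScale i k a b c j = b := fun a b c => by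
    simp [mkScale, hij.symm, hjk]
  have vs : ∀ a b c, ∑ x, mkScale i k a b c x = a + b + c := fun a b c => by
    rw [sum_coords hij hik hjk, vi, vj, vk]
  have hsg : ∀ c κ, c + κ ≤ n → ∑ x, mkScale i k c (n - c - κ) κ x = n := fun c κ h => by
    rw [vs]; omega
  have hsh : ∀ c s, c + s ≤ n → ∑ x, mkScale i k c s (n - c - s) x = n := fun c κ h => by
    rw [vs]; omega
  have main := avg_coincidence_pow_le (n := n) (T j) (T k) C K (Finset.range (n + 1)) χ
    (fun c κ s => by simp only [hχ]; split_ifs <;> simp)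
    (fun c κ s h0 => by
      simp only [hχ, ne_eq, ite_eq_right_iff, one_ne_zero, imp_false, not_not] at h0
      obtain ⟨h1, h2, _, h4⟩ := hE _ h0
      simp only [vs, vj] at h1 h2 h4
      omega) g h
    (fun c κ ω => by
      simp only [hg]; split_ifs with h0
      · exact hf.abs_le (hsg c κ h0) ω
      · simp)
    (fun c κ ω => by
      simp only [hh]; split_ifs with h0
      · exact hf.abs_le (hsh c κ h0) ω
      · simp)
    (fun c κ l hl ω => by
      simp only [hg]; split_ifs with h0
      · exact hf.inv (hsg c κ h0) j (by rw [vj]; omega) ω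
      · rfl)
    (fun c κ l hl ω => by
      simp only [hg]; split_ifs with h0
      · exact hf.inv (hsg c κ h0) k (by rw [vk]; omega) ω
      · rfl)
    (fun c κ ω => by
      simp only [hg]; split_ifs with h0
      · exact hf.odd' (hsg c κ h0) k (by rw [vk]) ω
      · simp)
    (fun c κ l hl ω => by
      simp only [hh]; split_ifs with h0
      · exact hf.inv (hsh c κ h0) j (by rw [vj]; omega) ω
      · rfl)
    (fun c κ ω => by
      simp only [hh]; split_ifs with h0
      · exact hf.odd' (hsh c κ h0) j (by rw [vj]) ω
      · simp)
    (fun c s hs ω => by simp only [hh]; rw [if_neg (by omega)])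
    (fun c κ l hl ω => by
      simp only [hh]; split_ifs with h0
      · exact hf.inv (hsh c κ h0) k (by rw [vk]; omega) ω
      · rfl)
    (fun c κ l hl ω => by
      simp only [hh]; split_ifs with h0
      · exact hf.odd' (hsh c κ h0) k (by rw [vk]; omega) ω
      · simp)
    hm hτ (by simpa using hτS)
  have e : ∀ ω, ∑ p ∈ E, f p.1 ω * f p.2 ω =
      ∑ s ∈ Finset.range (n + 1), ∑ κ ∈ K, ∑ c ∈ C, χ c κ s * (g c κ ω * h c s ω) := by
    intro ω
    rw [← Finset.sum_product', ← Finset.sum_product']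
    simp only [hχ, ite_mul, one_mul, zero_mul]
    rw [← Finset.sum_filter]
    have hp : ∀ p ∈ E, mkScale i k (p.1 i) (n - p.1 i - p.1 k) (p.1 k) = p.1 ∧
        mkScale i k (p.1 i) (p.2 j) (n - p.1 i - p.2 j) = p.2 := by
      intro p hp
      obtain ⟨h1, h2, h3, h4⟩ := hE p hp
      rw [sum_coords hij hik hjk] at h1 h2
      constructor
      · conv_rhs => rw [eq_mkScale hij hik hjk p.1]
        congr 1; omega
      · conv_rhs => rw [eq_mkScale hij hik hjk p.2]
        rw [h3]
        congr 1; omega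
    refine Finset.sum_nbij' (fun p => ((p.2 j, p.1 k), p.1 i))
      (fun x => (mkScale i k x.2 (n - x.2 - x.1.2) x.1.2,
        mkScale i k x.2 x.1.1 (n - x.2 - x.1.1))) ?_ ?_ ?_ ?_ ?_
    · intro p hpE
      obtain ⟨h1, h2, h3, h4⟩ := hE p hpE
      rw [sum_coords hij hik hjk] at h1 h2
      simp only [Finset.mem_filter, Finset.mem_product, Finset.mem_range]
      refine ⟨⟨⟨by omega, hK p hpE⟩, hC p hpE⟩, ?_⟩
      rw [(hp p hpE).1, (hp p hpE).2]
      exact hpE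
    · intro x hx
      exact (Finset.mem_filter.1 hx).2
    · intro p hpE
      exact Prod.ext (hp p hpE).1 (hp p hpE).2
    · intro x hx
      simp [vi, vj, vk]
    · intro p hpE
      obtain ⟨h1, h2, h3, h4⟩ := hE p hpE
      rw [sum_coords hij hik hjk] at h1 h2
      simp only [hg, hh, (hp p hpE).1, (hp p hpE).2]
      rw [if_pos (by omega), if_pos (by omega)]
  simp only [e]
  simpa using main

/-- Blocks are removed from the last down. Flipping digit `r 0` for a scale `r` of the last block
fixes `g` and all earlier blocks and negates `f r`, so each block contributes only its constant `ε
w`. -/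
theorem avg_mul_rieszProd (hf : IsSignFamily T n f) (hblk : Monotone blk)
    (hA : IsBlocked n blk A) (W : Finset ℕ) (g : Ω → ℝ)
    (hg : ∀ w ∈ W, ∀ r ∈ A w, ∀ ω, g (T 0 (r 0) ω) = g ω) :
    avg (fun ω => g ω * rieszProd f ρ ε A W ω) = avg g * ∏ w ∈ W, ε w := by
  induction W using Finset.induction_on_max with
  | empty => simp [rieszProd]
  | insert w W hmax ih =>
    have hw : w ∉ W := fun h => lt_irrefl _ (hmax w h)
    have e : ∀ ω, g ω * rieszProd f ρ ε A (insert w W) ω =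
        ε w * (g ω * rieszProd f ρ ε A W ω) +
          ∑ r ∈ A w, ρ * (g ω * rieszProd f ρ ε A W ω * f r ω) := by
      intro ω
      rw [rieszProd, Finset.prod_insert hw, ← Finset.mul_sum, ← Finset.mul_sum]
      simp only [rieszProd, signSum]
      ring
    simp only [e]
    rw [avg_add, avg_const_mul, avg_sum, ih fun w' hw' => hg w' (by simp [hw']),
      Finset.prod_insert hw, Finset.sum_eq_zero, add_zero]
    · ring
    · intro r hr
      rw [avg_const_mul, avg_eq_zero_of_odd (T 0 (r 0)), mul_zero]
      intro ω
      rw [hg w (by simp) r hr, hf.odd (hA w r hr).1,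
        rieszProd_inv hf hA W 0 (r 0) fun w' hw' s hs => hA.lt hblk (hmax w' hw') hs hr]
      ring

theorem avg_rieszProd [Nonempty Ω] (hf : IsSignFamily T n f) (hblk : Monotone blk)
    (hA : IsBlocked n blk A) (W : Finset ℕ) :
    avg (rieszProd f ρ ε A W) = ∏ w ∈ W, ε w := by
  have := avg_mul_rieszProd (ρ := ρ) (ε := ε) hf hblk hA W (fun _ => 1) (fun _ _ _ _ _ => rfl)
  simpa [avg_const] using this

/-- The sum over distinct pairs in `A` with the same first coordinate. -/
noncomputable def pairSum (f : (Fin 3 → ℕ) → Ω → ℝ) (A : Finset (Fin 3 → ℕ)) (ω : Ω) : ℝ :=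
  ∑ p ∈ (A ×ˢ A) with p.1 0 = p.2 0 ∧ p.1 1 < p.2 1, f p.1 ω * f p.2 ω

/-- Two scales with different first coordinates are orthogonal through the larger one. Distinct
scales with equal first coordinates have different second coordinates, so they occur in `pairSum` in
exactly one order. -/
theorem avg_mul_signSum_sq [Nonempty Ω] (hf : IsSignFamily T n f) (A : Finset (Fin 3 → ℕ))
    (hA : ∀ r ∈ A, ∑ i, r i = n) (g : Ω → ℝ)
    (hg : ∀ r ∈ A, ∀ ω, g (T 0 (r 0) ω) = g ω) :
    avg (fun ω => g ω * signSum f A ω ^ 2) =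
      A.card * avg g + 2 * avg fun ω => g ω * pairSum f A ω := by
  classical
  have e1 : avg (fun ω => g ω * signSum f A ω ^ 2) =
      ∑ p ∈ A ×ˢ A, avg fun ω => g ω * (f p.1 ω * f p.2 ω) := by
    rw [← avg_sum]
    congr 1; ext ω
    rw [pow_two, signSum, Finset.sum_mul_sum, ← Finset.sum_product', Finset.mul_sum]
  have hlt : ∀ r s, r ∈ A → s ∈ A → r 0 < s 0 →
      avg (fun ω => g ω * (f r ω * f s ω)) = 0 := by
    intro r s hr hs h
    refine avg_eq_zero_of_odd (T 0 (s 0)) fun ω => ?_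
    rw [hg s hs, hf.inv (hA r hr) 0 h, hf.odd (hA s hs)]
    ring
  have hcm : ∀ r s, avg (fun ω => g ω * (f r ω * f s ω)) =
      avg (fun ω => g ω * (f s ω * f r ω)) := fun r s => by simp only [mul_comm (f r _)]
  have hsq : ∀ r ∈ A, avg (fun ω => g ω * (f r ω * f r ω)) = avg g := fun r hr => by
    simp only [← pow_two, hf.sq (hA r hr), mul_one]
  have hval : ∀ p ∈ A ×ˢ A, avg (fun ω => g ω * (f p.1 ω * f p.2 ω)) =
      (if p.1 = p.2 then avg g else 0) +
        ((if p.1 0 = p.2 0 ∧ p.1 1 < p.2 1 then avg (fun ω => g ω * (f p.1 ω * f p.2 ω)) else 0) +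
        (if p.2 0 = p.1 0 ∧ p.2 1 < p.1 1 then avg (fun ω => g ω * (f p.2 ω * f p.1 ω)) else 0)) := by
    rintro ⟨r, s⟩ hp
    obtain ⟨hr, hs⟩ := Finset.mem_product.1 hp
    simp only at hr hs ⊢
    by_cases h0 : r 0 = s 0
    · rcases lt_trichotomy (r 1) (s 1) with h | h | h
      · have : r ≠ s := fun h' => by rw [h'] at h; exact lt_irrefl _ h
        simp [this, h0, h, h.le]
      · have : r = s := eq_of_two_coords (hA r hr) (hA s hs) h0 h
        subst this
        simp [hsq r hr]
      · have : r ≠ s := fun h' => by rw [h'] at h; exact lt_irrefl _ h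
        rw [hcm]
        simp [this, h0, h, h.le]
    · have : r ≠ s := fun h' => h0 (by rw [h'])
      simp only [this, h0, Ne.symm h0, if_false, false_and, add_zero]
      rcases lt_or_gt_of_ne h0 with h | h
      · exact hlt r s hr hs h
      · rw [hcm]; exact hlt s r hs hr h
  rw [e1, Finset.sum_congr rfl hval, Finset.sum_add_distrib, Finset.sum_add_distrib]
  have e2 : ∑ p ∈ A ×ˢ A, (if p.1 = p.2 then avg g else 0) = A.card * avg g := by
    rw [Finset.sum_product]
    simp
  have e3 : ∑ p ∈ A ×ˢ A, (if p.1 0 = p.2 0 ∧ p.1 1 < p.2 1 then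
      avg (fun ω => g ω * (f p.1 ω * f p.2 ω)) else 0) = avg fun ω => g ω * pairSum f A ω := by
    rw [← Finset.sum_filter, ← avg_sum]
    simp only [pairSum, Finset.mul_sum]
  have e4 : ∑ p ∈ A ×ˢ A, (if p.2 0 = p.1 0 ∧ p.2 1 < p.1 1 then
      avg (fun ω => g ω * (f p.2 ω * f p.1 ω)) else 0) = avg fun ω => g ω * pairSum f A ω := by
    rw [← e3, Finset.sum_product, Finset.sum_comm, ← Finset.sum_product']
  rw [e2, e3, e4]
  ring

end RieszProducts

/-! ### First and second moments of Riesz products -/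

section RieszMoments

variable {Ω : Type*} {T : Fin 3 → ℕ → Equiv.Perm Ω} {n : ℕ}
  {f : (Fin 3 → ℕ) → Ω → ℝ} {blk : ℕ → ℕ} {A : ℕ → Finset (Fin 3 → ℕ)} {ρ : ℝ}

theorem abs_signSum_le (hf : IsSignFamily T n f) (A : Finset (Fin 3 → ℕ))
    (hA : ∀ r ∈ A, ∑ i, r i = n) (ω : Ω) : |signSum f A ω| ≤ A.card := by
  refine (Finset.abs_sum_le_sum_abs _ _).trans ?_
  refine (Finset.sum_le_card_nsmul _ _ 1 fun r hr => hf.abs_le (hA r hr) ω).trans ?_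
  simp

/-- A crude bound, exponential in the number of blocks; it is only used multiplied by a high moment
that outweighs it. -/
theorem abs_rieszProd_le (hf : IsSignFamily T n f) (hA : IsBlocked n blk A) {B : ℝ}
    (hB : ∀ w, 1 + |ρ| * (A w).card ≤ B) (W : Finset ℕ) (ω : Ω) :
    |rieszProd f ρ 1 A W ω| ≤ B ^ W.card := by
  rw [rieszProd, Finset.abs_prod]
  rw [← Finset.prod_const]
  refine Finset.prod_le_prod (fun _ _ => abs_nonneg _) fun w _ =>
    (abs_add_le _ _).trans ((hB w).trans' ?_)
  rw [abs_mul, Pi.one_apply, abs_one]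
  gcongr
  exact abs_signSum_le hf _ (fun r hr => (hA w r hr).1) ω

/-- An emptied block contributes the factor 1, so bounds uniform in `A` for the full product also
apply to subproducts. -/
theorem rieszProd_one_subset (A : ℕ → Finset (Fin 3 → ℕ)) {U W : Finset ℕ} (hU : U ⊆ W) (ω : Ω) :
    rieszProd f ρ 1 A U ω = rieszProd f ρ 1 (fun w => if w ∈ U then A w else ∅) W ω := by
  rw [rieszProd, rieszProd]
  refine (Finset.prod_subset_one_on_sdiff hU (fun w hw => ?_) (fun w hw => ?_))
  · simp [(Finset.mem_sdiff.1 hw).2, signSum]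
  · simp [hw]

variable [Fintype Ω]

theorem IsSignFamily.avg_pairSum_pow_le [Nonempty Ω] (hf : IsSignFamily T n f)
    (A : Finset (Fin 3 → ℕ)) (hA : ∀ r ∈ A, ∑ i, r i = n) {m : ℕ} (hm : m ≠ 0) {τ : ℝ}
    (hτ : 0 ≤ τ) (hτS : 2 * (m : ℝ) ^ 2 * (n + 1) ≤ τ ^ 2) :
    avg (fun ω => pairSum f A ω ^ (2 * m)) ≤
      (8 * (m : ℝ) ^ 4 * (((n : ℝ) + 1) ^ 3 + (n + 1) ^ 3 * τ)) ^ m := by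
  have hle : ∀ r ∈ A, ∀ i, r i < n + 1 := fun r hr i => by
    have := Finset.single_le_sum (f := r) (fun _ _ => Nat.zero_le _) (Finset.mem_univ i)
    rw [hA r hr] at this
    omega
  have h := hf.avg_pair_pow_le (i := 0) (j := 1) (k := 2) (by decide) (by decide) (by decide)
    {p ∈ A ×ˢ A | p.1 0 = p.2 0 ∧ p.1 1 < p.2 1}
    (fun p hp => by
      obtain ⟨hp, h0, h1⟩ := Finset.mem_filter.1 hp
      obtain ⟨hr, hs⟩ := Finset.mem_product.1 hp
      exact ⟨hA _ hr, hA _ hs, h0, h1⟩)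
    (Finset.range (n + 1)) (Finset.range (n + 1))
    (fun p hp => Finset.mem_range.2
      (hle _ (Finset.mem_product.1 (Finset.mem_filter.1 hp).1).1 _))
    (fun p hp => Finset.mem_range.2
      (hle _ (Finset.mem_product.1 (Finset.mem_filter.1 hp).1).1 _)) hm hτ hτS
  refine h.trans_eq ?_
  simp only [Finset.card_range]
  push_cast
  ring_nf

/-- Chebyshev's inequality in pointwise form: an excess over `η` is charged to a high power. -/
theorem le_add_pow_div {y η : ℝ} (hη : 0 < η) {m : ℕ} (hm : m ≠ 0) :
    y ≤ η + y ^ (2 * m) / η ^ (2 * m) * η := by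
  rcases le_total y η with h | h
  · have : 0 ≤ y ^ (2 * m) / η ^ (2 * m) * η := by
      rw [pow_mul]; positivity
    exact le_add_of_le_of_nonneg h this
  · have h1 : 1 ≤ y / η := (one_le_div hη).2 h
    have h2 : y / η ≤ (y / η) ^ (2 * m) := le_self_pow₀ h1 (by omega)
    rw [div_pow] at h2
    have h3 := mul_le_mul_of_nonneg_right h2 hη.le
    rw [div_mul_cancel₀ _ hη.ne'] at h3
    linarith

/-- The second moment of a short Riesz product. -/
theorem avg_rieszProd_sq_le [Nonempty Ω] (hf : IsSignFamily T n f) (hblk : Monotone blk)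
    (hA : IsBlocked n blk A) {q m : ℕ} (hm : m ≠ 0) {x η B τ : ℝ} (hη : 0 < η)
    (hx : ∀ w, ρ ^ 2 * (A w).card ≤ x) (hB : ∀ w, 1 + |ρ| * (A w).card ≤ B)
    (hτ : 0 ≤ τ) (hτS : 2 * (m : ℝ) ^ 2 * (n + 1) ≤ τ ^ 2)
    (hbig : (B ^ q) ^ 2 * (4 * ρ ^ 4 * (8 * (m : ℝ) ^ 4 * (((n : ℝ) + 1) ^ 3 +
      (n + 1) ^ 3 * τ))) ^ m ≤ η ^ (2 * m)) :
    avg (fun ω => rieszProd f ρ 1 A (Finset.range q) ω ^ 2) ≤ (1 + x + 2 * η) ^ q := by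
  have hx0 : 0 ≤ x := (hx 0).trans' (by positivity)
  have hB1 : 1 ≤ B := (hB 0).trans' (le_add_of_nonneg_right (by positivity))
  have key : ∀ t ≤ q, avg (fun ω => rieszProd f ρ 1 A (Finset.range t) ω ^ 2) ≤
      (1 + x + 2 * η) ^ t := by
    intro t
    induction t with
    | zero => intro _; simp [rieszProd, avg_const]
    | succ t ih =>
      intro ht
      have ih' := ih (by omega)
      set P := rieszProd f ρ 1 A (Finset.range t) with hP
      have hPinv : ∀ r ∈ A t, ∀ ω, P (T 0 (r 0) ω) = P ω := fun r hr ω =>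
        rieszProd_inv hf hA _ 0 _
          (fun w hw s hs => hA.lt hblk (Finset.mem_range.1 hw) hs hr) ω
      have e : ∀ ω, rieszProd f ρ 1 A (Finset.range (t + 1)) ω ^ 2 =
          P ω ^ 2 + (2 * ρ * ∑ r ∈ A t, P ω ^ 2 * f r ω +
            ρ ^ 2 * (P ω ^ 2 * signSum f (A t) ω ^ 2)) := by
        intro ω
        rw [rieszProd, Finset.prod_range_succ, ← Finset.mul_sum]
        simp only [hP, rieszProd, signSum, Pi.one_apply]
        ring
      have hz : avg (fun ω => ∑ r ∈ A t, P ω ^ 2 * f r ω) = 0 := by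
        rw [avg_sum]
        refine Finset.sum_eq_zero fun r hr => avg_eq_zero_of_odd (T 0 (r 0)) fun ω => ?_
        rw [hPinv r hr, hf.odd (hA t r hr).1]
        ring
      simp only [e]
      rw [avg_add, avg_add, avg_const_mul, avg_const_mul, hz, mul_zero, zero_add,
        avg_mul_signSum_sq hf (A t) (fun r hr => (hA t r hr).1) (fun ω => P ω ^ 2)
          (fun r hr ω => by simp only [hPinv r hr])]
      have hpair := hf.avg_pairSum_pow_le (A t) (fun r hr => (hA t r hr).1) hm hτ hτS
      set v : ℝ := 8 * (m : ℝ) ^ 4 * (((n : ℝ) + 1) ^ 3 + (n + 1) ^ 3 * τ) with hv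
      have hPb : ∀ ω, P ω ^ 2 ≤ (B ^ q) ^ 2 := fun ω => by
        rw [← sq_abs]
        have := abs_rieszProd_le hf hA hB (Finset.range t) ω
        rw [Finset.card_range] at this
        have h2 : B ^ t ≤ B ^ q := pow_le_pow_right₀ hB1 (by omega)
        exact pow_le_pow_left₀ (abs_nonneg _) (this.trans h2) 2
      -- Where the pair term is at most `η` it costs only a factor near 1. Elsewhere `P ω ^ 2` is
      -- replaced by its supremum, and `hbig` makes the high moment of the pair sum compensate.
      have hG : 2 * ρ ^ 2 * avg (fun ω => P ω ^ 2 * pairSum f (A t) ω) ≤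
          η * avg (fun ω => P ω ^ 2) + η := by
        rw [← avg_const_mul]
        calc _ ≤ avg (fun ω => η * P ω ^ 2 +
              (B ^ q) ^ 2 * (4 * ρ ^ 4) ^ m / η ^ (2 * m) * η * pairSum f (A t) ω ^ (2 * m)) := by
              refine avg_mono fun ω => ?_
              have h1 := le_add_pow_div (y := 2 * ρ ^ 2 * pairSum f (A t) ω) hη hm
              have h2 := mul_le_mul_of_nonneg_left h1 (sq_nonneg (P ω))
              have h3 : 0 ≤ (2 * ρ ^ 2 * pairSum f (A t) ω) ^ (2 * m) / η ^ (2 * m) * η := by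
                rw [pow_mul]; positivity
              have h4 := mul_le_mul_of_nonneg_right (hPb ω) h3
              have h5 : (2 * ρ ^ 2 * pairSum f (A t) ω) ^ (2 * m) =
                  (4 * ρ ^ 4) ^ m * pairSum f (A t) ω ^ (2 * m) := by
                rw [mul_pow, pow_mul (2 * ρ ^ 2)]
                ring_nf
              rw [h5] at h4 h2
              calc _ = P ω ^ 2 * (2 * ρ ^ 2 * pairSum f (A t) ω) := by ring
                _ ≤ _ := h2
                _ ≤ P ω ^ 2 * η + (B ^ q) ^ 2 * ((4 * ρ ^ 4) ^ m *
                    pairSum f (A t) ω ^ (2 * m) / η ^ (2 * m) * η) := by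
                  rw [mul_add]; gcongr
                _ = _ := by ring
          _ = η * avg (fun ω => P ω ^ 2) + (B ^ q) ^ 2 * (4 * ρ ^ 4) ^ m / η ^ (2 * m) * η *
                avg fun ω => pairSum f (A t) ω ^ (2 * m) := by
              rw [avg_add, avg_const_mul, avg_const_mul]
          _ ≤ η * avg (fun ω => P ω ^ 2) + (B ^ q) ^ 2 * (4 * ρ ^ 4) ^ m / η ^ (2 * m) * η *
                v ^ m := by gcongr
          _ = η * avg (fun ω => P ω ^ 2) + ((B ^ q) ^ 2 * (4 * ρ ^ 4 * v) ^ m) / η ^ (2 * m) * η := by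
              rw [mul_pow (4 * ρ ^ 4)]; ring
          _ ≤ η * avg (fun ω => P ω ^ 2) + 1 * η := by
              gcongr
              exact div_le_one_of_le₀ hbig (by positivity)
          _ = _ := by rw [one_mul]
      have h0 : 0 ≤ avg (fun ω => P ω ^ 2) := avg_nonneg fun ω => sq_nonneg _
      have h1 : 1 ≤ (1 + x + 2 * η) ^ t := one_le_pow₀ (by linarith)
      have h2 := mul_le_mul_of_nonneg_right (hx t) h0
      have h3 := mul_le_mul_of_nonneg_left ih' (by positivity : 0 ≤ 1 + x + η)
      rw [pow_succ (1 + x + 2 * η)]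
      nlinarith
  exact key q le_rfl

/-- The first moment of a short Riesz product. -/
theorem avg_abs_rieszProd_le [Nonempty Ω] (hf : IsSignFamily T n f) (hblk : Monotone blk)
    (hA : IsBlocked n blk A) {q m : ℕ} {x y : ℝ} (hx : ∀ w, ρ ^ 2 * (A w).card ≤ x)
    (hy : avg (fun ω => rieszProd f ρ 1 A (Finset.range q) ω ^ 2) ≤ y)
    (hsmall : y * (q * (4 * (m : ℝ) ^ 4 * x) ^ m) ≤ 1 / 4) :
    avg (fun ω => |rieszProd f ρ 1 A (Finset.range q) ω|) ≤ 2 := by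
  have hx0 : 0 ≤ x := (hx 0).trans' (by positivity)
  set P := rieszProd f ρ 1 A (Finset.range q) with hP
  set I : Ω → ℝ := fun ω => if P ω < 0 then 1 else 0 with hI
  have hmean : avg P = 1 := by
    rw [hP, avg_rieszProd hf hblk hA]; simp
  -- Since the mean of `P` is 1, only the negative part has to be bounded.
  have e : ∀ ω, |P ω| = P ω + 2 * (|P ω| * I ω) := by
    intro ω
    simp only [hI]
    split_ifs with h
    · rw [abs_of_neg h]; ring
    · rw [abs_of_nonneg (not_lt.1 h)]; ring
  have hIle : ∀ ω, I ω ^ 2 ≤ ∑ w ∈ Finset.range q, ρ ^ (2 * m) * signSum f (A w) ω ^ (2 * m) := by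
    intro ω
    have h0 : ∀ w ∈ Finset.range q, 0 ≤ ρ ^ (2 * m) * signSum f (A w) ω ^ (2 * m) := fun w _ => by
      rw [pow_mul, pow_mul]; positivity
    simp only [hI]
    split_ifs with h
    -- A negative product has a negative factor, and there `(ρ * signSum f (A w) ω) ^ 2` is at least
    -- 1.
    · have : ∃ w ∈ Finset.range q, 1 + ρ * signSum f (A w) ω < 0 := by
        by_contra hcon
        push Not at hcon
        exact absurd h (not_lt.2 (Finset.prod_nonneg hcon))
      obtain ⟨w, hw, hlt⟩ := this
      refine le_trans ?_ (Finset.single_le_sum h0 hw)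
      rw [← mul_pow, one_pow, pow_mul]
      exact one_le_pow₀ (by nlinarith)
    · simpa using Finset.sum_nonneg h0
  have hIavg : avg (fun ω => I ω ^ 2) ≤ q * (4 * (m : ℝ) ^ 4 * x) ^ m := by
    refine (avg_mono hIle).trans ?_
    rw [avg_sum]
    refine (Finset.sum_le_card_nsmul _ _ ((4 * (m : ℝ) ^ 4 * x) ^ m) fun w _ => ?_).trans ?_
    · rw [avg_const_mul, pow_mul]
      have := hf.avg_sum_pow_le (A w) (fun r hr => (hA w r hr).1) m
      calc _ ≤ (ρ ^ 2) ^ m * (4 * (m : ℝ) ^ 4 * (A w).card) ^ m := by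
            gcongr; exact this
        _ = (4 * (m : ℝ) ^ 4 * (ρ ^ 2 * (A w).card)) ^ m := by rw [← mul_pow]; ring_nf
        _ ≤ _ := by
            gcongr
            exact hx w
    · simp
  have hcs := avg_mul_sq_le (fun ω => |P ω|) I
  simp only [sq_abs] at hcs
  have hPI : avg (fun ω => |P ω| * I ω) ≤ 1 / 2 := by
    refine le_of_sq_le_sq ?_ (by norm_num)
    have hy0 : 0 ≤ y := hy.trans' (avg_nonneg fun ω => sq_nonneg _)
    calc _ ≤ _ := hcs
      _ ≤ y * (q * (4 * (m : ℝ) ^ 4 * x) ^ m) :=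
          mul_le_mul hy hIavg (avg_nonneg fun ω => sq_nonneg _) hy0
      _ ≤ _ := hsmall
      _ = _ := by norm_num
  have : avg (fun ω => |P ω|) = avg fun ω => P ω + 2 * (|P ω| * I ω) := by
    congr 1; ext ω; exact e ω
  rw [this, avg_add, avg_const_mul]
  have hmean' : (avg fun ω => P ω) = 1 := hmean
  rw [hmean']
  linarith

/-- Pairing a function with controlled high moments with a Riesz product. -/
theorem avg_abs_mul_le {g P : Ω → ℝ} {m : ℕ} {v σ : ℝ} (hσ : 0 < σ) (hv : v ≤ σ ^ 2)
    (hv0 : 0 ≤ v) (hm : m ≠ 0)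
    (hg : avg (fun ω => g ω ^ (2 * m)) ≤ v ^ m) (hP1 : avg (fun ω => |P ω|) ≤ 2)
    (hP2 : avg (fun ω => P ω ^ 2) ≤ 4 ^ (m - 1)) :
    avg (fun ω => |g ω * P ω|) ≤ 5 * σ := by
  obtain ⟨m, rfl⟩ := Nat.exists_eq_succ_of_ne_zero hm
  simp only [Nat.succ_eq_add_one, Nat.add_sub_cancel] at *
  -- Below the threshold 2σ the first moment of `P` suffices. Above it, the gain 2^(-m) from the
  -- high moment of `g` cancels the root 2^m of the second moment of `P`. The two parts give 4σ + σ.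
  have hpt : ∀ ω, |g ω * P ω| ≤ 2 * σ * |P ω| + ((2 * σ) ^ m)⁻¹ * (|g ω| ^ (m + 1) * |P ω|) := by
    intro ω
    rw [abs_mul, ← mul_assoc, ← add_mul]
    gcongr
    rcases le_total |g ω| (2 * σ) with h | h
    · exact le_add_of_le_of_nonneg h (by positivity)
    · refine le_add_of_nonneg_of_le (by positivity) ?_
      rw [pow_succ, ← mul_assoc]
      refine le_mul_of_one_le_left (abs_nonneg _) ?_
      rw [← div_eq_inv_mul, one_le_div (by positivity)]
      gcongr
  have hcs := avg_mul_sq_le (fun ω => |g ω| ^ (m + 1)) (fun ω => |P ω|)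
  simp only [sq_abs] at hcs
  have e : ∀ ω, (|g ω| ^ (m + 1)) ^ 2 = g ω ^ (2 * (m + 1)) := fun ω => by
    rw [← pow_mul, mul_comm, pow_mul, sq_abs, ← pow_mul]
  simp only [e] at hcs
  have h2 : avg (fun ω => |g ω| ^ (m + 1) * |P ω|) ≤ σ ^ (m + 1) * 2 ^ m := by
    refine le_of_sq_le_sq ?_ (by positivity)
    calc _ ≤ _ := hcs
      _ ≤ v ^ (m + 1) * 4 ^ m :=
          mul_le_mul hg hP2 (avg_nonneg fun ω => sq_nonneg _) (by positivity)
      _ ≤ (σ ^ 2) ^ (m + 1) * 4 ^ m := by gcongr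
      _ = _ := by
          rw [mul_pow, ← pow_mul, ← pow_mul, ← pow_mul, mul_comm 2 (m + 1), mul_comm m 2, pow_mul 2]
          norm_num
  refine (avg_mono hpt).trans ?_
  rw [avg_add, avg_const_mul, avg_const_mul]
  calc _ ≤ 2 * σ * 2 + ((2 * σ) ^ m)⁻¹ * (σ ^ (m + 1) * 2 ^ m) := by gcongr
    _ = 5 * σ := by
        rw [mul_pow]
        field_simp
        ring

end RieszMoments

/-! ### Calculus of functions with controlled moments -/

section MomentBounds

variable {Ω : Type*} [Fintype Ω]

/-- All even moments of `g` up to order `2 M` are bounded by those of a constant `√v`. -/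
structure HasMoments (M : ℕ) (g : Ω → ℝ) (v : ℝ) : Prop where
  pos : 0 < v
  le : ∀ m ≤ M, avg (fun ω => g ω ^ (2 * m)) ≤ v ^ m

theorem HasMoments.mono {M M' : ℕ} {g : Ω → ℝ} {v v' : ℝ} (h : HasMoments M g v) (hM : M' ≤ M)
    (hv : v ≤ v') : HasMoments M' g v' :=
  ⟨h.pos.trans_le hv, fun m hm =>
    (h.le m (hm.trans hM)).trans (pow_le_pow_left₀ h.pos.le hv m)⟩

theorem hasMoments_one [Nonempty Ω] (M : ℕ) : HasMoments M (fun _ : Ω => (1 : ℝ)) 1 :=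
  ⟨one_pos, fun m _ => by simp [avg_const]⟩

/-- Cauchy–Schwarz, at the price of half the available order. -/
theorem HasMoments.mul {M : ℕ} {g h : Ω → ℝ} {v w : ℝ} (hg : HasMoments (2 * M) g v)
    (hh : HasMoments (2 * M) h w) : HasMoments M (fun ω => g ω * h ω) (v * w) := by
  refine ⟨mul_pos hg.pos hh.pos, fun m hm => ?_⟩
  have h1 := avg_mul_sq_le (fun ω => g ω ^ (2 * m)) (fun ω => h ω ^ (2 * m))
  have h2 := hg.le (2 * m) (by omega)
  have h3 := hh.le (2 * m) (by omega)
  have e : ∀ x : ℝ, (x ^ (2 * m)) ^ 2 = x ^ (2 * (2 * m)) := fun x => by ring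
  have hv := hg.pos
  have hw := hh.pos
  simp only [e] at h1
  simp only [mul_pow]
  refine le_of_sq_le_sq ?_ (by positivity)
  calc _ ≤ _ := h1
    _ ≤ v ^ (2 * m) * w ^ (2 * m) := by
        refine mul_le_mul h2 h3 (avg_nonneg fun ω => ?_) (by positivity)
        rw [pow_mul]; positivity
    _ = _ := by ring

theorem prod_le_sum_pow_div_card {ι : Type*} (s : Finset ι) (hs : s.Nonempty) (z : ι → ℝ)
    (hz : ∀ i ∈ s, 0 ≤ z i) : ∏ i ∈ s, z i ≤ (∑ i ∈ s, z i ^ s.card) / s.card := by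
  have hc : (s.card : ℝ) ≠ 0 := by exact_mod_cast hs.card_pos.ne'
  have h := Real.geom_mean_le_arith_mean_weighted s (fun _ => (s.card : ℝ)⁻¹)
    (fun i => z i ^ s.card) (fun _ _ => by positivity) (by simp [hc])
    (fun i hi => pow_nonneg (hz i hi) _)
  rw [← Finset.mul_sum] at h
  rw [div_eq_inv_mul]
  refine le_trans (le_of_eq ?_) h
  refine Finset.prod_congr rfl fun i hi => ?_
  rw [Real.pow_rpow_inv_natCast (hz i hi) hs.card_pos.ne']

/-- The arithmetic-geometric mean inequality for the normalized powers `(g w ω ^ 2 / v w) ^ l`. It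
loses no constant but divides the order by the number of factors, so moments of order about m q are
needed for m q blocks' worth of products. -/
theorem HasMoments.prod [Nonempty Ω] {M m : ℕ} (s : Finset ℕ) {g : ℕ → Ω → ℝ} {v : ℕ → ℝ}
    (h : ∀ w ∈ s, HasMoments M (g w) (v w)) (hm : m * s.card ≤ M) :
    HasMoments m (fun ω => ∏ w ∈ s, g w ω) (∏ w ∈ s, v w) := by
  refine ⟨Finset.prod_pos fun w hw => (h w hw).pos, fun l hl => ?_⟩
  rcases s.eq_empty_or_nonempty with rfl | hs
  · simp [avg_const]
  have hc : (0 : ℝ) < s.card := by exact_mod_cast hs.card_pos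
  have hpt : ∀ ω, (∏ w ∈ s, g w ω) ^ (2 * l) ≤ (∏ w ∈ s, v w) ^ l *
      ((s.card : ℝ)⁻¹ * ∑ w ∈ s, ((v w) ^ (l * s.card))⁻¹ * g w ω ^ (2 * (l * s.card))) := by
    intro ω
    have h1 := prod_le_sum_pow_div_card s hs (fun w => (g w ω ^ 2 / v w) ^ l)
      (fun w hw => by have := (h w hw).pos; positivity)
    have hp : 0 < (∏ w ∈ s, v w) ^ l := pow_pos (Finset.prod_pos fun w hw => (h w hw).pos) l
    rw [Finset.prod_pow, Finset.prod_div_distrib, div_pow, div_le_iff₀' hp, Finset.prod_pow,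
      ← pow_mul] at h1
    refine h1.trans_eq ?_
    rw [div_eq_inv_mul]
    congr 2
    refine Finset.sum_congr rfl fun w hw => ?_
    rw [← pow_mul, div_pow, ← pow_mul, div_eq_inv_mul]
  refine (avg_mono hpt).trans ?_
  rw [avg_const_mul, avg_const_mul, avg_sum]
  have hp : 0 ≤ (∏ w ∈ s, v w) ^ l :=
    (pow_pos (Finset.prod_pos fun w hw => (h w hw).pos) l).le
  refine mul_le_of_le_one_right hp ?_
  rw [inv_mul_le_iff₀ hc, mul_one]
  refine (Finset.sum_le_card_nsmul _ _ 1 fun w hw => ?_).trans (by simp)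
  have hv := (h w hw).pos
  rw [avg_const_mul, inv_mul_le_iff₀ (by positivity), mul_one]
  exact (h w hw).le _ ((Nat.mul_le_mul_right _ hl).trans hm)

variable {T : Fin 3 → ℕ → Equiv.Perm Ω} {n : ℕ} {f : (Fin 3 → ℕ) → Ω → ℝ} {blk : ℕ → ℕ} {ρ : ℝ}

theorem IsSignFamily.hasMoments [Nonempty Ω] (hf : IsSignFamily T n f) (hρ : 0 < ρ)
    {A : Finset (Fin 3 → ℕ)} (hA : ∀ r ∈ A, ∑ i, r i = n) {M : ℕ} (hM : 0 < M) {a v : ℝ}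
    (ha : 0 < a) (hcard : (A.card : ℝ) ≤ a) (hv : 4 * (M : ℝ) ^ 4 * ρ ^ 2 * a ≤ v) :
    HasMoments M (fun ω => ρ * signSum f A ω) v := by
  have hM' : (0 : ℝ) < M := by exact_mod_cast hM
  refine HasMoments.mono ⟨(by positivity : 0 < 4 * (M : ℝ) ^ 4 * ρ ^ 2 * a), fun m hm => ?_⟩
    le_rfl hv
  simp only [mul_pow ρ]
  rw [avg_const_mul, pow_mul]
  have hm' : (m : ℝ) ≤ M := by exact_mod_cast hm
  calc _ ≤ (ρ ^ 2) ^ m * (4 * (m : ℝ) ^ 4 * A.card) ^ m := by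
        gcongr; exact hf.avg_sum_pow_le A hA m
    _ = (4 * (m : ℝ) ^ 4 * ρ ^ 2 * A.card) ^ m := by rw [← mul_pow]; ring_nf
    _ ≤ _ := by gcongr

/-- Uniform control of the first two moments of the Riesz products over all choices of blocks. -/
structure RieszControl (f : (Fin 3 → ℕ) → Ω → ℝ) (n : ℕ) (blk : ℕ → ℕ) (q : ℕ) (ρ : ℝ)
    (m : ℕ) : Prop where
  first : ∀ A, IsBlocked n blk A →
    avg (fun ω => |rieszProd f ρ 1 A (Finset.range q) ω|) ≤ 2
  second : ∀ A, IsBlocked n blk A →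
    avg (fun ω => rieszProd f ρ 1 A (Finset.range q) ω ^ 2) ≤ 4 ^ (m - 1)

/-- A product of factors with controlled moments, times a Riesz product over the other blocks. -/
theorem RieszControl.avg_abs_le [Nonempty Ω] {q m : ℕ} (hR : RieszControl f n blk q ρ m)
    (hm : m ≠ 0) {A : ℕ → Finset (Fin 3 → ℕ)} (hA : IsBlocked n blk A) {U V : Finset ℕ}
    (hU : U ⊆ Finset.range q) {M : ℕ} {G : Ω → ℝ} {vG : ℝ} (hG : HasMoments M G vG)
    {g : ℕ → Ω → ℝ} {v : ℕ → ℝ} (hg : ∀ w ∈ V, HasMoments M (g w) (v w))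
    (hV : V ⊆ Finset.range q) (hM : 2 * m * (q + 1) ≤ M) {σ : ℝ} (hσ : 0 < σ)
    (hv : vG * ∏ w ∈ V, v w ≤ σ ^ 2) :
    avg (fun ω => |G ω * (∏ w ∈ V, g w ω) * rieszProd f ρ 1 A U ω|) ≤ 5 * σ := by
  have hVc : V.card ≤ q := by simpa using Finset.card_le_card hV
  have hA' : IsBlocked n blk (fun w => if w ∈ U then A w else ∅) := by
    intro w r hr
    dsimp only at hr
    split_ifs at hr with h
    · exact hA w r hr
    · simp at hr
  have h1 : HasMoments (2 * m) (fun ω => ∏ w ∈ V, g w ω) (∏ w ∈ V, v w) :=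
    HasMoments.prod V hg (hM.trans' (by gcongr; omega))
  have h2 : HasMoments m _ _ := (hG.mono (M' := 2 * m) (by nlinarith) le_rfl).mul h1
  simp only [rieszProd_one_subset A hU]
  exact avg_abs_mul_le hσ hv h2.pos.le hm (h2.le m le_rfl) (hR.first _ hA') (hR.second _ hA')

end MomentBounds

/-! ### Decomposition by the maxima of the second and third coordinates -/

section Terms

/-- The scales of order `n` in block `w` satisfying `p`. -/
def blockScales (n : ℕ) (blk : ℕ → ℕ) (p : (Fin 3 → ℕ) → Prop) [DecidablePred p] (w : ℕ) :
    Finset (Fin 3 → ℕ) :=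
  {r ∈ Finset.Nat.antidiagonalTuple 3 n | blk (r 0) = w ∧ p r}

/-- `x = c` if `b` holds, and `x < c` otherwise. -/
def CutAt (b : Prop) [Decidable b] (x c : ℕ) : Prop := if b then x = c else x < c

instance (b : Prop) [Decidable b] (x c : ℕ) : Decidable (CutAt b x c) := by
  unfold CutAt; infer_instance

/-- The scales in block `w` whose second and third coordinates equal the maxima `c`, `d` if
`w` belongs to `V`, `V'`, and are smaller otherwise. -/
def termScales (n : ℕ) (blk : ℕ → ℕ) (c d : ℕ) (V V' : Finset ℕ) (w : ℕ) : Finset (Fin 3 → ℕ) :=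
  blockScales n blk (fun r => CutAt (w ∈ V) (r 1) c ∧ CutAt (w ∈ V') (r 2) d) w

/-- The part of the Riesz product in which the second coordinate has its maximum `c` exactly at
the blocks in `V`, and the third its maximum `d` exactly at the blocks in `V'`. -/
noncomputable def rieszTerm {Ω : Type*} (f : (Fin 3 → ℕ) → Ω → ℝ) (n : ℕ) (blk : ℕ → ℕ) (q : ℕ)
    (ρ : ℝ) (c d : ℕ) (V V' : Finset ℕ) : Ω → ℝ :=
  rieszProd f ρ (fun w => if w ∈ V ∪ V' then 0 else 1) (termScales n blk c d V V')
    (Finset.range q)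

theorem mem_blockScales {n : ℕ} {blk : ℕ → ℕ} {p : (Fin 3 → ℕ) → Prop} [DecidablePred p] {w : ℕ}
    {r : Fin 3 → ℕ} :
    r ∈ blockScales n blk p w ↔ ∑ i, r i = n ∧ blk (r 0) = w ∧ p r := by
  rw [blockScales, Finset.mem_filter, Finset.Nat.mem_antidiagonalTuple]

theorem blockScales_congr {n : ℕ} {blk : ℕ → ℕ} {p p' : (Fin 3 → ℕ) → Prop} [DecidablePred p]
    [DecidablePred p'] (h : ∀ r, p r ↔ p' r) (w : ℕ) :
    blockScales n blk p w = blockScales n blk p' w := by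
  ext r
  rw [mem_blockScales, mem_blockScales, h]

theorem termScales_of_mem {n : ℕ} {blk : ℕ → ℕ} {c d w : ℕ} {V V' : Finset ℕ} (hw : w ∈ V') :
    termScales n blk c d V V' w =
      blockScales n blk (fun r => CutAt (w ∈ V) (r 1) c ∧ r 2 = d) w :=
  blockScales_congr (fun r => by simp [CutAt, hw]) w

theorem termScales_of_notMem {n : ℕ} {blk : ℕ → ℕ} {c d w : ℕ} {V V' : Finset ℕ} (hw : w ∉ V') :
    termScales n blk c d V V' w =
      blockScales n blk (fun r => CutAt (w ∈ V) (r 1) c ∧ r 2 < d) w :=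
  blockScales_congr (fun r => by simp [CutAt, hw]) w

theorem isBlocked_blockScales {n : ℕ} {blk : ℕ → ℕ} (p : ℕ → (Fin 3 → ℕ) → Prop)
    [∀ w, DecidablePred (p w)] : IsBlocked n blk fun w => blockScales n blk (p w) w :=
  fun _ _ hr => ⟨(mem_blockScales.1 hr).1, (mem_blockScales.1 hr).2.1⟩

theorem isBlocked_termScales {n : ℕ} {blk : ℕ → ℕ} (c d : ℕ) (V V' : Finset ℕ) :
    IsBlocked n blk (termScales n blk c d V V') :=
  isBlocked_blockScales fun w r => CutAt (w ∈ V) (r 1) c ∧ CutAt (w ∈ V') (r 2) d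

theorem card_le_of_second {n : ℕ} {A : Finset (Fin 3 → ℕ)} (hA : ∀ r ∈ A, ∑ i, r i = n)
    {C : Finset ℕ} (hC : ∀ r ∈ A, r 1 ∈ C) : A.card ≤ C.card * (n + 1) := by
  rw [← Finset.card_range (n + 1), ← Finset.card_product]
  refine Finset.card_le_card_of_injOn (fun r => (r 1, r 0)) (fun r hr => ?_) ?_
  · have := hA r hr
    rw [Fin.sum_univ_three] at this
    simp only [Finset.coe_product, Set.mem_prod, Finset.mem_coe, Finset.mem_range]
    exact ⟨hC r hr, by omega⟩
  · intro r hr s hs h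
    simp only [Prod.mk.injEq] at h
    exact eq_of_two_coords (hA r hr) (hA s hs) h.2 h.1

theorem card_le_of_third {n d : ℕ} {A : Finset (Fin 3 → ℕ)} (hA : ∀ r ∈ A, ∑ i, r i = n)
    (hd : ∀ r ∈ A, r 2 = d) : A.card ≤ n + 1 := by
  rw [← Finset.card_range (n + 1)]
  refine Finset.card_le_card_of_injOn (fun r => r 0) (fun r hr => ?_) ?_
  · have := hA r hr
    rw [Fin.sum_univ_three] at this
    simp only [Finset.mem_coe, Finset.mem_range]
    omega
  · intro r hr s hs h
    have h1 := hA r hr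
    have h2 := hA s hs
    have h3 := hd r hr
    have h4 := hd s hs
    rw [Fin.sum_univ_three] at h1 h2
    simp only at h
    exact eq_of_two_coords (hA r hr) (hA s hs) h (by omega)

theorem card_le_of_second_third {n d : ℕ} {A : Finset (Fin 3 → ℕ)}
    (hA : ∀ r ∈ A, ∑ i, r i = n) {C : Finset ℕ} (hC : ∀ r ∈ A, r 1 ∈ C)
    (hd : ∀ r ∈ A, r 2 = d) : A.card ≤ C.card := by
  refine Finset.card_le_card_of_injOn (fun r => r 1) (fun r hr => hC r hr) ?_
  intro r hr s hs h
  have h1 := hA r hr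
  have h2 := hA s hs
  have h3 := hd r hr
  have h4 := hd s hs
  rw [Fin.sum_univ_three] at h1 h2
  simp only at h
  exact eq_of_two_coords (hA r hr) (hA s hs) (by omega) h

variable {Ω : Type*} {T : Fin 3 → ℕ → Equiv.Perm Ω} {n : ℕ}
  {f : (Fin 3 → ℕ) → Ω → ℝ} {blk : ℕ → ℕ} {q : ℕ} {ρ : ℝ}

theorem signSum_cut_succ (p : (Fin 3 → ℕ) → Prop) [DecidablePred p] (i : Fin 3) (w d : ℕ)
    (ω : Ω) :
    signSum f (blockScales n blk (fun r => p r ∧ r i < d + 1) w) ω =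
      signSum f (blockScales n blk (fun r => p r ∧ r i < d) w) ω +
        signSum f (blockScales n blk (fun r => p r ∧ r i = d) w) ω := by
  rw [signSum, signSum, signSum, ← Finset.sum_union]
  · refine Finset.sum_congr ?_ fun _ _ => rfl
    ext r
    simp only [Finset.mem_union, mem_blockScales, Nat.lt_succ_iff_lt_or_eq]
    tauto
  · rw [Finset.disjoint_left]
    intro r h1 h2
    have h1 := (mem_blockScales.1 h1).2.2.2
    have h2 := (mem_blockScales.1 h2).2.2.2
    omega

/-- Each factor splits into the scales with `r 2 = d` and the rest, and the product is expanded over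
the set `V'` of blocks where the first piece is chosen. -/
theorem rieszTerm_succ (c d : ℕ) (V : Finset ℕ) (ω : Ω) :
    rieszTerm f n blk q ρ c (d + 1) V ∅ ω =
      ∑ V' ∈ (Finset.range q).powerset, rieszTerm f n blk q ρ c d V V' ω := by
  classical
  have e : ∀ w, (if w ∈ V ∪ ∅ then (0 : ℝ) else 1) +
      ρ * signSum f (termScales n blk c (d + 1) V ∅ w) ω =
      ρ * signSum f (blockScales n blk (fun r => CutAt (w ∈ V) (r 1) c ∧ r 2 = d) w) ω +
      ((if w ∈ V then (0 : ℝ) else 1) +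
        ρ * signSum f (blockScales n blk (fun r => CutAt (w ∈ V) (r 1) c ∧ r 2 < d) w) ω) := by
    intro w
    rw [termScales_of_notMem (Finset.notMem_empty w), signSum_cut_succ, Finset.union_empty]
    ring
  rw [rieszTerm, rieszProd]
  simp only [e]
  rw [Finset.prod_add]
  refine Finset.sum_congr rfl fun V' hV' => ?_
  rw [rieszTerm, rieszProd, ← Finset.prod_sdiff (Finset.mem_powerset.1 hV'), mul_comm]
  congr 1
  · refine Finset.prod_congr rfl fun w hw => ?_
    have hw := (Finset.mem_sdiff.1 hw).2
    rw [termScales_of_notMem hw]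
    simp [hw]
  · refine Finset.prod_congr rfl fun w hw => ?_
    rw [termScales_of_mem hw]
    simp [hw]

/-- In `rieszTerm_succ` the summand for `V' = ∅` is the same product with the cutoff lowered by one,
so the identity telescopes in `d`. -/
theorem rieszTerm_sub_zero (c D : ℕ) (V : Finset ℕ) (ω : Ω) :
    rieszTerm f n blk q ρ c D V ∅ ω - rieszTerm f n blk q ρ c 0 V ∅ ω =
      ∑ d ∈ Finset.range D, ∑ V' ∈ (Finset.range q).powerset.erase ∅,
        rieszTerm f n blk q ρ c d V V' ω := by
  rw [← Finset.sum_range_sub (fun d => rieszTerm f n blk q ρ c d V ∅ ω)]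
  refine Finset.sum_congr rfl fun d _ => ?_
  rw [rieszTerm_succ, ← Finset.add_sum_erase _ _ (Finset.empty_mem_powerset _)]
  ring

/-- With cutoff 0 no scale remains, and a block in `V` has no constant term to fall back on. -/
theorem rieszTerm_zero_of_nonempty (c : ℕ) {V : Finset ℕ} (hV : V.Nonempty)
    (hVq : V ⊆ Finset.range q) (ω : Ω) : rieszTerm f n blk q ρ c 0 V ∅ ω = 0 := by
  obtain ⟨w, hw⟩ := hV
  rw [rieszTerm, rieszProd]
  refine Finset.prod_eq_zero (hVq hw) ?_
  simp [hw, termScales, CutAt, blockScales, signSum]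

theorem rieszTerm_zero_empty (c : ℕ) (ω : Ω) : rieszTerm f n blk q ρ c 0 ∅ ∅ ω = 1 := by
  rw [rieszTerm, rieszProd]
  refine Finset.prod_eq_one fun w _ => ?_
  simp [termScales, CutAt, blockScales, signSum]

/-- Exchange of the second and third coordinates. -/
def swapCoord : Equiv.Perm (Fin 3) := Equiv.swap 1 2

theorem swapCoord_zero : swapCoord 0 = 0 := by decide

theorem swapCoord_one : swapCoord 1 = 2 := by decide

theorem swapCoord_two : swapCoord 2 = 1 := by decide

theorem swapCoord_swapCoord (i : Fin 3) : swapCoord (swapCoord i) = i := by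
  revert i; decide

theorem sum_comp_swapCoord (r : Fin 3 → ℕ) : ∑ i, (r ∘ swapCoord) i = ∑ i, r i :=
  Equiv.sum_comp swapCoord r

/-- The family with second and third coordinates exchanged. -/
def swapFamily (f : (Fin 3 → ℕ) → Ω → ℝ) : (Fin 3 → ℕ) → Ω → ℝ := fun r => f (r ∘ swapCoord)

theorem IsSignFamily.swap (hf : IsSignFamily T n f) :
    IsSignFamily (fun i => T (swapCoord i)) n (swapFamily f) := by
  intro r hr
  obtain ⟨h1, h2⟩ := hf (r ∘ swapCoord) (by rw [sum_comp_swapCoord, hr])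
  refine ⟨fun i => ?_, h2⟩
  have := h1 (swapCoord i)
  simp only [Function.comp_apply, swapCoord_swapCoord] at this
  exact this

theorem rieszTerm_swap (c d : ℕ) (V V' : Finset ℕ) (ω : Ω) :
    rieszTerm (swapFamily f) n blk q ρ c d V V' ω = rieszTerm f n blk q ρ d c V' V ω := by
  rw [rieszTerm, rieszTerm, rieszProd, rieszProd]
  refine Finset.prod_congr rfl fun w _ => ?_
  rw [Finset.union_comm]
  congr 2
  refine Finset.sum_nbij' (fun r => r ∘ swapCoord) (fun r => r ∘ swapCoord) ?_ ?_ ?_ ?_ ?_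
  · intro r hr
    obtain ⟨h1, h2, h3, h4⟩ := mem_blockScales.1 hr
    refine mem_blockScales.2 ⟨by rw [sum_comp_swapCoord, h1], ?_, ?_, ?_⟩
    · simpa [swapCoord_zero] using h2
    · simpa [swapCoord_one] using h4
    · simpa [swapCoord_two] using h3
  · intro r hr
    obtain ⟨h1, h2, h3, h4⟩ := mem_blockScales.1 hr
    refine mem_blockScales.2 ⟨by rw [sum_comp_swapCoord, h1], ?_, ?_, ?_⟩
    · simpa [swapCoord_zero] using h2
    · simpa [swapCoord_one] using h4
    · simpa [swapCoord_two] using h3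
  · intro r _
    ext i
    simp [swapCoord_swapCoord]
  · intro r _
    ext i
    simp [swapCoord_swapCoord]
  · intro r _
    rfl

/-- The part of the Riesz product with unique maxima in both coordinates. -/
noncomputable def mainPart (f : (Fin 3 → ℕ) → Ω → ℝ) (n : ℕ) (blk : ℕ → ℕ) (q : ℕ) (ρ : ℝ)
    (ω : Ω) : ℝ :=
  ∑ V ∈ (Finset.range q).powersetCard 1, ∑ U ∈ (Finset.range q).powersetCard 1,
    ∑ c ∈ Finset.range (n + 1), ∑ d ∈ Finset.range (n + 1), rieszTerm f n blk q ρ c d V U ω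

/-- The part with a repeated maximum `c` of the second coordinate, with the data
of the third coordinate given. -/
noncomputable def repeatedPart (f : (Fin 3 → ℕ) → Ω → ℝ) (n : ℕ) (blk : ℕ → ℕ) (q : ℕ) (ρ : ℝ)
    (d : ℕ) (V' : Finset ℕ) (ω : Ω) : ℝ :=
  ∑ V ∈ (Finset.range q).powerset with 2 ≤ V.card,
    ∑ c ∈ Finset.range (n + 1), rieszTerm f n blk q ρ c d V V' ω

theorem sum_powerset_split {α : Type*} (P : Finset (Finset α)) (h : Finset α → ℝ)
    [DecidableEq α] : ∑ V ∈ P.erase ∅, h V =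
      ∑ V ∈ P with V.card = 1, h V + ∑ V ∈ P with 2 ≤ V.card, h V := by
  rw [← Finset.sum_union]
  · refine Finset.sum_congr ?_ fun _ _ => rfl
    ext V
    simp only [Finset.mem_erase, Finset.mem_union, Finset.mem_filter, ← and_or_left,
      ne_eq, ← Finset.card_eq_zero]
    rw [and_comm]
    refine and_congr_right fun _ => ?_
    omega
  · rw [Finset.disjoint_left]
    intro V h1 h2
    have h1 := (Finset.mem_filter.1 h1).2
    have h2 := (Finset.mem_filter.1 h2).2
    omega

/-- Decomposition of the Riesz product according to repetition of the maxima. -/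
theorem mainPart_eq (ω : Ω) :
    mainPart f n blk q ρ ω = rieszTerm f n blk q ρ (n + 1) (n + 1) ∅ ∅ ω - 1
      - repeatedPart f n blk q ρ (n + 1) ∅ ω
      - repeatedPart (swapFamily f) n blk q ρ (n + 1) ∅ ω
      + ∑ V' ∈ (Finset.range q).powerset with 2 ≤ V'.card, ∑ d ∈ Finset.range (n + 1),
          repeatedPart f n blk q ρ d V' ω := by
  classical
  set P := (Finset.range q).powerset with hP
  set R := Finset.range (n + 1)
  set a : Finset ℕ → Finset ℕ → ℝ := fun V V' =>
    ∑ c ∈ R, ∑ d ∈ R, rieszTerm f n blk q ρ c d V V' ω with ha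
  have hcard1 : (Finset.range q).powersetCard 1 = {V ∈ P | V.card = 1} := by
    ext V; simp [hP, Finset.mem_powersetCard]
  have h1 : ∀ V ∈ P.erase ∅, ∑ c ∈ R, rieszTerm f n blk q ρ c (n + 1) V ∅ ω =
      ∑ V' ∈ P.erase ∅, a V V' := by
    intro V hV
    obtain ⟨hne, hV⟩ := Finset.mem_erase.1 hV
    have : ∀ c, rieszTerm f n blk q ρ c (n + 1) V ∅ ω =
        ∑ d ∈ R, ∑ V' ∈ P.erase ∅, rieszTerm f n blk q ρ c d V V' ω := fun c => by
      rw [← rieszTerm_sub_zero, rieszTerm_zero_of_nonempty c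
        (Finset.nonempty_iff_ne_empty.2 hne) (Finset.mem_powerset.1 hV), sub_zero]
    simp only [this, ha]
    rw [Finset.sum_congr rfl fun c _ => Finset.sum_comm, Finset.sum_comm]
  have h2 : ∀ V' ∈ P.erase ∅, ∑ d ∈ R, rieszTerm f n blk q ρ (n + 1) d ∅ V' ω =
      ∑ V ∈ P.erase ∅, a V V' := by
    intro V' hV'
    obtain ⟨hne, hV'⟩ := Finset.mem_erase.1 hV'
    have : ∀ d, rieszTerm f n blk q ρ (n + 1) d ∅ V' ω =
        ∑ c ∈ R, ∑ V ∈ P.erase ∅, rieszTerm f n blk q ρ c d V V' ω := fun d => by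
      simp only [← rieszTerm_swap (f := f)]
      rw [← rieszTerm_sub_zero, rieszTerm_zero_of_nonempty d
        (Finset.nonempty_iff_ne_empty.2 hne) (Finset.mem_powerset.1 hV'), sub_zero]
    simp only [this, ha]
    rw [Finset.sum_comm, Finset.sum_congr rfl fun c _ => Finset.sum_comm, Finset.sum_comm]
  -- Coordinates are at most `n`, so the cutoffs `n + 1` impose nothing and this is the full Riesz
  -- product minus 1. The claim then follows by inclusion and exclusion over cardinality one or at
  -- least two.
  have h3 : rieszTerm f n blk q ρ (n + 1) (n + 1) ∅ ∅ ω - 1 =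
      ∑ V ∈ P.erase ∅, ∑ V' ∈ P.erase ∅, a V V' := by
    rw [← Finset.sum_congr rfl h1, Finset.sum_comm]
    simp only [← rieszTerm_swap (f := f)]
    rw [← rieszTerm_sub_zero, rieszTerm_zero_empty]
  have e1 : repeatedPart f n blk q ρ (n + 1) ∅ ω =
      ∑ V ∈ P with 2 ≤ V.card, ∑ V' ∈ P.erase ∅, a V V' := by
    refine Finset.sum_congr rfl fun V hV => h1 V ?_
    obtain ⟨hV, hc⟩ := Finset.mem_filter.1 hV
    refine Finset.mem_erase.2 ⟨fun h => ?_, hV⟩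
    simp [h] at hc
  have e2 : repeatedPart (swapFamily f) n blk q ρ (n + 1) ∅ ω =
      ∑ V' ∈ P with 2 ≤ V'.card, ∑ V ∈ P.erase ∅, a V V' := by
    refine Finset.sum_congr rfl fun V hV => ?_
    simp only [rieszTerm_swap]
    refine h2 V ?_
    obtain ⟨hV, hc⟩ := Finset.mem_filter.1 hV
    refine Finset.mem_erase.2 ⟨fun h => ?_, hV⟩
    simp [h] at hc
  have e3 : ∑ V' ∈ P with 2 ≤ V'.card, ∑ d ∈ R, repeatedPart f n blk q ρ d V' ω =
      ∑ V' ∈ P with 2 ≤ V'.card, ∑ V ∈ P with 2 ≤ V.card, a V V' := by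
    refine Finset.sum_congr rfl fun V' _ => ?_
    simp only [repeatedPart, ha]
    rw [Finset.sum_comm]
    refine Finset.sum_congr rfl fun V _ => ?_
    rw [Finset.sum_comm]
  rw [h3, e1, e2, e3, mainPart, hcard1]
  change ∑ V ∈ P with V.card = 1, ∑ V' ∈ P with V'.card = 1, a V V' = _
  simp only [sum_powerset_split P, Finset.sum_add_distrib]
  rw [Finset.sum_comm (s := P.filter fun V => V.card = 1) (t := P.filter fun V => 2 ≤ V.card),
    Finset.sum_comm (s := P.filter fun V => 2 ≤ V.card) (t := P.filter fun V => 2 ≤ V.card)]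
  ring

end Terms

/-! ### Testing Haar functions against the main part -/

section Duality

variable {Ω : Type*} [Fintype Ω] {T : Fin 3 → ℕ → Equiv.Perm Ω} {n : ℕ}
  {f : (Fin 3 → ℕ) → Ω → ℝ} {blk : ℕ → ℕ} {q : ℕ} {ρ : ℝ}

/-- Whichever of `s 1` and `c` is larger is a digit in which one of the two functions is odd and
which the other ignores. -/
theorem avg_haar_mul_rieszTerm_of_second_ne (hf : IsSignFamily T n f) {s : Fin 3 → ℕ} {H : Ω → ℝ}
    (hH : IsHaar T s H) {c d t u : ℕ} (ht : t < q) (hc : s 1 ≠ c) :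
    avg (fun ω => H ω * rieszTerm f n blk q ρ c d {t} {u} ω) = 0 := by
  have hb := isBlocked_termScales (n := n) (blk := blk) c d {t} {u}
  have hle : ∀ w, ∀ r ∈ termScales n blk c d {t} {u} w, r 1 ≤ c ∧ (w ≠ t → r 1 < c) ∧
      (w = t → r 1 = c) := by
    intro w r hr
    have := (mem_blockScales.1 hr).2.2.1
    simp only [CutAt, Finset.mem_singleton] at this
    split_ifs at this with h
    · exact ⟨this.le, fun h' => absurd h h', fun _ => this⟩
    · exact ⟨this.le, fun _ => this, fun h' => absurd h' h⟩
  rcases lt_or_gt_of_ne hc with h | h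
  · refine avg_eq_zero_of_odd (T 1 c) fun ω => ?_
    rw [(hH 1).1 c h]
    -- Uniqueness of the maximum enters here: exactly one factor changes sign, and its constant term
    -- is 0.
    have : rieszTerm f n blk q ρ c d {t} {u} (T 1 c ω) = -rieszTerm f n blk q ρ c d {t} {u} ω := by
      rw [rieszTerm, rieszProd, rieszProd,
        ← Finset.mul_prod_erase _ _ (Finset.mem_range.2 ht),
        ← Finset.mul_prod_erase _ _ (Finset.mem_range.2 ht), ← neg_mul]
      congr 1
      · have : signSum f (termScales n blk c d {t} {u} t) (T 1 c ω) =
            -signSum f (termScales n blk c d {t} {u} t) ω := by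
          rw [signSum, signSum, ← Finset.sum_neg_distrib]
          exact Finset.sum_congr rfl fun r hr =>
            hf.odd' (hb t r hr).1 1 ((hle t r hr).2.2 rfl) ω
        rw [this]
        simp
      · refine Finset.prod_congr rfl fun w hw => ?_
        congr 2
        exact Finset.sum_congr rfl fun r hr =>
          hf.inv (hb w r hr).1 1 ((hle w r hr).2.1 (Finset.ne_of_mem_erase hw)) ω
    rw [this]
    ring
  · refine avg_eq_zero_of_odd (T 1 (s 1)) fun ω => ?_
    rw [(hH 1).2, rieszTerm, rieszProd_inv hf hb _ 1 _ fun w _ r hr =>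
      (hle w r hr).1.trans_lt h]
    ring

theorem avg_haar_mul_rieszTerm_of_third_ne (hf : IsSignFamily T n f) {s : Fin 3 → ℕ} {H : Ω → ℝ}
    (hH : IsHaar T s H) {c d t u : ℕ} (hu : u < q) (hd : s 2 ≠ d) :
    avg (fun ω => H ω * rieszTerm f n blk q ρ c d {t} {u} ω) = 0 := by
  simp only [← rieszTerm_swap (f := f)]
  refine avg_haar_mul_rieszTerm_of_second_ne (s := s ∘ swapCoord) hf.swap (fun i => ?_) hu ?_
  · have := hH (swapCoord i)
    exact this
  · simpa [swapCoord_one] using hd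

/-- All scales have the same coordinate sum. Hence one attaining both maxima `s 1`, `s 2` is `s`,
and any other has first coordinate above `s 0` and can be averaged out by `avg_mul_rieszProd`. -/
theorem avg_haar_mul_rieszTerm (hf : IsSignFamily T n f) (hblk : Monotone blk)
    {s : Fin 3 → ℕ} (hs : ∑ i, s i = n) {H : Ω → ℝ} (hH : IsHaar T s H) {t u : ℕ}
    (ht : t < q) :
    avg (fun ω => H ω * rieszTerm f n blk q ρ (s 1) (s 2) {t} {u} ω) =
      if t = u ∧ t = blk (s 0) then ρ * avg (fun ω => H ω * f s ω) else 0 := by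
  have hb := isBlocked_termScales (n := n) (blk := blk) (s 1) (s 2) {t} {u}
  have hle : ∀ w, ∀ r ∈ termScales n blk (s 1) (s 2) {t} {u} w,
      (w = t → w = u → r = s) ∧ (w ≠ t ∨ w ≠ u → s 0 < r 0) := by
    intro w r hr
    obtain ⟨h0, _, h1, h2⟩ := mem_blockScales.1 hr
    simp only [CutAt, Finset.mem_singleton] at h1 h2
    have hs' := hs
    have h0' := h0
    rw [Fin.sum_univ_three] at hs' h0'
    refine ⟨fun ht hu => ?_, fun h => ?_⟩
    · rw [if_pos ht] at h1
      rw [if_pos hu] at h2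
      exact eq_of_two_coords h0 hs (by omega) h1
    · split_ifs at h1 h2 <;> omega
  by_cases htu : t = u
  · subst htu
    by_cases hts : t = blk (s 0)
    · rw [if_pos ⟨rfl, hts⟩]
      have hsing : termScales n blk (s 1) (s 2) {t} {t} t = {s} := by
        refine Finset.eq_singleton_iff_unique_mem.2 ⟨?_, fun r hr => (hle t r hr).1 rfl rfl⟩
        exact mem_blockScales.2 ⟨hs, hts.symm, by simp [CutAt], by simp [CutAt]⟩
      have e : ∀ ω, H ω * rieszTerm f n blk q ρ (s 1) (s 2) {t} {t} ω =
          ρ * (H ω * f s ω * rieszProd f ρ (fun w => if w ∈ ({t} ∪ {t} : Finset ℕ) then 0 else 1)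
            (termScales n blk (s 1) (s 2) {t} {t}) ((Finset.range q).erase t) ω) := by
        intro ω
        rw [rieszTerm, rieszProd, ← Finset.mul_prod_erase _ _ (Finset.mem_range.2 ht), hsing]
        simp only [rieszProd, signSum, Finset.sum_singleton, Finset.union_self,
          Finset.mem_singleton, if_true]
        ring
      simp only [e]
      rw [avg_const_mul, avg_mul_rieszProd hf hblk hb]
      · rw [Finset.prod_eq_one, mul_one]
        intro w hw
        simp [Finset.ne_of_mem_erase hw]
      · intro w hw r hr ω
        have hlt := (hle w r hr).2 (Or.inl (Finset.ne_of_mem_erase hw))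
        rw [(hH 0).1 _ hlt, hf.inv hs 0 hlt]
    · rw [if_neg fun h => hts h.2]
      have hemp : termScales n blk (s 1) (s 2) {t} {t} t = ∅ := by
        refine Finset.eq_empty_of_forall_notMem fun r hr => hts ?_
        have := (hb t r hr).2
        rw [(hle t r hr).1 rfl rfl] at this
        exact this.symm
      have e : ∀ ω, H ω * rieszTerm f n blk q ρ (s 1) (s 2) {t} {t} ω = 0 := by
        intro ω
        rw [rieszTerm, rieszProd, Finset.prod_eq_zero (Finset.mem_range.2 ht), mul_zero]
        simp [hemp, signSum]
      simp only [e]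
      simp [avg]
  · rw [if_neg fun h => htu h.1]
    -- The maxima lie in different blocks, so no scale attains both. The whole product averages to
    -- the product of its constant terms, which vanishes at block `t`.
    simp only [rieszTerm]
    rw [avg_mul_rieszProd hf hblk hb, Finset.prod_eq_zero (Finset.mem_range.2 ht), mul_zero]
    · simp
    · intro w _ r hr ω
      refine (hH 0).1 _ ((hle w r hr).2 ?_) ω
      by_cases h : w = t
      · exact Or.inr (h ▸ htu)
      · exact Or.inl h

/-- Testing a Haar function of order `n` against the main part of the Riesz product. -/
theorem avg_haar_mul_mainPart (hf : IsSignFamily T n f) (hblk : Monotone blk)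
    {s : Fin 3 → ℕ} (hs : ∑ i, s i = n) (hq : blk (s 0) < q) {H : Ω → ℝ} (hH : IsHaar T s H) :
    avg (fun ω => H ω * mainPart f n blk q ρ ω) = ρ * avg (fun ω => H ω * f s ω) := by
  have e : ∀ h : Finset ℕ → ℝ, ∑ V ∈ (Finset.range q).powersetCard 1, h V =
      ∑ t ∈ Finset.range q, h {t} := fun h => by
    rw [Finset.powersetCard_one, Finset.sum_map]
    rfl
  have hs' := hs
  rw [Fin.sum_univ_three] at hs'
  simp only [mainPart, e, Finset.mul_sum, avg_sum]
  have hcd : ∀ t ∈ Finset.range q, ∀ u ∈ Finset.range q,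
      ∑ c ∈ Finset.range (n + 1), ∑ d ∈ Finset.range (n + 1),
        avg (fun ω => H ω * rieszTerm f n blk q ρ c d {t} {u} ω) =
      if t = u ∧ t = blk (s 0) then ρ * avg (fun ω => H ω * f s ω) else 0 := by
    intro t ht u hu
    rw [Finset.mem_range] at ht hu
    rw [Finset.sum_eq_single (s 1), Finset.sum_eq_single (s 2),
      avg_haar_mul_rieszTerm hf hblk hs hH ht]
    · intro d _ hd
      exact avg_haar_mul_rieszTerm_of_third_ne hf hH hu hd.symm
    · intro h
      simp only [Finset.mem_range] at h
      omega
    · intro c _ hc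
      exact Finset.sum_eq_zero fun d _ =>
        avg_haar_mul_rieszTerm_of_second_ne hf hH ht hc.symm
    · intro h
      simp only [Finset.mem_range] at h
      omega
  rw [Finset.sum_congr rfl fun t ht => Finset.sum_congr rfl fun u hu => hcd t ht u hu,
    Finset.sum_eq_single (blk (s 0)), Finset.sum_eq_single (blk (s 0))]
  · simp
  · intro u _ hu
    rw [if_neg fun h => hu h.1.symm]
  · intro h
    exact absurd (Finset.mem_range.2 hq) h
  · intro t _ ht
    exact Finset.sum_eq_zero fun u _ => if_neg fun h => ht h.2
  · intro h
    exact absurd (Finset.mem_range.2 hq) h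

end Duality

/-! ### Dependence of the remaining factors on the cutoff -/

section LowerProducts

variable {Ω : Type*} {n : ℕ} {f : (Fin 3 → ℕ) → Ω → ℝ} {blk : ℕ → ℕ} {q : ℕ} {ρ : ℝ}

/-- Scales of block `w` with second coordinate below `c`, for given data of the third. -/
def lowScales (n : ℕ) (blk : ℕ → ℕ) (d : ℕ) (V' : Finset ℕ) (c w : ℕ) : Finset (Fin 3 → ℕ) :=
  blockScales n blk (fun r => r 1 < c ∧ CutAt (w ∈ V') (r 2) d) w

/-- Scales of block `w` with second coordinate `c`, for given data of the third. -/
def topScales (n : ℕ) (blk : ℕ → ℕ) (d : ℕ) (V' : Finset ℕ) (c w : ℕ) : Finset (Fin 3 → ℕ) :=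
  blockScales n blk (fun r => r 1 = c ∧ CutAt (w ∈ V') (r 2) d) w

/-- The product of the lower parts of the blocks in `W`, with cutoffs depending on the block. -/
noncomputable def lowProd (f : (Fin 3 → ℕ) → Ω → ℝ) (n : ℕ) (blk : ℕ → ℕ) (ρ : ℝ) (d : ℕ)
    (V' : Finset ℕ) (κ : ℕ → ℕ) (W : Finset ℕ) (ω : Ω) : ℝ :=
  rieszProd f ρ (fun w => if w ∈ V' then 0 else 1) (fun w => lowScales n blk d V' (κ w) w) W ω

/-- Telescoping over the blocks: the cutoff is changed one block at a time, which gives a short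
signed sum times a product with mixed cutoffs. -/
theorem lowProd_sub_lowProd (d : ℕ) (V' : Finset ℕ) (c c₀ : ℕ) (hc : c₀ ≤ c) (W : Finset ℕ)
    (ω : Ω) :
    lowProd f n blk ρ d V' (fun _ => c) W ω - lowProd f n blk ρ d V' (fun _ => c₀) W ω =
      ∑ i ∈ W, ρ * signSum f (blockScales n blk
          (fun r => r 1 ∈ Finset.Ico c₀ c ∧ CutAt (i ∈ V') (r 2) d) i) ω *
        lowProd f n blk ρ d V' (fun w => if w < i then c₀ else c) (W.erase i) ω := by
  set Y : ℕ → ℕ → ℝ := fun c w =>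
    (if w ∈ V' then (0 : ℝ) else 1) + ρ * signSum f (lowScales n blk d V' c w) ω with hY
  have hdiff : ∀ i, Y c i - Y c₀ i = ρ * signSum f (blockScales n blk
      (fun r => r 1 ∈ Finset.Ico c₀ c ∧ CutAt (i ∈ V') (r 2) d) i) ω := by
    intro i
    have : signSum f (lowScales n blk d V' c i) ω = signSum f (lowScales n blk d V' c₀ i) ω +
        signSum f (blockScales n blk
          (fun r => r 1 ∈ Finset.Ico c₀ c ∧ CutAt (i ∈ V') (r 2) d) i) ω := by
      rw [signSum, signSum, signSum, ← Finset.sum_union]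
      · refine Finset.sum_congr ?_ fun _ _ => rfl
        ext r
        simp only [lowScales, Finset.mem_union, mem_blockScales, Finset.mem_Ico]
        have : r 1 < c ↔ r 1 < c₀ ∨ c₀ ≤ r 1 ∧ r 1 < c := by omega
        rw [this]
        tauto
      · rw [Finset.disjoint_left]
        intro r h1 h2
        have h1 := (mem_blockScales.1 h1).2.2.1
        have h2 := (Finset.mem_Ico.1 (mem_blockScales.1 h2).2.2.1).1
        omega
    simp only [hY, this]
    ring
  have h1 := Finset.prod_sub_ordered W (Y c) (fun i => Y c i - Y c₀ i)
  simp only [sub_sub_cancel] at h1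
  change ∏ w ∈ W, Y c w - ∏ w ∈ W, Y c₀ w = _
  rw [h1, sub_sub_cancel]
  refine Finset.sum_congr rfl fun i hi => ?_
  rw [hdiff, mul_assoc]
  congr 1
  have e : W.erase i = W.filter (· < i) ∪ W.filter (i < ·) := by
    ext w
    simp only [Finset.mem_erase, Finset.mem_union, Finset.mem_filter, ← and_or_left]
    rw [and_comm]
    exact and_congr_right fun _ => lt_or_lt_iff_ne.symm
  rw [lowProd, rieszProd, e, Finset.prod_union]
  · congr 1
    · refine Finset.prod_congr rfl fun w hw => ?_
      simp only [(Finset.mem_filter.1 hw).2, if_true, hY]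
    · refine Finset.prod_congr rfl fun w hw => ?_
      simp only [(Finset.mem_filter.1 hw).2.not_gt, if_false, hY]
  · rw [Finset.disjoint_left]
    intro w h1 h2
    have h1 := (Finset.mem_filter.1 h1).2
    have h2 := (Finset.mem_filter.1 h2).2
    omega

theorem rieszTerm_pair_eq {t u : ℕ} (htu : t ≠ u) (ht : t < q) (hu : u < q) (c d : ℕ)
    (V' : Finset ℕ) (ω : Ω) :
    rieszTerm f n blk q ρ c d {t, u} V' ω =
      ρ * signSum f (topScales n blk d V' c t) ω * (ρ * signSum f (topScales n blk d V' c u) ω) *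
        lowProd f n blk ρ d V' (fun _ => c) (((Finset.range q).erase t).erase u) ω := by
  have htop : ∀ w ∈ ({t, u} : Finset ℕ), termScales n blk c d {t, u} V' w =
      topScales n blk d V' c w := fun w hw =>
    blockScales_congr (fun r => by rw [CutAt, if_pos hw]) w
  have hlow : ∀ w ∉ ({t, u} : Finset ℕ), termScales n blk c d {t, u} V' w =
      lowScales n blk d V' c w := fun w hw =>
    blockScales_congr (fun r => by rw [CutAt, if_neg hw]) w
  have hu' : u ∈ (Finset.range q).erase t := by simp [htu.symm, hu]
  rw [rieszTerm, rieszProd, ← Finset.mul_prod_erase _ _ (Finset.mem_range.2 ht),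
    ← Finset.mul_prod_erase _ _ hu', htop t (by simp), htop u (by simp), mul_assoc]
  congr 1
  · simp
  congr 1
  · simp
  · refine Finset.prod_congr rfl fun w hw => ?_
    have hw' : w ∉ ({t, u} : Finset ℕ) := by
      simp only [Finset.mem_erase] at hw
      simp [hw.1, hw.2.1]
    rw [hlow w hw']
    simp only [Finset.mem_union, hw', false_or]

/-- Two scales with second coordinate `c` in blocks `t < u` have equal coordinate sums, so the later
one has the smaller third coordinate and cannot attain the maximum `d`. -/
theorem rieszTerm_pair_eq_zero (hblk : Monotone blk) {t u : ℕ} (htu : t < u) (hu : u < q)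
    (c d : ℕ) {V' : Finset ℕ} (huV : u ∈ V') (ω : Ω) :
    rieszTerm f n blk q ρ c d {t, u} V' ω = 0 := by
  rw [rieszTerm_pair_eq htu.ne (htu.trans hu) hu]
  rcases (topScales n blk d V' c t).eq_empty_or_nonempty with h | ⟨r, hr⟩
  · simp [h, signSum]
  rcases (topScales n blk d V' c u).eq_empty_or_nonempty with h | ⟨s, hs⟩
  · simp [h, signSum]
  exfalso
  obtain ⟨r1, r2, r3, r4⟩ := mem_blockScales.1 hr
  obtain ⟨s1, s2, s3, s4⟩ := mem_blockScales.1 hs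
  rw [CutAt, if_pos huV] at s4
  have hlt : r 0 < s 0 := hblk.reflect_lt (by rw [r2, s2]; exact htu)
  have hr2 : r 2 ≤ d := by
    unfold CutAt at r4
    split_ifs at r4 <;> omega
  rw [Fin.sum_univ_three] at r1 s1
  omega

end LowerProducts

/-! ### Brute force bounds for single terms -/

section Estimates

variable {Ω : Type*} [Fintype Ω] {T : Fin 3 → ℕ → Equiv.Perm Ω} {n : ℕ}
  {f : (Fin 3 → ℕ) → Ω → ℝ} {blk : ℕ → ℕ} {q m M : ℕ} {ρ σ : ℝ}

theorem avg_abs_sum_le {ι : Type*} (s : Finset ι) (g : ι → Ω → ℝ) :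
    avg (fun ω => |∑ i ∈ s, g i ω|) ≤ ∑ i ∈ s, avg fun ω => |g i ω| := by
  rw [← avg_sum]
  exact avg_mono fun ω => Finset.abs_sum_le_sum_abs _ _

theorem avg_abs_add_le (g h : Ω → ℝ) :
    avg (fun ω => |g ω + h ω|) ≤ avg (fun ω => |g ω|) + avg fun ω => |h ω| := by
  rw [← avg_add]
  exact avg_mono fun ω => abs_add_le _ _

/-- The relations between the parameters that the estimates of the terms use. -/
structure TermParams (n q m M : ℕ) (ρ σ : ℝ) : Prop where
  m_ne : m ≠ 0
  M_ge : 2 * m * (q + 1) ≤ M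
  ρ_pos : 0 < ρ
  σ_pos : 0 < σ
  σ_ge : 4 * ((4 * M : ℕ) : ℝ) ^ 4 * ρ ^ 2 * (n + 1) ≤ σ ^ 2
  one_le : 1 ≤ σ ^ 2 * (n + 1)

theorem TermParams.M_pos (h : TermParams n q m M ρ σ) : 0 < M := by
  have := h.M_ge
  have := h.m_ne
  have : 0 < 2 * m * (q + 1) := by positivity
  omega

theorem TermParams.hasMoments_of_third [Nonempty Ω] (h : TermParams n q m M ρ σ)
    (hf : IsSignFamily T n f) {A : Finset (Fin 3 → ℕ)} (hA : ∀ r ∈ A, ∑ i, r i = n) {d : ℕ}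
    (hd : ∀ r ∈ A, r 2 = d) : HasMoments (4 * M) (fun ω => ρ * signSum f A ω) (σ ^ 2) := by
  have := h.M_pos
  exact hf.hasMoments h.ρ_pos hA (by omega) (by positivity)
    (by exact_mod_cast card_le_of_third hA hd) h.σ_ge

theorem TermParams.hasMoments_of_second [Nonempty Ω] (h : TermParams n q m M ρ σ)
    (hf : IsSignFamily T n f) {A : Finset (Fin 3 → ℕ)} (hA : ∀ r ∈ A, ∑ i, r i = n)
    {C : Finset ℕ} (hC : ∀ r ∈ A, r 1 ∈ C) {a : ℝ} (ha : 0 < a) (hCa : (C.card : ℝ) ≤ a) :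
    HasMoments (4 * M) (fun ω => ρ * signSum f A ω) (σ ^ 2 * a) := by
  have := h.M_pos
  refine hf.hasMoments h.ρ_pos hA (by omega) (a := a * (n + 1)) (by positivity) ?_ ?_
  · calc (A.card : ℝ) ≤ C.card * (n + 1) := by exact_mod_cast card_le_of_second hA hC
      _ ≤ _ := by gcongr
  · calc _ = 4 * ((4 * M : ℕ) : ℝ) ^ 4 * ρ ^ 2 * (n + 1) * a := by ring
      _ ≤ _ := by gcongr; exact h.σ_ge

/-- Fixing the third coordinate as well leaves one scale for each second coordinate. The factor `n +
1` saved is turned into a second `σ ^ 2` by `one_le`. -/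
theorem TermParams.hasMoments_of_second_third [Nonempty Ω] (h : TermParams n q m M ρ σ)
    (hf : IsSignFamily T n f) {A : Finset (Fin 3 → ℕ)} (hA : ∀ r ∈ A, ∑ i, r i = n)
    {C : Finset ℕ} (hC : ∀ r ∈ A, r 1 ∈ C) {d : ℕ} (hd : ∀ r ∈ A, r 2 = d) {a : ℝ} (ha : 0 < a)
    (hCa : (C.card : ℝ) ≤ a) :
    HasMoments (4 * M) (fun ω => ρ * signSum f A ω) (σ ^ 2 * a * σ ^ 2) := by
  have := h.M_pos
  refine hf.hasMoments h.ρ_pos hA (by omega) (a := a) ha ?_ ?_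
  · calc (A.card : ℝ) ≤ C.card := by exact_mod_cast card_le_of_second_third hA hC hd
      _ ≤ _ := hCa
  · have hK : 0 ≤ 4 * ((4 * M : ℕ) : ℝ) ^ 4 * ρ ^ 2 := by positivity
    calc _ = 4 * ((4 * M : ℕ) : ℝ) ^ 4 * ρ ^ 2 * 1 * a := by ring
      _ ≤ 4 * ((4 * M : ℕ) : ℝ) ^ 4 * ρ ^ 2 * (σ ^ 2 * (n + 1)) * a := by
          gcongr; exact h.one_le
      _ = 4 * ((4 * M : ℕ) : ℝ) ^ 4 * ρ ^ 2 * (n + 1) * (a * σ ^ 2) := by ring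
      _ ≤ σ ^ 2 * (a * σ ^ 2) := by gcongr; exact h.σ_ge
      _ = _ := by ring

/-- The weight of block `w`: `σ²` if `w ∈ V`, and `1` otherwise. -/
noncomputable def wt (σ : ℝ) (V : Finset ℕ) (w : ℕ) : ℝ := if w ∈ V then σ ^ 2 else 1

theorem wt_pos (hσ : 0 < σ) (V : Finset ℕ) (w : ℕ) : 0 < wt σ V w := by
  unfold wt; split_ifs <;> positivity

theorem prod_wt {V W : Finset ℕ} (h : V ⊆ W) : ∏ w ∈ W, wt σ V w = (σ ^ V.card) ^ 2 := by
  unfold wt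
  rw [Finset.prod_ite_mem, Finset.inter_eq_right.2 h, Finset.prod_const]
  ring

/-- Each prescribed maximum costs one factor `σ`; the unrestricted blocks form a Riesz product
covered by `RieszControl`. -/
theorem avg_abs_rieszTerm_le [Nonempty Ω] (h : TermParams n q m M ρ σ) (hf : IsSignFamily T n f)
    (hR : RieszControl f n blk q ρ m) (c d : ℕ) {V V' : Finset ℕ} (hV : V ⊆ Finset.range q)
    (hV' : V' ⊆ Finset.range q) :
    avg (fun ω => |rieszTerm f n blk q ρ c d V V' ω|) ≤ 5 * σ ^ (V.card + V'.card) := by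
  have hb := isBlocked_termScales (n := n) (blk := blk) c d V V'
  have hu : V ∪ V' ⊆ Finset.range q := Finset.union_subset hV hV'
  have hσ := h.σ_pos
  have e : ∀ ω, rieszTerm f n blk q ρ c d V V' ω =
      1 * (∏ w ∈ V ∪ V', ρ * signSum f (termScales n blk c d V V' w) ω) *
        rieszProd f ρ 1 (termScales n blk c d V V') (Finset.range q \ (V ∪ V')) ω := by
    intro ω
    rw [rieszTerm, rieszProd, ← Finset.prod_sdiff hu, mul_comm, one_mul]
    congr 1
    · refine Finset.prod_congr rfl fun w hw => ?_
      rw [if_pos hw, zero_add]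
    · refine Finset.prod_congr rfl fun w hw => ?_
      rw [if_neg (Finset.mem_sdiff.1 hw).2, Pi.one_apply]
  simp only [e]
  refine hR.avg_abs_le h.m_ne hb Finset.sdiff_subset (hasMoments_one M)
    (v := fun w => wt σ V w * wt σ V' w) (fun w hw => ?_) hu h.M_ge (by positivity) ?_
  · refine HasMoments.mono (M := 4 * M) (v := wt σ V w * wt σ V' w) ?_ (by omega) le_rfl
    have hA : ∀ r ∈ termScales n blk c d V V' w, ∑ i, r i = n := fun r hr => (hb w r hr).1
    have h1 : w ∈ V → ∀ r ∈ termScales n blk c d V V' w, r 1 ∈ ({c} : Finset ℕ) := by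
      intro hw r hr
      have := (mem_blockScales.1 hr).2.2.1
      rw [CutAt, if_pos hw] at this
      simpa using this
    have h2 : w ∈ V' → ∀ r ∈ termScales n blk c d V V' w, r 2 = d := by
      intro hw r hr
      have := (mem_blockScales.1 hr).2.2.2
      rwa [CutAt, if_pos hw] at this
    by_cases hw1 : w ∈ V
    · by_cases hw2 : w ∈ V'
      · simpa [wt, hw1, hw2] using
          h.hasMoments_of_second_third hf hA (h1 hw1) (h2 hw2) (a := 1) one_pos (by simp)
      · simpa [wt, hw1, hw2] using h.hasMoments_of_second hf hA (h1 hw1) (a := 1) one_pos (by simp)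
    · have hw2 : w ∈ V' := (Finset.mem_union.1 hw).resolve_left hw1
      simpa [wt, hw1, hw2] using h.hasMoments_of_third hf hA (h2 hw2)
  · rw [Finset.prod_mul_distrib, prod_wt Finset.subset_union_left,
      prod_wt Finset.subset_union_right, pow_add]
    exact le_of_eq (by ring)

theorem avg_abs_mul_lowProd_le [Nonempty Ω] (h : TermParams n q m M ρ σ)
    (hf : IsSignFamily T n f) (hR : RieszControl f n blk q ρ m) (d : ℕ) (V' : Finset ℕ)
    (κ : ℕ → ℕ) {W : Finset ℕ} (hW : W ⊆ Finset.range q) {G : Ω → ℝ} {vG : ℝ}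
    (hG : HasMoments M G vG) {s : ℝ} (hs : 0 < s) (hv : vG * ∏ w ∈ W, wt σ V' w ≤ s ^ 2) :
    avg (fun ω => |G ω * lowProd f n blk ρ d V' κ W ω|) ≤ 5 * s := by
  have hb : IsBlocked n blk (fun w => lowScales n blk d V' (κ w) w) :=
    isBlocked_blockScales fun w r => r 1 < κ w ∧ CutAt (w ∈ V') (r 2) d
  have e : ∀ ω, G ω * lowProd f n blk ρ d V' κ W ω =
      G ω * (∏ w ∈ W ∩ V', ρ * signSum f (lowScales n blk d V' (κ w) w) ω) *
        rieszProd f ρ 1 (fun w => lowScales n blk d V' (κ w) w) (W \ V') ω := by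
    intro ω
    rw [lowProd, rieszProd, mul_assoc, ← Finset.prod_inter_mul_prod_sdiff W V']
    congr 2
    · refine Finset.prod_congr rfl fun w hw => ?_
      rw [if_pos (Finset.mem_inter.1 hw).2, zero_add]
    · refine Finset.prod_congr rfl fun w hw => ?_
      rw [if_neg (Finset.mem_sdiff.1 hw).2, Pi.one_apply]
  simp only [e]
  refine hR.avg_abs_le h.m_ne hb (Finset.sdiff_subset.trans hW) hG (v := fun _ => σ ^ 2)
    (fun w hw => ?_) (Finset.inter_subset_left.trans hW) h.M_ge hs ?_
  · refine (h.hasMoments_of_third hf (fun r hr => (hb w r hr).1) (d := d)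
      (fun r hr => ?_)).mono (by omega) le_rfl
    have := (mem_blockScales.1 hr).2.2.2
    rwa [CutAt, if_pos (Finset.mem_inter.1 hw).2] at this
  · refine le_trans (le_of_eq ?_) hv
    congr 1
    unfold wt
    rw [Finset.prod_ite_mem]

end Estimates

/-! ### Maxima shared by exactly two blocks -/

section PairEstimate

variable {Ω : Type*} [Fintype Ω] {T : Fin 3 → ℕ → Equiv.Perm Ω} {n : ℕ}
  {f : (Fin 3 → ℕ) → Ω → ℝ} {blk : ℕ → ℕ} {q m M : ℕ} {ρ σ : ℝ}

theorem card_div_eq_le (n L j : ℕ) (hL : 0 < L) :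
    ({c ∈ Finset.range (n + 1) | c / L = j}).card ≤ L := by
  calc _ ≤ (Finset.Ico (L * j) (L * j + L)).card := by
        refine Finset.card_le_card fun c hc => ?_
        have h := (Finset.mem_filter.1 hc).2
        rw [Finset.mem_Ico]
        have h1 := Nat.div_add_mod c L
        have h2 := Nat.mod_lt c hL
        rw [h] at h1
        omega
    _ = L := by simp

/-- Square-root cancellation over a window of `L` values of `c`: the bound grows like `L` and not
like its square. The condition `hLτ` makes the off-diagonal part of the coincidence estimate no
larger than the diagonal one. -/
theorem TermParams.hasMoments_top_mul_top [Nonempty Ω] (h : TermParams n q m M ρ σ)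
    (hf : IsSignFamily T n f) (hblk : Monotone blk) {t u : ℕ} (htu : t < u) (d : ℕ)
    (V' : Finset ℕ) {L : ℕ} (hL : 0 < L) (j : ℕ) {τ : ℝ} (hτ : 0 ≤ τ)
    (hτM : 2 * (M : ℝ) ^ 2 * (n + 1) ≤ τ ^ 2) (hLτ : L * τ ≤ n + 1) :
    HasMoments M (fun ω => ∑ c ∈ Finset.range (n + 1) with c / L = j,
        ρ * signSum f (topScales n blk d V' c t) ω * (ρ * signSum f (topScales n blk d V' c u) ω))
      (16 * ρ ^ 4 * M ^ 4 * L * (n + 1) ^ 2 * wt σ V' t) := by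
  classical
  have hM : (0 : ℝ) < M := by exact_mod_cast h.M_pos
  have hρ := h.ρ_pos
  have hL' : (0 : ℝ) < L := by exact_mod_cast hL
  set C := {c ∈ Finset.range (n + 1) | c / L = j} with hC
  -- If `t ∈ V'`, the third coordinate of the first scale is fixed, which produces the weight `wt σ
  -- V' t`.
  set K : Finset ℕ := if t ∈ V' then {d} else Finset.range (n + 1) with hK
  have hCc : (C.card : ℝ) ≤ L := by exact_mod_cast card_div_eq_le n L j hL
  have hKc : (K.card : ℝ) ≤ (n + 1) * wt σ V' t := by
    rw [hK, wt]
    split_ifs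
    · have := h.one_le
      simp only [Finset.card_singleton, Nat.cast_one]
      linarith
    · simp
  set E := C.biUnion fun c => topScales n blk d V' c t ×ˢ topScales n blk d V' c u with hE
  have hmem : ∀ p ∈ E, ∑ i, p.1 i = n ∧ ∑ i, p.2 i = n ∧ p.1 1 = p.2 1 ∧ p.1 0 < p.2 0 ∧
      p.1 1 ∈ C ∧ p.1 2 ∈ K := by
    intro p hp
    obtain ⟨c, hc, hp⟩ := Finset.mem_biUnion.1 hp
    obtain ⟨hr, hs⟩ := Finset.mem_product.1 hp
    obtain ⟨r1, r2, r3, r4⟩ := mem_blockScales.1 hr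
    obtain ⟨s1, s2, s3, s4⟩ := mem_blockScales.1 hs
    refine ⟨r1, s1, r3.trans s3.symm, hblk.reflect_lt (by rw [r2, s2]; exact htu), by rwa [r3], ?_⟩
    rw [hK]
    split_ifs with htV
    · rw [CutAt, if_pos htV] at r4
      simpa using r4
    · rw [Fin.sum_univ_three] at r1
      rw [Finset.mem_range]
      omega
  have hsum : ∀ ω, ∑ c ∈ C, ρ * signSum f (topScales n blk d V' c t) ω *
      (ρ * signSum f (topScales n blk d V' c u) ω) = ρ ^ 2 * ∑ p ∈ E, f p.1 ω * f p.2 ω := by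
    intro ω
    rw [hE, Finset.sum_biUnion, Finset.mul_sum]
    · refine Finset.sum_congr rfl fun c _ => ?_
      simp only [signSum, Finset.sum_product]
      rw [← Finset.sum_mul_sum]
      ring
    · intro c _ c' _ hcc
      rw [Function.onFun, Finset.disjoint_left]
      intro p hp hp'
      have h1 := (mem_blockScales.1 (Finset.mem_product.1 hp).1).2.2.1
      have h2 := (mem_blockScales.1 (Finset.mem_product.1 hp').1).2.2.1
      exact hcc (h1.symm.trans h2)
  refine ⟨mul_pos (by positivity) (wt_pos h.σ_pos _ _), fun l hl => ?_⟩
  rcases Nat.eq_zero_or_pos l with rfl | hl0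
  · simp [avg_const]
  have hlM : (l : ℝ) ≤ M := by exact_mod_cast hl
  have hl' : 2 * (l : ℝ) ^ 2 * (n + 1) ≤ τ ^ 2 := hτM.trans' (by gcongr)
  have hp := hf.avg_pair_pow_le (i := 1) (j := 0) (k := 2) (by decide) (by decide) (by decide)
    E (fun p hp => ⟨(hmem p hp).1, (hmem p hp).2.1, (hmem p hp).2.2.1, (hmem p hp).2.2.2.1⟩)
    C K (fun p hp => (hmem p hp).2.2.2.2.1) (fun p hp => (hmem p hp).2.2.2.2.2)
    hl0.ne' hτ hl'
  simp only [hsum, mul_pow (ρ ^ 2)]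
  rw [avg_const_mul]
  calc _ ≤ (ρ ^ 2) ^ (2 * l) * (8 * (l : ℝ) ^ 4 *
        (C.card * K.card * (n + 1) + C.card ^ 2 * K.card * τ)) ^ l := by gcongr
    _ = (ρ ^ 4 * (8 * (l : ℝ) ^ 4 *
        (C.card * K.card * (n + 1) + C.card ^ 2 * K.card * τ))) ^ l := by
        rw [mul_pow (ρ ^ 4), ← pow_mul, ← pow_mul]; ring_nf
    _ ≤ (ρ ^ 4 * (8 * (M : ℝ) ^ 4 *
        (L * ((n + 1) * wt σ V' t) * (n + 1) + L ^ 2 * ((n + 1) * wt σ V' t) * τ))) ^ l := by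
        gcongr
    _ ≤ _ := by
        have hw := wt_pos h.σ_pos V' t
        refine pow_le_pow_left₀ (by positivity) ?_ l
        have h1 : (L : ℝ) ^ 2 * ((n + 1) * wt σ V' t) * τ ≤
            L * ((n + 1) * wt σ V' t) * (n + 1) := by
          calc (L : ℝ) ^ 2 * ((n + 1) * wt σ V' t) * τ
              = L * ((n + 1) * wt σ V' t) * (L * τ) := by ring
            _ ≤ _ := by gcongr
        calc _ ≤ ρ ^ 4 * (8 * (M : ℝ) ^ 4 * (L * ((n + 1) * wt σ V' t) * (n + 1) +
              L * ((n + 1) * wt σ V' t) * (n + 1))) := by gcongr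
          _ = _ := by ring

/-- The bound for the sum of the terms with a maximum repeated exactly twice. -/
noncomputable def pairBound (n q M l : ℕ) (ρ σ : ℝ) : ℝ :=
  ((n / l ^ 2 : ℕ) + 1) * (20 * ρ ^ 2 * M ^ 2 * (n + 1) * l) + (n + 1) * (q * (5 * (σ ^ 3 * l)))

/-- The lower product varies with `c` and would spoil the cancellation, so `c` is grouped into
windows of length `l ^ 2` and the cutoff is frozen at the start of the window. The frozen part gains
a factor `l`. The correction has a third restricted factor, of size `σ * l`, and is affordable
because of the resulting `σ ^ 3`. -/
theorem avg_abs_sum_rieszTerm_pair_le [Nonempty Ω] (h : TermParams n q m M ρ σ)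
    (hf : IsSignFamily T n f) (hblk : Monotone blk) (hR : RieszControl f n blk q ρ m)
    {t u : ℕ} (htu : t < u) (hu : u < q) (d : ℕ) {V' : Finset ℕ} (hV' : V' ⊆ Finset.range q)
    {l : ℕ} (hl : 0 < l) {τ : ℝ} (hτ : 0 ≤ τ) (hτM : 2 * (M : ℝ) ^ 2 * (n + 1) ≤ τ ^ 2)
    (hlτ : (l : ℝ) ^ 2 * τ ≤ n + 1) :
    avg (fun ω => |∑ c ∈ Finset.range (n + 1), rieszTerm f n blk q ρ c d {t, u} V' ω|) ≤
      pairBound n q M l ρ σ * σ ^ V'.card := by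
  classical
  have hσ := h.σ_pos
  have hρ := h.ρ_pos
  have hM : (0 : ℝ) < M := by exact_mod_cast h.M_pos
  have hl' : (0 : ℝ) < l := by exact_mod_cast hl
  by_cases huV : u ∈ V'
  · simp only [rieszTerm_pair_eq_zero hblk htu hu _ d huV, Finset.sum_const_zero, abs_zero]
    have : 0 ≤ pairBound n q M l ρ σ * σ ^ V'.card := by unfold pairBound; positivity
    simpa [avg] using this
  set L := l ^ 2 with hL
  have hL0 : 0 < L := by positivity
  set W := ((Finset.range q).erase t).erase u with hW
  have hWq : W ⊆ Finset.range q := (Finset.erase_subset _ _).trans (Finset.erase_subset _ _)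
  have hu' : u ∈ (Finset.range q).erase t := by simp [htu.ne', hu]
  have hprod : wt σ V' t * ∏ w ∈ W, wt σ V' w = (σ ^ V'.card) ^ 2 := by
    rw [← prod_wt hV', ← Finset.mul_prod_erase _ _ (Finset.mem_range.2 (htu.trans hu)),
      ← Finset.mul_prod_erase _ _ hu', show wt σ V' u = 1 by simp [wt, huV], one_mul]
  set Z : ℕ → Ω → ℝ := fun c ω => ρ * signSum f (topScales n blk d V' c t) ω *
    (ρ * signSum f (topScales n blk d V' c u) ω) with hZ
  have hdecomp : ∀ ω, ∑ c ∈ Finset.range (n + 1), rieszTerm f n blk q ρ c d {t, u} V' ω =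
      (∑ j ∈ Finset.range (n / L + 1), (∑ c ∈ Finset.range (n + 1) with c / L = j, Z c ω) *
          lowProd f n blk ρ d V' (fun _ => L * j) W ω) +
        ∑ c ∈ Finset.range (n + 1), ∑ i ∈ W, (Z c ω * (ρ * signSum f (blockScales n blk
            (fun r => r 1 ∈ Finset.Ico (L * (c / L)) c ∧ CutAt (i ∈ V') (r 2) d) i) ω)) *
          lowProd f n blk ρ d V' (fun w => if w < i then L * (c / L) else c) (W.erase i) ω := by
    intro ω
    have e1 : ∀ j ∈ Finset.range (n / L + 1),
        (∑ c ∈ Finset.range (n + 1) with c / L = j, Z c ω) *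
          lowProd f n blk ρ d V' (fun _ => L * j) W ω =
        ∑ c ∈ Finset.range (n + 1) with c / L = j,
          Z c ω * lowProd f n blk ρ d V' (fun _ => L * (c / L)) W ω := by
      intro j _
      rw [Finset.sum_mul]
      refine Finset.sum_congr rfl fun c hc => ?_
      rw [(Finset.mem_filter.1 hc).2]
    rw [Finset.sum_congr rfl e1, Finset.sum_fiberwise_of_maps_to (g := fun c => c / L),
      ← Finset.sum_add_distrib]
    · refine Finset.sum_congr rfl fun c _ => ?_
      rw [rieszTerm_pair_eq htu.ne (htu.trans hu) hu]
      have := lowProd_sub_lowProd (f := f) (n := n) (blk := blk) (ρ := ρ) d V' c (L * (c / L))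
        (Nat.mul_div_le c L) W ω
      simp only [mul_assoc (Z c ω)]
      rw [← Finset.mul_sum, ← this]
      simp only [hZ]
      ring
    · intro c hc
      rw [Finset.mem_range] at hc ⊢
      have : c / L ≤ n / L := Nat.div_le_div_right (by omega)
      omega
  simp only [hdecomp]
  refine (avg_abs_add_le _ _).trans ?_
  rw [pairBound, add_mul]
  refine add_le_add ?_ ?_
  · refine (avg_abs_sum_le _ _).trans ?_
    refine (Finset.sum_le_card_nsmul _ _ (5 * (4 * ρ ^ 2 * M ^ 2 * (n + 1) * l * σ ^ V'.card))
      fun j _ => ?_).trans ?_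
    · refine avg_abs_mul_lowProd_le h hf hR d V' _ hWq
        (h.hasMoments_top_mul_top hf hblk htu d V' hL0 j hτ hτM ?_) (by positivity) ?_
      · rw [hL]; push_cast; exact hlτ
      · rw [mul_assoc _ (wt σ V' t), hprod, hL]
        push_cast
        exact le_of_eq (by ring)
    · rw [Finset.card_range, nsmul_eq_mul]
      push_cast
      exact le_of_eq (by ring)
  · refine (avg_abs_sum_le _ _).trans ?_
    refine (Finset.sum_le_card_nsmul _ _ (q * (5 * (σ ^ 3 * l * σ ^ V'.card)))
      fun c _ => ?_).trans ?_
    · refine (avg_abs_sum_le _ _).trans ?_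
      refine (Finset.sum_le_card_nsmul _ _ (5 * (σ ^ 3 * l * σ ^ V'.card))
        fun i hi => ?_).trans ?_
      · have hcut : ∀ w, ∀ r ∈ blockScales n blk (fun r => r 1 ∈ Finset.Ico (L * (c / L)) c ∧
            CutAt (w ∈ V') (r 2) d) w, w ∈ V' → r 2 = d := by
          intro w r hr hw
          have := (mem_blockScales.1 hr).2.2.2
          rwa [CutAt, if_pos hw] at this
        have hcutt : ∀ w, ∀ r ∈ topScales n blk d V' c w, w ∈ V' → r 2 = d := by
          intro w r hr hw
          have := (mem_blockScales.1 hr).2.2.2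
          rwa [CutAt, if_pos hw] at this
        have hIco : ((Finset.Ico (L * (c / L)) c).card : ℝ) ≤ l ^ 2 := by
          rw [Nat.card_Ico]
          have h1 := Nat.div_add_mod c L
          have h2 := Nat.mod_lt c hL0
          have : c - L * (c / L) ≤ l ^ 2 := by omega
          exact_mod_cast this
        have m1 : ∀ w, HasMoments (4 * M) (fun ω => ρ * signSum f (topScales n blk d V' c w) ω)
            (σ ^ 2 * wt σ V' w) := by
          intro w
          have hA : ∀ r ∈ topScales n blk d V' c w, ∑ i, r i = n := fun r hr =>
            (mem_blockScales.1 hr).1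
          have hC : ∀ r ∈ topScales n blk d V' c w, r 1 ∈ ({c} : Finset ℕ) := fun r hr => by
            simpa using (mem_blockScales.1 hr).2.2.1
          by_cases hw : w ∈ V'
          · simpa [wt, hw] using h.hasMoments_of_second_third hf hA hC
              (fun r hr => hcutt w r hr hw) (a := 1) one_pos (by simp)
          · simpa [wt, hw] using h.hasMoments_of_second hf hA hC (a := 1) one_pos (by simp)
        have m2 : HasMoments (4 * M) (fun ω => ρ * signSum f (blockScales n blk
            (fun r => r 1 ∈ Finset.Ico (L * (c / L)) c ∧ CutAt (i ∈ V') (r 2) d) i) ω)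
            (σ ^ 2 * l ^ 2 * wt σ V' i) := by
          have hA : ∀ r ∈ blockScales n blk (fun r => r 1 ∈ Finset.Ico (L * (c / L)) c ∧
            CutAt (i ∈ V') (r 2) d) i, ∑ i, r i = n := fun r hr => (mem_blockScales.1 hr).1
          have hC : ∀ r ∈ blockScales n blk (fun r => r 1 ∈ Finset.Ico (L * (c / L)) c ∧
            CutAt (i ∈ V') (r 2) d) i, r 1 ∈ Finset.Ico (L * (c / L)) c := fun r hr =>
            (mem_blockScales.1 hr).2.2.1
          by_cases hw : i ∈ V'
          · have := h.hasMoments_of_second_third hf hA hC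
              (fun r hr => hcut i r hr hw) (a := (l : ℝ) ^ 2) (by positivity) hIco
            simpa only [wt, if_pos hw] using this
          · have := h.hasMoments_of_second hf hA hC (a := (l : ℝ) ^ 2) (by positivity) hIco
            simpa only [wt, if_neg hw, mul_one] using this
        have m3 : HasMoments M (fun ω => Z c ω * (ρ * signSum f (blockScales n blk
            (fun r => r 1 ∈ Finset.Ico (L * (c / L)) c ∧ CutAt (i ∈ V') (r 2) d) i) ω))
            (σ ^ 2 * wt σ V' t * (σ ^ 2 * wt σ V' u) * (σ ^ 2 * l ^ 2 * wt σ V' i)) :=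
          HasMoments.mul (HasMoments.mul ((m1 t).mono (by omega) le_rfl)
            ((m1 u).mono (by omega) le_rfl)) (m2.mono (by omega) le_rfl)
        refine avg_abs_mul_lowProd_le h hf hR d V' _ ((Finset.erase_subset _ _).trans hWq) m3
          (by positivity) (le_of_eq ?_)
        calc _ = σ ^ 6 * l ^ 2 * wt σ V' u *
              (wt σ V' t * (wt σ V' i * ∏ w ∈ W.erase i, wt σ V' w)) := by ring
          _ = _ := by
            rw [Finset.mul_prod_erase _ _ hi, hprod, wt, if_neg huV]
            ring
      · rw [nsmul_eq_mul]
        gcongr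
        have := Finset.card_le_card hWq
        rw [Finset.card_range] at this
        exact this
    · rw [Finset.card_range, nsmul_eq_mul]
      push_cast
      exact le_of_eq (by ring)

end PairEstimate

/-! ### Summation over all repeated maxima -/

section MainPartBound

theorem one_add_inv_pow_le_three (q : ℕ) : (1 + (q : ℝ)⁻¹) ^ q ≤ 3 := by
  rcases Nat.eq_zero_or_pos q with rfl | hq
  · norm_num
  have hq' : (q : ℝ) ≠ 0 := by positivity
  have h1 : 1 + (q : ℝ)⁻¹ ≤ Real.exp (q : ℝ)⁻¹ := by
    rw [add_comm]; exact Real.add_one_le_exp _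
  calc (1 + (q : ℝ)⁻¹) ^ q ≤ Real.exp (q : ℝ)⁻¹ ^ q := by gcongr
    _ = Real.exp 1 := by rw [← Real.exp_nat_mul, mul_inv_cancel₀ hq']
    _ ≤ 3 := by linarith [Real.exp_one_lt_d9]

theorem sum_powerset_pow_le {q j : ℕ} {σ : ℝ} (hσ : 0 ≤ σ) (hqσ : q * σ ≤ 1) (hj : j ≠ 0) :
    ∑ V ∈ (Finset.range q).powerset with j ≤ V.card, σ ^ V.card ≤ 3 * (q * σ) ^ j := by
  rcases Nat.eq_zero_or_pos q with rfl | hq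
  · have : ((Finset.range 0).powerset.filter fun V : Finset ℕ => j ≤ V.card) = ∅ := by
      refine Finset.filter_eq_empty_iff.2 fun V hV => ?_
      simp only [Finset.range_zero, Finset.powerset_empty, Finset.mem_singleton] at hV
      subst hV
      simpa using hj
    rw [this]
    simp [hj]
  have hq' : (0 : ℝ) < q := by exact_mod_cast hq
  have h0 : 0 ≤ q * σ := by positivity
  -- Writing `σ` as `(q * σ) * q⁻¹` extracts `(q * σ) ^ j`, and the powers of `q⁻¹` sum to (1 +
  -- 1/q)^q ≤ 3.
  calc _ ≤ ∑ V ∈ (Finset.range q).powerset with j ≤ V.card,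
        (q * σ) ^ j * ((q : ℝ)⁻¹) ^ V.card := by
        refine Finset.sum_le_sum fun V hV => ?_
        have hc := (Finset.mem_filter.1 hV).2
        calc σ ^ V.card = (q * σ) ^ V.card * ((q : ℝ)⁻¹) ^ V.card := by
              rw [← mul_pow]; congr 1; field_simp
          _ ≤ _ := by
              exact mul_le_mul_of_nonneg_right (pow_le_pow_of_le_one h0 hqσ hc) (by positivity)
    _ ≤ ∑ V ∈ (Finset.range q).powerset, (q * σ) ^ j * ((q : ℝ)⁻¹) ^ V.card :=
        Finset.sum_le_sum_of_subset_of_nonneg (Finset.filter_subset _ _)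
          fun _ _ _ => by positivity
    _ = (q * σ) ^ j * (1 + (q : ℝ)⁻¹) ^ q := by
        rw [← Finset.mul_sum]
        have := Finset.sum_pow_mul_eq_add_pow ((q : ℝ)⁻¹) 1 (Finset.range q)
        simp only [one_pow, mul_one, Finset.card_range] at this
        rw [this, add_comm]
    _ ≤ (q * σ) ^ j * 3 := by gcongr; exact one_add_inv_pow_le_three q
    _ = _ := mul_comm _ _

variable {Ω : Type*} [Fintype Ω] {T : Fin 3 → ℕ → Equiv.Perm Ω} {n : ℕ}
  {f : (Fin 3 → ℕ) → Ω → ℝ} {blk : ℕ → ℕ} {q m M l : ℕ} {ρ σ τ : ℝ}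

/-- The bound for the terms with a repeated maximum. -/
noncomputable def repeatedBound (n q M l : ℕ) (ρ σ : ℝ) : ℝ :=
  q ^ 2 * pairBound n q M l ρ σ + 15 * (n + 1) * (q * σ) ^ 3

theorem pairBound_nonneg (hσ : 0 ≤ σ) : 0 ≤ pairBound n q M l ρ σ := by
  unfold pairBound; positivity

theorem repeatedBound_nonneg (hσ : 0 ≤ σ) : 0 ≤ repeatedBound n q M l ρ σ := by
  have := pairBound_nonneg (n := n) (q := q) (M := M) (l := l) (ρ := ρ) hσ
  unfold repeatedBound; positivity

/-- Sets `V` of two blocks need the cancellation in `c`; for three or more blocks, summing absolute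
values over the `n + 1` values of `c` is enough. -/
theorem avg_abs_repeatedPart_le [Nonempty Ω] (h : TermParams n q m M ρ σ)
    (hf : IsSignFamily T n f) (hblk : Monotone blk) (hR : RieszControl f n blk q ρ m)
    (d : ℕ) {V' : Finset ℕ} (hV' : V' ⊆ Finset.range q) (hl : 0 < l) (hτ : 0 ≤ τ)
    (hτM : 2 * (M : ℝ) ^ 2 * (n + 1) ≤ τ ^ 2) (hlτ : (l : ℝ) ^ 2 * τ ≤ n + 1)
    (hqσ : q * σ ≤ 1) :
    avg (fun ω => |repeatedPart f n blk q ρ d V' ω|) ≤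
      repeatedBound n q M l ρ σ * σ ^ V'.card := by
  have hσ := h.σ_pos
  have hsplit : ∀ g : Finset ℕ → ℝ, ∑ V ∈ (Finset.range q).powerset with 2 ≤ V.card, g V =
      ∑ V ∈ (Finset.range q).powersetCard 2, g V +
        ∑ V ∈ (Finset.range q).powerset with 3 ≤ V.card, g V := by
    intro g
    rw [← Finset.sum_union]
    · refine Finset.sum_congr ?_ fun _ _ => rfl
      ext V
      simp only [Finset.mem_filter, Finset.mem_powerset, Finset.mem_union,
        Finset.mem_powersetCard, ← and_or_left]
      refine and_congr_right fun _ => ?_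
      omega
    · rw [Finset.disjoint_left]
      intro V h1 h2
      have h1 := (Finset.mem_powersetCard.1 h1).2
      have h2 := (Finset.mem_filter.1 h2).2
      omega
  simp only [repeatedPart, hsplit]
  refine (avg_abs_add_le _ _).trans ?_
  rw [repeatedBound, add_mul]
  refine add_le_add ?_ ?_
  · refine (avg_abs_sum_le _ _).trans ?_
    refine (Finset.sum_le_card_nsmul _ _ (pairBound n q M l ρ σ * σ ^ V'.card)
      fun V hV => ?_).trans ?_
    · obtain ⟨hVq, hc⟩ := Finset.mem_powersetCard.1 hV
      obtain ⟨t, u, htu, rfl⟩ := Finset.card_eq_two.1 hc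
      have ht : t < q := Finset.mem_range.1 (hVq (by simp))
      have hu : u < q := Finset.mem_range.1 (hVq (by simp))
      rcases lt_or_gt_of_ne htu with hlt | hlt
      · exact avg_abs_sum_rieszTerm_pair_le h hf hblk hR hlt hu d hV' hl hτ hτM hlτ
      · rw [Finset.pair_comm]
        exact avg_abs_sum_rieszTerm_pair_le h hf hblk hR hlt ht d hV' hl hτ hτM hlτ
    · rw [Finset.card_powersetCard, Finset.card_range, nsmul_eq_mul, mul_assoc]
      have := pairBound_nonneg (n := n) (q := q) (M := M) (l := l) (ρ := ρ) hσ.le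
      gcongr
      exact_mod_cast Nat.choose_le_pow q 2
  · refine (avg_abs_sum_le _ _).trans ?_
    calc _ ≤ ∑ V ∈ (Finset.range q).powerset with 3 ≤ V.card,
          5 * (n + 1) * σ ^ V'.card * σ ^ V.card := by
          refine Finset.sum_le_sum fun V hV => ?_
          have hV := Finset.mem_powerset.1 (Finset.mem_filter.1 hV).1
          refine (avg_abs_sum_le _ _).trans ?_
          refine (Finset.sum_le_card_nsmul _ _ _ fun c _ =>
            avg_abs_rieszTerm_le h hf hR c d hV hV').trans ?_
          rw [Finset.card_range, nsmul_eq_mul, pow_add]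
          push_cast
          exact le_of_eq (by ring)
      _ ≤ 5 * (n + 1) * σ ^ V'.card * (3 * (q * σ) ^ 3) := by
          rw [← Finset.mul_sum]
          gcongr
          exact sum_powerset_pow_le hσ.le hqσ (by norm_num)
      _ = _ := by ring

theorem avg_abs_mainPart_le [Nonempty Ω] (h : TermParams n q m M ρ σ)
    (hf : IsSignFamily T n f) (hblk : Monotone blk) (hR : RieszControl f n blk q ρ m)
    (hR' : RieszControl (swapFamily f) n blk q ρ m) (hl : 0 < l) (hτ : 0 ≤ τ)
    (hτM : 2 * (M : ℝ) ^ 2 * (n + 1) ≤ τ ^ 2) (hlτ : (l : ℝ) ^ 2 * τ ≤ n + 1)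
    (hqσ : q * σ ≤ 1) :
    avg (fun ω => |mainPart f n blk q ρ ω|) ≤
      6 + 2 * repeatedBound n q M l ρ σ +
        3 * (q * σ) ^ 2 * (n + 1) * repeatedBound n q M l ρ σ := by
  have hσ := h.σ_pos
  have h1 := avg_abs_rieszTerm_le (blk := blk) h hf hR (n + 1) (n + 1) (V := ∅) (V' := ∅)
    (by simp) (by simp)
  have h2 := avg_abs_repeatedPart_le h hf hblk hR (n + 1) (V' := ∅) (by simp) hl hτ hτM hlτ hqσ
  have h3 := avg_abs_repeatedPart_le h hf.swap hblk hR' (n + 1) (V' := ∅) (by simp) hl hτ hτM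
    hlτ hqσ
  have h4 : avg (fun ω => |∑ V' ∈ (Finset.range q).powerset with 2 ≤ V'.card,
      ∑ d ∈ Finset.range (n + 1), repeatedPart f n blk q ρ d V' ω|) ≤
      3 * (q * σ) ^ 2 * (n + 1) * repeatedBound n q M l ρ σ := by
    have hκ := repeatedBound_nonneg (n := n) (q := q) (M := M) (l := l) (ρ := ρ) hσ.le
    refine (avg_abs_sum_le _ _).trans ?_
    calc _ ≤ ∑ V' ∈ (Finset.range q).powerset with 2 ≤ V'.card,
          (n + 1) * repeatedBound n q M l ρ σ * σ ^ V'.card := by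
          refine Finset.sum_le_sum fun V' hV' => ?_
          have hV' := Finset.mem_powerset.1 (Finset.mem_filter.1 hV').1
          refine (avg_abs_sum_le _ _).trans ?_
          refine (Finset.sum_le_card_nsmul _ _ _ fun d _ =>
            avg_abs_repeatedPart_le h hf hblk hR d hV' hl hτ hτM hlτ hqσ).trans ?_
          rw [Finset.card_range, nsmul_eq_mul]
          push_cast
          exact le_of_eq (by ring)
      _ ≤ (n + 1) * repeatedBound n q M l ρ σ * (3 * (q * σ) ^ 2) := by
          rw [← Finset.mul_sum]
          gcongr
          exact sum_powerset_pow_le hσ.le hqσ (by norm_num)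
      _ = _ := by ring
  simp only [Finset.card_empty, add_zero, pow_zero, mul_one] at h1 h2 h3
  calc _ ≤ avg (fun ω => |rieszTerm f n blk q ρ (n + 1) (n + 1) ∅ ∅ ω| + (1 +
        (|repeatedPart f n blk q ρ (n + 1) ∅ ω| +
        (|repeatedPart (swapFamily f) n blk q ρ (n + 1) ∅ ω| +
        |∑ V' ∈ (Finset.range q).powerset with 2 ≤ V'.card,
          ∑ d ∈ Finset.range (n + 1), repeatedPart f n blk q ρ d V' ω|)))) := by
        refine avg_mono fun ω => ?_
        rw [mainPart_eq]
        refine (abs_add_le _ _).trans ?_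
        have a1 := abs_sub (rieszTerm f n blk q ρ (n + 1) (n + 1) ∅ ∅ ω) 1
        have a2 := abs_sub (rieszTerm f n blk q ρ (n + 1) (n + 1) ∅ ∅ ω - 1)
          (repeatedPart f n blk q ρ (n + 1) ∅ ω)
        have a3 := abs_sub (rieszTerm f n blk q ρ (n + 1) (n + 1) ∅ ∅ ω - 1 -
          repeatedPart f n blk q ρ (n + 1) ∅ ω) (repeatedPart (swapFamily f) n blk q ρ (n + 1) ∅ ω)
        rw [abs_one] at a1
        linarith
    _ ≤ _ := by
        rw [avg_add, avg_add, avg_add, avg_add, avg_const]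
        linarith

/-- The dual estimate: bound for the total mass of a sum of Haar functions of order `n`. -/
theorem sum_avg_abs_le_of_mainPart (hf : IsSignFamily T n f) (hblk : Monotone blk)
    (hq : ∀ a ≤ n, blk a < q) {H : (Fin 3 → ℕ) → Ω → ℝ} {S : Finset (Fin 3 → ℕ)}
    (hS : ∀ s ∈ S, ∑ i, s i = n) (hH : ∀ s ∈ S, IsHaar T s (H s))
    (hHf : ∀ s ∈ S, ∀ ω, H s ω * f s ω = |H s ω|) {X B : ℝ}
    (hX : ∀ ω, |∑ s ∈ S, H s ω| ≤ X) (hB : avg (fun ω => |mainPart f n blk q ρ ω|) ≤ B)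
    (hX0 : 0 ≤ X) :
    ρ * ∑ s ∈ S, avg (fun ω => |H s ω|) ≤ X * B := by
  have e : avg (fun ω => (∑ s ∈ S, H s ω) * mainPart f n blk q ρ ω) =
      ρ * ∑ s ∈ S, avg (fun ω => |H s ω|) := by
    simp only [Finset.sum_mul]
    rw [avg_sum, Finset.mul_sum]
    refine Finset.sum_congr rfl fun s hs => ?_
    have hs' := hS s hs
    rw [avg_haar_mul_mainPart hf hblk hs' (hq _ ?_) (hH s hs)]
    · simp only [hHf s hs]
    · rw [Fin.sum_univ_three] at hs'
      omega
  rw [← e]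
  refine (le_abs_self _).trans ((abs_avg_le _).trans ?_)
  calc _ ≤ avg (fun ω => X * |mainPart f n blk q ρ ω|) := by
        refine avg_mono fun ω => ?_
        rw [abs_mul]
        exact mul_le_mul_of_nonneg_right (hX ω) (abs_nonneg _)
    _ ≤ _ := by
        rw [avg_const_mul]
        gcongr

end MainPartBound

/-! ### Choice of parameters and the abstract inequality -/

section Parameters

theorem card_filter_div_eq_le {q n : ℕ} (hq : 0 < q) (w : ℕ) :
    ((Finset.range (n + 1)).filter fun a => a * q / (n + 1) = w).card ≤ (n + 1) / q + 2 := by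
  have hsub : ((Finset.range (n + 1)).filter fun a => a * q / (n + 1) = w) ⊆
      Finset.Ico (w * (n + 1) / q) (w * (n + 1) / q + ((n + 1) / q + 2)) := by
    intro a ha
    have h := (Finset.mem_filter.1 ha).2
    rw [Nat.div_eq_iff (Nat.succ_pos n), Nat.succ_eq_add_one] at h
    generalize w * (n + 1) = y at h ⊢
    have h1 : y < (y / q + 1) * q := by
      have := Nat.lt_mul_div_succ y hq
      rwa [mul_comm] at this
    have h2 : n + 1 < ((n + 1) / q + 1) * q := by
      have := Nat.lt_mul_div_succ (n + 1) hq
      rwa [mul_comm] at this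
    rw [Finset.mem_Ico]
    constructor
    · exact (Nat.div_le_iff_le_mul_add_pred hq).2 (by rw [mul_comm q a]; omega)
    · refine lt_of_mul_lt_mul_right (a := q) ?_ (Nat.zero_le _)
      have e : (y / q + ((n + 1) / q + 2)) * q = (y / q + 1) * q + ((n + 1) / q + 1) * q := by
        ring
      omega
  simpa using Finset.card_le_card hsub

variable {Ω : Type*} {T : Fin 3 → ℕ → Equiv.Perm Ω} {n : ℕ} {f : (Fin 3 → ℕ) → Ω → ℝ}

theorem IsBlocked.card_le {q : ℕ} (hq : 0 < q) {A : ℕ → Finset (Fin 3 → ℕ)}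
    (hA : IsBlocked n (fun a => a * q / (n + 1)) A) (w : ℕ) :
    (A w).card ≤ ((n + 1) / q + 2) * (n + 1) := by
  calc (A w).card ≤ (((Finset.range (n + 1)).filter fun a => a * q / (n + 1) = w) ×ˢ
        Finset.range (n + 1)).card := by
        refine Finset.card_le_card_of_injOn (fun r => (r 0, r 1)) (fun r hr => ?_) ?_
        · obtain ⟨h1, h2⟩ := hA w r hr
          rw [Fin.sum_univ_three] at h1
          simp only [Finset.coe_product, Set.mem_prod, Finset.mem_coe, Finset.mem_filter,
            Finset.mem_range]
          exact ⟨⟨by omega, h2⟩, by omega⟩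
        · intro r hr s hs h
          exact eq_of_two_coords (hA w r hr).1 (hA w s hs).1 (congrArg Prod.fst h)
            (congrArg Prod.snd h)
    _ ≤ _ := by
        rw [Finset.card_product, Finset.card_range]
        exact Nat.mul_le_mul_right _ (card_filter_div_eq_le hq w)

theorem monotone_mul_div (q d : ℕ) : Monotone fun a : ℕ => a * q / d := fun _ _ h =>
  Nat.div_le_div_right (Nat.mul_le_mul_right _ h)

theorem pow_sq_mul_pow_le {B Y η : ℝ} (h : B ^ 2 * Y ^ 10 ≤ η ^ 20) (q : ℕ) :
    (B ^ q) ^ 2 * Y ^ (10 * q) ≤ η ^ (2 * (10 * q)) := by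
  calc _ = (B ^ 2 * Y ^ 10) ^ q := by ring
    _ ≤ (η ^ 20) ^ q := pow_le_pow_left₀ (by positivity) h q
    _ = _ := by ring

/-- The fourth-moment error is negligible. -/
theorem riesz_error_le {K s : ℝ} (hK : 100 ≤ K) (hs : K ^ 500 ≤ s) :
    (K * s ^ 2) ^ 2 * (4 * (K / (2 * s ^ 2)) ^ 4 * (8 * (10 * K ^ 16) ^ 4 * ((s ^ 2) ^ 3 +
      (s ^ 2) ^ 3 * (2 * (10 * K ^ 16) * s)))) ^ 10 ≤ (1 / K ^ 16) ^ 20 := by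
  have hK0 : 0 < K := by linarith
  have hs1 : 1 ≤ s := hs.trans' (one_le_pow₀ (by linarith))
  have hs0 : 0 < s := by linarith
  have h3 : (100 : ℝ) ^ 3 ≤ K ^ 3 := by gcongr
  have hq1 : 1 ≤ K ^ 16 := one_le_pow₀ (by linarith)
  have hY : 4 * (K / (2 * s ^ 2)) ^ 4 * (8 * (10 * K ^ 16) ^ 4 * ((s ^ 2) ^ 3 +
      (s ^ 2) ^ 3 * (2 * (10 * K ^ 16) * s))) ≤ K ^ 87 / s := by
    have h1 : 1 + 2 * (10 * K ^ 16) * s ≤ 30 * K ^ 16 * s := by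
      nlinarith [mul_le_mul hq1 hs1 zero_le_one (by positivity)]
    calc _ = 20000 * K ^ 68 * (1 + 2 * (10 * K ^ 16) * s) / s ^ 2 := by field_simp; ring
      _ ≤ 20000 * K ^ 68 * (30 * K ^ 16 * s) / s ^ 2 := by gcongr
      _ = 600000 * K ^ 84 / s := by field_simp; ring
      _ ≤ K ^ 3 * K ^ 84 / s := by gcongr; linarith
      _ = _ := by ring
  calc _ ≤ (K * s ^ 2) ^ 2 * (K ^ 87 / s) ^ 10 := by gcongr
    _ = K ^ 872 / s ^ 6 := by field_simp
    _ ≤ K ^ 872 / (K ^ 500) ^ 6 := by gcongr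
    _ ≤ (1 / K ^ 16) ^ 20 := by
        rw [div_pow, one_pow, div_le_div_iff₀ (by positivity) (by positivity), one_mul]
        rw [← pow_mul, ← pow_mul, ← pow_add]
        exact pow_le_pow_right₀ (by linarith) (by norm_num)

variable [Fintype Ω]

/-- A block has at most about 2(n+1)²/k^16 scales, so ρ² times its size is at most 1/(2 k^14). Over
k^16 blocks the second moment is at most exp(k²/2 + 2), well below 4^(k³-1). The moments of order k³
bound the measure where some factor is negative by k^16 (2/k²)^(k³), which defeats it. -/
theorem rieszControl_of_large [Nonempty Ω] (hf : IsSignFamily T n f) {k : ℕ} (hk : 100 ≤ k)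
    (hn : k ^ 1000 ≤ n + 1) :
    RieszControl f n (fun a => a * k ^ 16 / (n + 1)) (k ^ 16) (k / (2 * (n + 1))) (k ^ 3) := by
  have hK : (100 : ℝ) ≤ k := by exact_mod_cast hk
  have hK0 : (0 : ℝ) < k := by linarith
  have hk0 : 0 < k := by omega
  have hblk := monotone_mul_div (k ^ 16) (n + 1)
  have hN : (k : ℝ) ^ 1000 ≤ n + 1 := by exact_mod_cast hn
  obtain ⟨s, hs0, hs2⟩ : ∃ s : ℝ, 0 ≤ s ∧ (n : ℝ) + 1 = s ^ 2 :=
    ⟨√(n + 1), Real.sqrt_nonneg _, (Real.sq_sqrt (by positivity)).symm⟩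
  have hs : (k : ℝ) ^ 500 ≤ s := by
    refine le_of_sq_le_sq ?_ hs0
    rw [← hs2, ← pow_mul]
    exact hN
  have hspos : 0 < s := hs.trans_lt' (by positivity)
  have hcard : ∀ A, IsBlocked n (fun a => a * k ^ 16 / (n + 1)) A → ∀ w,
      ((A w).card : ℝ) ≤ 2 * (s ^ 2) ^ 2 / k ^ 16 := by
    intro A hA w
    have h1 : ((A w).card : ℝ) ≤ (((n + 1) / k ^ 16 : ℕ) + 2) * (n + 1) := by
      exact_mod_cast hA.card_le (by positivity) w
    have h2 : (((n + 1) / k ^ 16 : ℕ) : ℝ) ≤ ((n : ℝ) + 1) / k ^ 16 := by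
      have := Nat.cast_div_le (α := ℝ) (m := n + 1) (n := k ^ 16)
      push_cast at this
      exact this
    have h3 : 2 ≤ ((n : ℝ) + 1) / k ^ 16 := by
      rw [le_div_iff₀ (by positivity)]
      calc 2 * (k : ℝ) ^ 16 ≤ k * k ^ 16 := by gcongr; linarith
        _ = (k : ℝ) ^ 17 := by ring
        _ ≤ (k : ℝ) ^ 1000 := pow_le_pow_right₀ (by linarith) (by norm_num)
        _ ≤ _ := hN
    calc _ ≤ _ := h1
      _ ≤ (((n : ℝ) + 1) / k ^ 16 + ((n : ℝ) + 1) / k ^ 16) * (n + 1) := by gcongr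
      _ = _ := by rw [hs2]; ring
  have hx : ∀ A, IsBlocked n (fun a => a * k ^ 16 / (n + 1)) A → ∀ w,
      ((k : ℝ) / (2 * (n + 1))) ^ 2 * (A w).card ≤ 1 / (2 * k ^ 14) := by
    intro A hA w
    calc _ ≤ ((k : ℝ) / (2 * (n + 1))) ^ 2 * (2 * (s ^ 2) ^ 2 / k ^ 16) := by
          gcongr; exact hcard A hA w
      _ = _ := by rw [hs2]; field_simp
  have hsecond : ∀ A, IsBlocked n (fun a => a * k ^ 16 / (n + 1)) A →
      avg (fun ω => rieszProd f (k / (2 * (n + 1))) 1 A (Finset.range (k ^ 16)) ω ^ 2) ≤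
        4 ^ (k ^ 3 - 1) := by
    intro A hA
    -- Per block the crude supremum costs (k s²)², while each moment of the pair term gains 1/s up
    -- to powers of k. Ten moments per block therefore outweigh s⁴, whence `m := 10 * k ^ 16`.
    have h := avg_rieszProd_sq_le (ρ := k / (2 * (n + 1))) hf hblk hA (q := k ^ 16)
      (m := 10 * k ^ 16) (by positivity) (x := 1 / (2 * k ^ 14)) (η := 1 / k ^ 16)
      (B := k * s ^ 2) (τ := 2 * (10 * k ^ 16) * s) (by positivity) (hx A hA) ?_ (by positivity)
      ?_ ?_
    · refine h.trans ?_
      have e1 : (1 + 1 / (2 * (k : ℝ) ^ 14) + 2 * (1 / k ^ 16)) ≤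
          Real.exp (1 / (2 * (k : ℝ) ^ 14) + 2 * (1 / k ^ 16)) := by
        have := Real.add_one_le_exp (1 / (2 * (k : ℝ) ^ 14) + 2 * (1 / k ^ 16))
        linarith
      have e2 : ((k ^ 16 : ℕ) : ℝ) * (1 / (2 * (k : ℝ) ^ 14) + 2 * (1 / k ^ 16)) =
          (k : ℝ) ^ 2 / 2 + 2 := by
        push_cast; field_simp
      have e3 : (k : ℝ) ^ 2 / 2 + 2 ≤ ((k ^ 3 - 1 : ℕ) : ℝ) := by
        rw [Nat.cast_sub (Nat.one_le_pow _ _ hk0)]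
        push_cast
        nlinarith [pow_pos hK0 2]
      calc _ ≤ Real.exp (1 / (2 * (k : ℝ) ^ 14) + 2 * (1 / k ^ 16)) ^ k ^ 16 := by gcongr
        _ = Real.exp ((k : ℝ) ^ 2 / 2 + 2) := by rw [← Real.exp_nat_mul, e2]
        _ ≤ Real.exp ((k ^ 3 - 1 : ℕ) * 1) := by
            rw [mul_one]; exact Real.exp_le_exp.2 e3
        _ = Real.exp 1 ^ (k ^ 3 - 1) := Real.exp_nat_mul _ _
        _ ≤ _ := by
            gcongr
            linarith [Real.exp_one_lt_d9]
    · intro w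
      have h1 := hcard A hA w
      have h2 : (1 : ℝ) ≤ s ^ 2 := by rw [← hs2]; linarith [(Nat.cast_nonneg n : (0 : ℝ) ≤ n)]
      have h16 : (1 : ℝ) ≤ k ^ 16 / 2 := by
        have : (100 : ℝ) ^ 16 ≤ k ^ 16 := by gcongr
        linarith
      rw [abs_of_nonneg (by positivity), hs2]
      calc 1 + (k : ℝ) / (2 * s ^ 2) * (A w).card
          ≤ 1 + (k : ℝ) / (2 * s ^ 2) * (2 * (s ^ 2) ^ 2 / k ^ 16) := by gcongr
        _ = 1 + (k * s ^ 2 / 2) / (k ^ 16 / 2) := by field_simp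
        _ ≤ 1 + (k * s ^ 2 / 2) / 1 := by gcongr
        _ ≤ _ := by nlinarith
    · push_cast
      rw [hs2]
      have : 0 ≤ (10 * (k : ℝ) ^ 16) ^ 2 * s ^ 2 := by positivity
      nlinarith
    · push_cast
      rw [hs2]
      exact pow_sq_mul_pow_le (riesz_error_le hK hs) _
  refine ⟨fun A hA => ?_, hsecond⟩
  refine avg_abs_rieszProd_le (m := k ^ 3) hf hblk hA (hx A hA) (hsecond A hA) ?_
  have hm1 : 1 ≤ k ^ 3 := Nat.one_le_pow _ _ hk0
  have h16 : 16 ≤ k ^ 3 := by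
    calc 16 ≤ 100 ^ 3 := by norm_num
      _ ≤ k ^ 3 := by gcongr
  have e : 4 * (((k ^ 3 : ℕ) : ℝ)) ^ 4 * (1 / (2 * k ^ 14)) = 2 / k ^ 2 := by
    push_cast; field_simp; ring
  have e4 : (4 : ℝ) ^ (k ^ 3 - 1) = 4 ^ k ^ 3 / 4 := by
    rw [eq_div_iff (by norm_num), ← pow_succ, Nat.sub_add_cancel hm1]
  rw [e, e4]
  calc (4 : ℝ) ^ k ^ 3 / 4 * (((k ^ 16 : ℕ) : ℝ) * (2 / k ^ 2) ^ k ^ 3)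
      = (k : ℝ) ^ 16 * (8 / k ^ 2) ^ k ^ 3 / 4 := by
        have : (8 : ℝ) / k ^ 2 = 4 * (2 / k ^ 2) := by ring
        rw [this, mul_pow 4]; push_cast; ring
    _ ≤ (k : ℝ) ^ 16 * (1 / k) ^ k ^ 3 / 4 := by
        gcongr (k : ℝ) ^ 16 * ?_ ^ _ / 4
        rw [div_le_div_iff₀ (by positivity) (by positivity)]
        nlinarith
    _ ≤ (k : ℝ) ^ 16 * (1 / k) ^ 16 / 4 := by
        gcongr (k : ℝ) ^ 16 * ?_ / 4
        exact pow_le_pow_of_le_one (by positivity) (by rw [div_le_one hK0]; linarith) h16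
    _ = 1 / 4 := by
        rw [← mul_pow, mul_one_div_cancel hK0.ne', one_pow]

/-- The bound for the main part with the choice of parameters made below. -/
theorem repeatedBound_le {K s M a l ν : ℝ} (hK : 100 ≤ K) (hs : K ^ 500 ≤ s) (hM0 : 0 ≤ M)
    (hM : M ≤ K ^ 20) (ha0 : 0 ≤ a) (ha : a ≤ K ^ 42) (hl : l = K ^ 200) (hν : ν ≤ s ^ 2 / l ^ 2) :
    (K ^ 16) ^ 2 * ((ν + 1) * (20 * (K / (2 * s ^ 2)) ^ 2 * M ^ 2 * s ^ 2 * l) +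
      s ^ 2 * (K ^ 16 * (5 * ((a / s) ^ 3 * l)))) + 15 * s ^ 2 * (K ^ 16 * (a / s)) ^ 3 ≤
      3 / K ^ 125 := by
  have hK0 : 0 < K := by linarith
  have hK1 : 1 ≤ K := by linarith
  have hs0 : 0 < s := hs.trans_lt' (by positivity)
  have hl0 : 0 < l := by rw [hl]; positivity
  have h1 : (K ^ 16) ^ 2 * ((ν + 1) * (20 * (K / (2 * s ^ 2)) ^ 2 * M ^ 2 * s ^ 2 * l)) ≤
      1 / K ^ 125 := by
    have h : 1 ≤ s ^ 2 / l ^ 2 := by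
      rw [one_le_div (by positivity), hl]
      gcongr
      exact hs.trans' (pow_le_pow_right₀ hK1 (by norm_num))
    calc _ ≤ (K ^ 16) ^ 2 * ((s ^ 2 / l ^ 2 + s ^ 2 / l ^ 2) *
          (20 * (K / (2 * s ^ 2)) ^ 2 * (K ^ 20) ^ 2 * s ^ 2 * l)) := by gcongr
      _ = 10 * K ^ 74 / l := by field_simp; ring
      _ ≤ K * K ^ 74 / l := by gcongr; linarith
      _ = _ := by rw [hl]; field_simp
  have h2 : (K ^ 16) ^ 2 * (s ^ 2 * (K ^ 16 * (5 * ((a / s) ^ 3 * l)))) ≤ 1 / K ^ 125 := by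
    calc _ ≤ (K ^ 16) ^ 2 * (s ^ 2 * (K ^ 16 * (5 * ((K ^ 42 / s) ^ 3 * l)))) := by gcongr
      _ = 5 * K ^ 374 / s := by rw [hl]; field_simp
      _ ≤ K * K ^ 374 / K ^ 500 := by gcongr; linarith
      _ = _ := by field_simp
  have h3 : 15 * s ^ 2 * (K ^ 16 * (a / s)) ^ 3 ≤ 1 / K ^ 125 := by
    calc _ ≤ 15 * s ^ 2 * (K ^ 16 * (K ^ 42 / s)) ^ 3 := by gcongr
      _ = 15 * K ^ 174 / s := by field_simp
      _ ≤ K * K ^ 174 / K ^ 500 := by gcongr; linarith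
      _ = 1 / K ^ 325 := by field_simp
      _ ≤ _ := by gcongr; norm_num
  calc _ ≤ 1 / K ^ 125 + 1 / K ^ 125 + 1 / K ^ 125 := by rw [mul_add]; gcongr
    _ = _ := by ring

/-- With windows of length (k^200)², `repeatedBound` is at most 3/k^125, while a repeated maximum in
the other coordinate loses at most 3 k^116. Everything beyond 5 for the full product and 1 for the
constant is thus negligible. -/
theorem avg_abs_mainPart_le_seven [Nonempty Ω] (hf : IsSignFamily T n f) {k : ℕ} (hk : 100 ≤ k)
    (hn : k ^ 1000 ≤ n + 1) :
    avg (fun ω => |mainPart f n (fun a => a * k ^ 16 / (n + 1)) (k ^ 16) (k / (2 * (n + 1))) ω|) ≤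
      7 := by
  have hK : (100 : ℝ) ≤ k := by exact_mod_cast hk
  have hK0 : (0 : ℝ) < k := by linarith
  have hK1 : (1 : ℝ) ≤ k := by linarith
  have hk0 : 0 < k := by omega
  have hN : (k : ℝ) ^ 1000 ≤ n + 1 := by exact_mod_cast hn
  obtain ⟨s, hs0, hs2⟩ : ∃ s : ℝ, 0 ≤ s ∧ (n : ℝ) + 1 = s ^ 2 :=
    ⟨√(n + 1), Real.sqrt_nonneg _, (Real.sq_sqrt (by positivity)).symm⟩
  have hs : (k : ℝ) ^ 500 ≤ s := by
    refine le_of_sq_le_sq ?_ hs0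
    rw [← hs2, ← pow_mul]
    exact hN
  have hspos : 0 < s := hs.trans_lt' (by positivity)
  obtain ⟨M, hMdef⟩ : ∃ M, M = 2 * k ^ 3 * (k ^ 16 + 1) := ⟨_, rfl⟩
  have hM1 : (1 : ℝ) ≤ M := by
    have : 1 ≤ M := by rw [hMdef]; exact Nat.succ_le_of_lt (by positivity)
    exact_mod_cast this
  have hM : (M : ℝ) ≤ k ^ 20 := by
    have h16 : (1 : ℝ) ≤ k ^ 16 := one_le_pow₀ hK1
    calc (M : ℝ) = 2 * k ^ 3 * (k ^ 16 + 1) := by rw [hMdef]; push_cast; ring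
      _ ≤ 2 * k ^ 3 * (k ^ 16 + k ^ 16) := by gcongr
      _ = 4 * k ^ 19 := by ring
      _ ≤ k * k ^ 19 := by gcongr; linarith
      _ = _ := by ring
  have ha : 16 * (M : ℝ) ^ 2 * k ≤ k ^ 42 := by
    calc 16 * (M : ℝ) ^ 2 * k ≤ k * (k ^ 20) ^ 2 * k := by gcongr; linarith
      _ = _ := by ring
  have ha1 : 1 ≤ 16 * (M : ℝ) ^ 2 * k := by
    nlinarith [one_le_pow₀ (n := 2) hM1, mul_le_mul (one_le_pow₀ (n := 2) hM1) hK1 zero_le_one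
      (by positivity)]
  -- This value makes `σ = a / s` satisfy `σ_ge` with equality.
  generalize hadef : 16 * (M : ℝ) ^ 2 * k = a at ha ha1
  have hparam : TermParams n (k ^ 16) (k ^ 3) M (k / (2 * (n + 1))) (a / s) := by
    refine ⟨by positivity, by rw [hMdef], by positivity, by positivity, ?_, ?_⟩
    · rw [hs2, ← hadef]
      push_cast
      refine le_of_eq ?_
      field_simp
      norm_num
    · rw [hs2, div_pow, div_mul_cancel₀ _ (by positivity)]
      exact one_le_pow₀ ha1
  have hqσ : ((k ^ 16 : ℕ) : ℝ) * (a / s) ≤ 1 := by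
    push_cast
    rw [mul_div_assoc', div_le_one hspos]
    calc (k : ℝ) ^ 16 * a ≤ k ^ 16 * k ^ 42 := by gcongr
      _ = (k : ℝ) ^ 58 := by ring
      _ ≤ (k : ℝ) ^ 500 := pow_le_pow_right₀ hK1 (by norm_num)
      _ ≤ s := hs
  have hmain := avg_abs_mainPart_le (l := k ^ 200) (τ := 2 * M * s) hparam hf
    (monotone_mul_div (k ^ 16) (n + 1)) (rieszControl_of_large hf hk hn)
    (rieszControl_of_large hf.swap hk hn) (by positivity) (by positivity)
    (by rw [hs2]; nlinarith [(by positivity : 0 ≤ (M : ℝ) ^ 2 * s ^ 2)])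
    (by
      rw [hs2]
      push_cast
      calc ((k : ℝ) ^ 200) ^ 2 * (2 * M * s) ≤ (k ^ 200) ^ 2 * (k * k ^ 20 * s) := by
            gcongr; linarith
        _ = k ^ 421 * s := by ring
        _ ≤ k ^ 500 * s := by gcongr; norm_num
        _ ≤ s * s := by gcongr
        _ = _ := by ring) hqσ
  have hν : ((n / (k ^ 200) ^ 2 : ℕ) : ℝ) ≤ s ^ 2 / (k ^ 200) ^ 2 := by
    have := Nat.cast_div_le (α := ℝ) (m := n) (n := (k ^ 200) ^ 2)
    refine this.trans ?_
    push_cast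
    gcongr
    linarith
  have hκ : repeatedBound n (k ^ 16) M (k ^ 200) (k / (2 * (n + 1))) (a / s) ≤ 3 / k ^ 125 := by
    have := repeatedBound_le hK hs (by linarith) hM (by linarith) ha rfl hν
    rw [repeatedBound, pairBound, hs2]
    push_cast at this ⊢
    exact this
  have hκ0 := repeatedBound_nonneg (n := n) (q := k ^ 16) (M := M) (l := k ^ 200)
    (ρ := k / (2 * (n + 1))) (σ := a / s) (by positivity)
  generalize repeatedBound n (k ^ 16) M (k ^ 200) (k / (2 * (n + 1))) (a / s) = κ at hmain hκ hκ0
  have h3 : 3 * (((k ^ 16 : ℕ) : ℝ) * (a / s)) ^ 2 * (n + 1) ≤ 3 * k ^ 116 := by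
    rw [hs2]
    push_cast
    calc 3 * ((k : ℝ) ^ 16 * (a / s)) ^ 2 * s ^ 2 = 3 * ((k : ℝ) ^ 16 * a) ^ 2 := by field_simp
      _ ≤ 3 * ((k : ℝ) ^ 16 * k ^ 42) ^ 2 := by gcongr
      _ = _ := by ring
  have h4 : (1 : ℝ) ≤ k ^ 116 := one_le_pow₀ hK1
  calc _ ≤ _ := hmain
    _ ≤ 6 + 2 * κ * k ^ 116 + 3 * k ^ 116 * κ := by
        gcongr 6 + ?_ + ?_ * κ
        exact le_mul_of_one_le_right (by positivity) h4
    _ = 6 + 5 * k ^ 116 * κ := by ring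
    _ ≤ 6 + 5 * k ^ 116 * (3 / k ^ 125) := by gcongr
    _ = 6 + 15 / k ^ 9 := by field_simp; norm_num
    _ ≤ 6 + 15 / k := by
        gcongr
        exact le_self_pow₀ hK1 (by norm_num)
    _ ≤ 6 + 15 / 100 := by gcongr
    _ ≤ 7 := by norm_num

/-- Distinct scales are orthogonal. -/
theorem avg_mul_eq_zero_of_ne {r s : Fin 3 → ℕ} (h : r ≠ s) {g g' : Ω → ℝ} (hg : IsHaar T r g)
    (hg' : IsHaar T s g') : avg (fun ω => g ω * g' ω) = 0 := by
  obtain ⟨i, hi⟩ := Function.ne_iff.1 h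
  rcases lt_or_gt_of_ne hi with hi | hi
  · refine avg_eq_zero_of_odd (T i (s i)) fun ω => ?_
    rw [(hg i).1 _ hi, (hg' i).2]; ring
  · refine avg_eq_zero_of_odd (T i (r i)) fun ω => ?_
    rw [(hg i).2, (hg' i).1 _ hi]; ring

variable {H : (Fin 3 → ℕ) → Ω → ℝ} {S : Finset (Fin 3 → ℕ)} {X : ℝ}

/-- Testing the sum against the single function `f s` isolates `H s` by orthogonality; this crude
bound serves for small `n`. -/
theorem avg_abs_le_of_abs_sum_le [Nonempty Ω] (hf : IsSignFamily T n f)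
    (hS : ∀ s ∈ S, ∑ i, s i = n) (hH : ∀ s ∈ S, IsHaar T s (H s))
    (hHf : ∀ s ∈ S, ∀ ω, H s ω * f s ω = |H s ω|) (hX : ∀ ω, |∑ s ∈ S, H s ω| ≤ X)
    {s : Fin 3 → ℕ} (hs : s ∈ S) : avg (fun ω => |H s ω|) ≤ X := by
  have e : avg (fun ω => (∑ r ∈ S, H r ω) * f s ω) = avg fun ω => |H s ω| := by
    simp only [Finset.sum_mul]
    rw [avg_sum, Finset.sum_eq_single_of_mem s hs]
    · simp only [hHf s hs]
    · exact fun r hr hrs => avg_mul_eq_zero_of_ne hrs (hH r hr) (hf s (hS s hs)).1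
  rw [← e]
  refine avg_le_of_le fun ω => (le_abs_self _).trans ?_
  rw [abs_mul]
  exact (mul_le_of_le_one_right (abs_nonneg _) (hf.abs_le (hS s hs) ω)).trans (hX ω)

theorem card_le_of_sum_eq (hS : ∀ s ∈ S, ∑ i, s i = n) : S.card ≤ (n + 1) ^ 2 := by
  calc S.card ≤ (Finset.range (n + 1) ×ˢ Finset.range (n + 1)).card := by
        refine Finset.card_le_card_of_injOn (fun r => (r 0, r 1)) (fun r hr => ?_) ?_
        · have h1 := hS r hr
          rw [Fin.sum_univ_three] at h1
          simp only [Finset.coe_product, Set.mem_prod, Finset.mem_coe, Finset.mem_range]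
          omega
        · intro r hr s hs h
          exact eq_of_two_coords (hS r hr) (hS s hs) (congrArg Prod.fst h) (congrArg Prod.snd h)
    _ = _ := by rw [Finset.card_product, Finset.card_range, sq]

/-- The small ball inequality for abstract Haar sums in three parameters. -/
theorem sum_avg_abs_le_rpow [Nonempty Ω] (hf : IsSignFamily T n f)
    (hS : ∀ s ∈ S, ∑ i, s i = n) (hH : ∀ s ∈ S, IsHaar T s (H s))
    (hHf : ∀ s ∈ S, ∀ ω, H s ω * f s ω = |H s ω|) (hX : ∀ ω, |∑ s ∈ S, H s ω| ≤ X) :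
    ∑ s ∈ S, avg (fun ω => |H s ω|) ≤ 100 ^ 1001 * ((n : ℝ) + 1) ^ (1 - 1 / 1000 : ℝ) * X := by
  have hX0 : 0 ≤ X := (abs_nonneg _).trans (hX (Classical.arbitrary Ω))
  set N : ℝ := (n : ℝ) + 1 with hNdef
  have hN : 0 < N := by positivity
  set z : ℝ := N ^ (1 / 1000 : ℝ) with hz
  have hz0 : 0 < z := Real.rpow_pos_of_pos hN _
  have hzpow : z ^ 1000 = N := by
    rw [hz, ← Real.rpow_natCast, ← Real.rpow_mul hN.le]
    norm_num
  have hsplit : N ^ (1 - 1 / 1000 : ℝ) = N / z := by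
    rw [Real.rpow_sub hN, Real.rpow_one]
  rw [hsplit]
  have hle := Nat.floor_le hz0.le
  have hlt := Nat.lt_floor_add_one z
  generalize hk : ⌊z⌋₊ = k at hle hlt
  -- For bounded `n` the count of scales suffices, and this case fixes the constant 100^1001 = sup
  -- of z^1001. Otherwise k = ⌊z⌋ ≥ 100 and the dual function gives 14 N X / k, with z ≤ 2 k.
  rcases lt_or_ge z 100 with hz100 | hz100
  · have h1 : ∑ s ∈ S, avg (fun ω => |H s ω|) ≤ N ^ 2 * X := by
      refine (Finset.sum_le_card_nsmul _ _ X fun s hs =>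
        avg_abs_le_of_abs_sum_le hf hS hH hHf hX hs).trans ?_
      rw [nsmul_eq_mul]
      gcongr
      rw [hNdef]
      exact_mod_cast card_le_of_sum_eq hS
    refine h1.trans (mul_le_mul_of_nonneg_right ?_ hX0)
    calc N ^ 2 = z ^ 1001 * (N / z) := by
          rw [pow_succ z, hzpow]; field_simp
      _ ≤ 100 ^ 1001 * (N / z) := by gcongr
  · have hk100 : 100 ≤ k := by
      rw [← hk]; exact Nat.le_floor (by exact_mod_cast hz100)
    have hkn : k ^ 1000 ≤ n + 1 := by
      have : (k : ℝ) ^ 1000 ≤ N := by rw [← hzpow]; gcongr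
      rw [hNdef] at this
      exact_mod_cast this
    have hk0 : (0 : ℝ) < k := by
      have : 0 < k := by omega
      exact_mod_cast this
    have h := sum_avg_abs_le_of_mainPart hf (monotone_mul_div (k ^ 16) (n + 1))
      (fun a ha => by
        rw [Nat.div_lt_iff_lt_mul (Nat.succ_pos n), mul_comm a]
        exact Nat.mul_lt_mul_of_pos_left (by omega) (by positivity))
      hS hH hHf hX (avg_abs_mainPart_le_seven hf hk100 hkn) hX0
    rw [← hNdef, div_mul_eq_mul_div, div_le_iff₀ (by positivity)] at h
    have h2 : z ≤ 2 * k := by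
      have : (1 : ℝ) ≤ k := by exact_mod_cast (by omega : 1 ≤ k)
      linarith
    have h28 : (28 : ℝ) ≤ 100 ^ 1001 := by
      calc (28 : ℝ) ≤ 100 := by norm_num
        _ ≤ 100 ^ 1001 := le_self_pow₀ (by norm_num) (by norm_num)
    calc ∑ s ∈ S, avg (fun ω => |H s ω|) ≤ 14 * N * X / k := by
          rw [le_div_iff₀ hk0]; linarith
      _ = 28 * N * X / (2 * k) := by field_simp; ring
      _ ≤ 28 * N * X / z := by gcongr
      _ = 28 * (N / z) * X := by ring
      _ ≤ _ := by gcongr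

end Parameters

/-! ### Realization by binary digits and return to the Haar sum -/

section DyadicModel

open DyadicRectangle

/-- Flip the binary digit number `k` (counted from the most significant one) of a number
with `N` digits. -/
def digitFlip (N k : ℕ) (u : Fin (2 ^ N)) : Fin (2 ^ N) :=
  if h : k < N then
    ⟨u.1 ^^^ 2 ^ (N - 1 - k),
      Nat.xor_lt_two_pow u.2 (Nat.pow_lt_pow_right one_lt_two (by omega))⟩
  else u

theorem digitFlip_involutive (N k : ℕ) : Function.Involutive (digitFlip N k) := by
  intro u
  unfold digitFlip
  split_ifs with h
  · ext
    simp
  · rfl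

theorem digitFlip_div {N k r : ℕ} (hr : r ≤ k) (u : Fin (2 ^ N)) :
    (digitFlip N k u).1 / 2 ^ (N - r) = u.1 / 2 ^ (N - r) := by
  unfold digitFlip
  split_ifs with h
  · rw [← Nat.shiftRight_eq_div_pow, ← Nat.shiftRight_eq_div_pow, Nat.shiftRight_xor_distrib,
      Nat.shiftRight_eq_div_pow (2 ^ (N - 1 - k)),
      Nat.div_eq_of_lt (Nat.pow_lt_pow_right one_lt_two (by omega)), Nat.xor_zero]
  · rfl

/-- The sign of the binary digit number `r`. -/
def digitSign (N r : ℕ) (u : Fin (2 ^ N)) : ℝ := if u.1.testBit (N - 1 - r) then 1 else -1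

theorem digitSign_sq (N r : ℕ) (u : Fin (2 ^ N)) : digitSign N r u ^ 2 = 1 := by
  unfold digitSign; split_ifs <;> norm_num

theorem digitSign_digitFlip {N k r : ℕ} (hr : r < k) (u : Fin (2 ^ N)) :
    digitSign N r (digitFlip N k u) = digitSign N r u := by
  unfold digitSign digitFlip
  split_ifs with h1 h2 h3 <;> simp_all [Nat.testBit_xor, Nat.testBit_two_pow] <;> omega

theorem digitSign_digitFlip_self {N r : ℕ} (hr : r < N) (u : Fin (2 ^ N)) :
    digitSign N r (digitFlip N r u) = -digitSign N r u := by
  unfold digitSign digitFlip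
  rw [dif_pos hr]
  cases h : u.1.testBit (N - 1 - r) <;> simp [Nat.testBit_xor, h]

/-- The digit flips on the cells of the grid of mesh `2 ^ (-N)`. -/
def cellFlip (N : ℕ) (i : Fin 3) (k : ℕ) : Equiv.Perm (Fin 3 → Fin (2 ^ N)) :=
  Function.Involutive.toPerm (fun u => Function.update u i (digitFlip N k (u i))) fun u => by
    simp [digitFlip_involutive N k (u i)]

theorem cellFlip_apply (N : ℕ) (i : Fin 3) (k : ℕ) (u : Fin 3 → Fin (2 ^ N)) :
    cellFlip N i k u = Function.update u i (digitFlip N k (u i)) := rfl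

/-- The dyadic rectangle with side lengths `2 ^ (-r i)` containing the cell `u`. -/
def cellRect (N : ℕ) (r : Fin 3 → ℕ) (u : Fin 3 → Fin (2 ^ N)) : DyadicRectangle 3 :=
  fun i => ⟨-(r i : ℤ), ((u i).1 / 2 ^ (N - r i) : ℕ)⟩

theorem cellRect_cellFlip {N : ℕ} {r : Fin 3 → ℕ} {i : Fin 3} {k : ℕ} (h : r i ≤ k)
    (u : Fin 3 → Fin (2 ^ N)) : cellRect N r (cellFlip N i k u) = cellRect N r u := by
  ext j
  · rfl
  · simp only [cellRect, cellFlip_apply]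
    by_cases hj : j = i
    · subst hj
      rw [Function.update_self, digitFlip_div h]
    · rw [Function.update_of_ne hj]

theorem prod_update_digit {N : ℕ} (r : Fin 3 → ℕ) (i : Fin 3) (u : Fin 3 → Fin (2 ^ N))
    (v : Fin (2 ^ N)) (c : ℝ) (h : digitSign N (r i) v = c * digitSign N (r i) (u i)) :
    ∏ j, digitSign N (r j) (Function.update u i v j) = c * ∏ j, digitSign N (r j) (u j) := by
  rw [← Finset.mul_prod_erase _ _ (Finset.mem_univ i),
    ← Finset.mul_prod_erase _ (fun j => digitSign N (r j) (u j)) (Finset.mem_univ i),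
    Function.update_self, h, mul_assoc]
  congr 2
  refine Finset.prod_congr rfl fun j hj => ?_
  rw [Function.update_of_ne (Finset.ne_of_mem_erase hj)]

/-- The function `∑ α_R h_R`, summed over the rectangles of side lengths `2 ^ (-r i)`, at a
cell. -/
def cellHaar (N : ℕ) (α : DyadicRectangle 3 → ℝ) (r : Fin 3 → ℕ) (u : Fin 3 → Fin (2 ^ N)) : ℝ :=
  α (cellRect N r u) * ∏ i, digitSign N (r i) (u i)

theorem isHaar_cellHaar {N : ℕ} (α : DyadicRectangle 3 → ℝ) {r : Fin 3 → ℕ}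
    (hr : ∀ i, r i < N) : IsHaar (cellFlip N) r (cellHaar N α r) := by
  intro i
  refine ⟨fun k hk u => ?_, fun u => ?_⟩
  · rw [cellHaar, cellRect_cellFlip hk.le, cellFlip_apply, prod_update_digit r i u _ 1, one_mul]
    · rfl
    · rw [one_mul, digitSign_digitFlip hk]
  · rw [cellHaar, cellRect_cellFlip le_rfl, cellFlip_apply, prod_update_digit r i u _ (-1),
      cellHaar]
    · ring
    · rw [digitSign_digitFlip_self (hr i), neg_one_mul]

theorem prod_digitSign_sq {N : ℕ} (r : Fin 3 → ℕ) (u : Fin 3 → Fin (2 ^ N)) :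
    (∏ i, digitSign N (r i) (u i)) ^ 2 = 1 := by
  rw [← Finset.prod_pow]
  simp [digitSign_sq]

theorem abs_cellHaar {N : ℕ} (α : DyadicRectangle 3 → ℝ) (r : Fin 3 → ℕ)
    (u : Fin 3 → Fin (2 ^ N)) : |cellHaar N α r u| = |α (cellRect N r u)| := by
  rw [cellHaar, abs_mul, (pow_eq_one_iff_of_nonneg (abs_nonneg _) two_ne_zero).1
    ((sq_abs _).trans (prod_digitSign_sq r u)), mul_one]

/-- The reason for `n + 1` digits: a side of scale `n` changes sign in digit number `n`, counted
from 0. -/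
theorem lt_succ_of_sum_eq {n : ℕ} {r : Fin 3 → ℕ} (hr : ∑ i, r i = n) (i : Fin 3) :
    r i < n + 1 :=
  Nat.lt_succ_of_le (hr ▸ Finset.single_le_sum (fun _ _ => Nat.zero_le _) (Finset.mem_univ i))

theorem isSignFamily_cellHaar {n : ℕ} {ε : DyadicRectangle 3 → ℝ} (hε : ∀ R, ε R ^ 2 = 1) :
    IsSignFamily (cellFlip (n + 1)) n (cellHaar (n + 1) ε) := fun r hr =>
  ⟨isHaar_cellHaar ε (lt_succ_of_sum_eq hr), fun u => by
    rw [cellHaar, mul_pow, hε, prod_digitSign_sq, one_mul]⟩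

/-- The cell `u` of the grid of mesh `2 ^ (-N)`. -/
def cell (N : ℕ) (u : Fin 3 → Fin (2 ^ N)) : Set (Fin 3 → ℝ) :=
  Set.univ.pi fun i => Set.Ico (((u i).1 : ℝ) / 2 ^ N) (((u i).1 + 1 : ℝ) / 2 ^ N)

theorem mem_toSet_iff {N r u : ℕ} (hr : r ≤ N) {x : ℝ}
    (hx : x ∈ Set.Ico ((u : ℝ) / 2 ^ N) ((u + 1 : ℝ) / 2 ^ N)) (p : ℤ) :
    x ∈ (DyadicInterval.mk (-(r : ℤ)) p).toSet ↔ ((u / 2 ^ (N - r) : ℕ) : ℤ) = p := by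
  obtain ⟨h1, h2⟩ := hx
  rw [div_le_iff₀ (by positivity)] at h1
  rw [lt_div_iff₀ (by positivity)] at h2
  have e : (2 : ℝ) ^ N = 2 ^ (N - r) * 2 ^ r := by rw [← pow_add, Nat.sub_add_cancel hr]
  have hd : (0 : ℤ) < 2 ^ (N - r) := by positivity
  have hr0 : (0 : ℝ) < 2 ^ r := by positivity
  have hc1 : (p : ℝ) * 2 ^ (-(r : ℤ)) ≤ x ↔ p * 2 ^ (N - r) ≤ (u : ℤ) := by
    rw [zpow_neg, zpow_natCast, ← div_eq_mul_inv, div_le_iff₀ hr0]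
    constructor
    · intro h
      have : ((p * 2 ^ (N - r) : ℤ) : ℝ) < ((u + 1 : ℤ) : ℝ) := by
        push_cast
        calc (p : ℝ) * 2 ^ (N - r) ≤ x * 2 ^ r * 2 ^ (N - r) := by gcongr
          _ = x * 2 ^ N := by rw [e]; ring
          _ < _ := h2
      have := Int.cast_lt.1 this
      omega
    · intro h
      have : ((p * 2 ^ (N - r) : ℤ) : ℝ) ≤ ((u : ℤ) : ℝ) := Int.cast_le.2 h
      push_cast at this
      refine le_of_mul_le_mul_right (a := (2 : ℝ) ^ (N - r)) ?_ (by positivity)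
      calc (p : ℝ) * 2 ^ (N - r) ≤ u := this
        _ ≤ x * 2 ^ N := h1
        _ = _ := by rw [e]; ring
  have hc2 : x < ((p : ℝ) + 1) * 2 ^ (-(r : ℤ)) ↔ (u : ℤ) < (p + 1) * 2 ^ (N - r) := by
    rw [zpow_neg, zpow_natCast, ← div_eq_mul_inv, lt_div_iff₀ hr0]
    constructor
    · intro h
      have : ((u : ℤ) : ℝ) < (((p + 1) * 2 ^ (N - r) : ℤ) : ℝ) := by
        push_cast
        calc (u : ℝ) ≤ x * 2 ^ N := h1
          _ = x * 2 ^ r * 2 ^ (N - r) := by rw [e]; ring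
          _ < _ := by gcongr
      exact Int.cast_lt.1 this
    · intro h
      have : (((u + 1 : ℤ)) : ℝ) ≤ (((p + 1) * 2 ^ (N - r) : ℤ) : ℝ) := Int.cast_le.2 h
      push_cast at this
      refine lt_of_mul_lt_mul_right (a := (2 : ℝ) ^ (N - r)) ?_ (by positivity)
      calc x * 2 ^ r * 2 ^ (N - r) = x * 2 ^ N := by rw [e]; ring
        _ < u + 1 := h2
        _ ≤ _ := this
  rw [DyadicInterval.toSet, Set.mem_Ico, hc1, hc2]
  push_cast
  rw [Int.ediv_eq_iff_of_pos hd, add_one_mul]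

/-- With `r < N` a cell lies in one half of the interval or misses the interval, and digit `r` tells
which half. -/
theorem haar_eq_of_mem {N r : ℕ} (hr : r < N) (u : Fin (2 ^ N)) {x : ℝ}
    (hx : x ∈ Set.Ico ((u.1 : ℝ) / 2 ^ N) ((u.1 + 1 : ℝ) / 2 ^ N)) (p : ℤ) :
    (DyadicInterval.mk (-(r : ℤ)) p).haar x =
      if ((u.1 / 2 ^ (N - r) : ℕ) : ℤ) = p then digitSign N r u else 0 := by
  classical
  have e : (-(r : ℤ)) - 1 = -((r + 1 : ℕ) : ℤ) := by push_cast; ring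
  have e2 : N - r = N - (r + 1) + 1 := by omega
  have e3 : N - 1 - r = N - (r + 1) := by omega
  simp only [DyadicInterval.haar, DyadicInterval.left, DyadicInterval.right, e,
    Set.indicator_apply, mem_toSet_iff hr hx, Pi.one_apply]
  rw [e2, pow_succ, ← Nat.div_div_eq_div_mul, digitSign, Nat.testBit_eq_decide_div_mod_eq, e3]
  generalize u.1 / 2 ^ (N - (r + 1)) = v
  simp only [decide_eq_true_eq]
  split_ifs <;> first | omega | norm_num

/-- The scales of a dyadic rectangle. -/
def scales (R : DyadicRectangle 3) (i : Fin 3) : ℕ := (-(R i).scale).toNat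

theorem scales_cellRect {N : ℕ} (r : Fin 3 → ℕ) (u : Fin 3 → Fin (2 ^ N)) :
    scales (cellRect N r u) = r := by
  ext i
  simp [scales, cellRect]

theorem vol_eq_zpow (R : DyadicRectangle 3) :
    R.vol = (2 : ℝ) ^ (∑ i, (R i).scale) := by
  simp only [vol, DyadicInterval.length, Fin.prod_univ_three, Fin.sum_univ_three]
  rw [zpow_add₀ two_ne_zero, zpow_add₀ two_ne_zero]

theorem cellRect_mem_hyperbolic {n : ℕ} {r : Fin 3 → ℕ} (hr : ∑ i, r i = n)
    (u : Fin 3 → Fin (2 ^ (n + 1))) : cellRect (n + 1) r u ∈ hyperbolic 3 n := by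
  rw [hyperbolic, Set.Finite.mem_toFinset]
  refine ⟨fun x hx => ?_, ?_⟩
  · have hside : ∀ i, 0 ≤ x i ∧ x i ≤ 1 := by
      intro i
      obtain ⟨h1, h2⟩ := hx i (Set.mem_univ i)
      simp only [cellRect] at h1 h2
      refine ⟨h1.trans' (by positivity), h2.le.trans ?_⟩
      rw [zpow_neg, zpow_natCast, ← div_eq_mul_inv, div_le_one (by positivity)]
      have hlt : (u i).1 / 2 ^ (n + 1 - r i) < 2 ^ r i := by
        rw [Nat.div_lt_iff_lt_mul (by positivity), ← pow_add,
          Nat.add_sub_cancel' (lt_succ_of_sum_eq hr i).le]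
        exact (u i).2
      exact_mod_cast hlt
    exact ⟨fun i => (hside i).1, fun i => (hside i).2⟩
  · rw [vol_eq_zpow]
    congr 1
    have hr' : ((∑ i, r i : ℕ) : ℤ) = n := by rw [hr]
    push_cast at hr'
    simp [cellRect, hr']

theorem toSet_side_subset {R : DyadicRectangle 3} (hR : R.toSet ⊆ Set.Icc 0 1) (i : Fin 3) :
    (R i).toSet ⊆ Set.Icc 0 1 := by
  intro x hx
  have hne : ∀ j, ((R j).toSet).Nonempty := fun j => by
    refine Set.nonempty_Ico.2 ?_
    have hp : (0 : ℝ) < (2 : ℝ) ^ (R j).scale := by positivity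
    nlinarith
  choose y hy using hne
  have hmem : Function.update y i x ∈ R.toSet := by
    intro j _
    by_cases hj : j = i
    · subst hj; simpa using hx
    · simpa [hj] using hy j
  have h0 := (hR hmem).1 i
  have h1 := (hR hmem).2 i
  simp only [Function.update_self, Pi.zero_apply, Pi.one_apply] at h0 h1
  exact ⟨h0, h1⟩

theorem exists_of_mem_hyperbolic {n : ℕ} {R : DyadicRectangle 3} (hR : R ∈ hyperbolic 3 n) :
    ∑ i, scales R i = n ∧ ∃ p : Fin 3 → ℕ, (∀ i, p i < 2 ^ scales R i) ∧
      R = fun i => ⟨-(scales R i : ℤ), p i⟩ := by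
  rw [hyperbolic, Set.Finite.mem_toFinset] at hR
  obtain ⟨hsub, hvol⟩ := hR
  have hb := fun i => side_bounds (toSet_side_subset hsub i)
  have hsc : ∀ i, (R i).scale = -(scales R i : ℤ) := by
    intro i
    obtain ⟨h0, h1⟩ := hb i
    have h0 : (0 : ℝ) ≤ (R i).pos := by exact_mod_cast h0
    have hp : (0 : ℝ) < (2 : ℝ) ^ (R i).scale := by positivity
    have : (2 : ℝ) ^ (R i).scale ≤ (2 : ℝ) ^ (0 : ℤ) := by
      rw [zpow_zero]; nlinarith
    have := (zpow_le_zpow_iff_right₀ (by norm_num)).1 this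
    rw [scales, Int.toNat_of_nonneg (by omega), neg_neg]
  refine ⟨?_, fun i => (R i).pos.toNat, fun i => ?_, ?_⟩
  · rw [vol_eq_zpow] at hvol
    have := zpow_right_injective₀ (by norm_num) (by norm_num) hvol
    simp only [hsc, Finset.sum_neg_distrib, neg_inj] at this
    exact_mod_cast this
  · obtain ⟨h0, h1⟩ := hb i
    rw [hsc i, zpow_neg, zpow_natCast, ← div_eq_mul_inv, div_le_one (by positivity)] at h1
    have h1 : (R i).pos + 1 ≤ 2 ^ scales R i := by exact_mod_cast h1
    zify
    rw [Int.toNat_of_nonneg h0]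
    omega
  · funext i
    refine DyadicInterval.ext (hsc i) ?_
    exact (Int.toNat_of_nonneg (hb i).1).symm

theorem sum_hyperbolic_eq {n : ℕ} (g : DyadicRectangle 3 → ℝ) :
    ∑ R ∈ hyperbolic 3 n, g R = ∑ r ∈ Finset.Nat.antidiagonalTuple 3 n,
      ∑ R ∈ hyperbolic 3 n with scales R = r, g R :=
  (Finset.sum_fiberwise_of_maps_to (fun _ hR =>
    Finset.Nat.mem_antidiagonalTuple.2 (exists_of_mem_hyperbolic hR).1) g).symm

theorem hyperbolicHaarSum_eq_of_mem_cell {n : ℕ} (α : DyadicRectangle 3 → ℝ)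
    (u : Fin 3 → Fin (2 ^ (n + 1))) {x : Fin 3 → ℝ} (hx : x ∈ cell (n + 1) u) :
    hyperbolicHaarSum n α x =
      ∑ r ∈ Finset.Nat.antidiagonalTuple 3 n, cellHaar (n + 1) α r u := by
  rw [hyperbolicHaarSum, sum_hyperbolic_eq]
  refine Finset.sum_congr rfl fun r hr => ?_
  have hr := Finset.Nat.mem_antidiagonalTuple.1 hr
  have hside : ∀ (i : Fin 3) (p : ℤ), (DyadicInterval.mk (-(r i : ℤ)) p).haar (x i) =
      if (((u i).1 / 2 ^ (n + 1 - r i) : ℕ) : ℤ) = p then digitSign (n + 1) (r i) (u i) else 0 :=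
    fun i p => haar_eq_of_mem (lt_succ_of_sum_eq hr i) (u i) (hx i (Set.mem_univ i)) p
  rw [Finset.sum_eq_single_of_mem (cellRect (n + 1) r u)]
  · rw [cellHaar, DyadicRectangle.haar]
    congr 1
    refine Finset.prod_congr rfl fun i _ => ?_
    rw [cellRect, hside, if_pos rfl]
  · exact Finset.mem_filter.2 ⟨cellRect_mem_hyperbolic hr u, scales_cellRect r u⟩
  · intro R hR hne
    obtain ⟨hR', hRr⟩ := Finset.mem_filter.1 hR
    obtain ⟨-, p, -, hRp⟩ := exists_of_mem_hyperbolic hR'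
    rw [hRr] at hRp
    subst hRp
    obtain ⟨i, hi⟩ := Function.ne_iff.1 hne
    rw [DyadicRectangle.haar, Finset.prod_eq_zero (Finset.mem_univ i), mul_zero]
    rw [hside, if_neg]
    rintro h
    exact hi (DyadicInterval.ext rfl h.symm)

theorem le_card_filter_div {N r p : ℕ} (hr : r ≤ N) (hp : p < 2 ^ r) :
    2 ^ (N - r) ≤ (Finset.univ.filter fun u : Fin (2 ^ N) => u.1 / 2 ^ (N - r) = p).card := by
  have hlt : ∀ j < 2 ^ (N - r), p * 2 ^ (N - r) + j < 2 ^ N := by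
    intro j hj
    calc p * 2 ^ (N - r) + j < (p + 1) * 2 ^ (N - r) := by rw [add_one_mul]; omega
      _ ≤ 2 ^ r * 2 ^ (N - r) := Nat.mul_le_mul_right _ hp
      _ = 2 ^ N := by rw [← pow_add, Nat.add_sub_cancel' hr]
  calc 2 ^ (N - r) = (Finset.univ : Finset (Fin (2 ^ (N - r)))).card := by simp
    _ ≤ _ := by
      refine Finset.card_le_card_of_injOn (fun j => ⟨p * 2 ^ (N - r) + j.1, hlt j.1 j.2⟩)
        (fun j _ => ?_) fun j _ j' _ h => ?_
      · simp only [Finset.coe_filter, Finset.mem_univ, true_and, Set.mem_ofPred_eq]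
        rw [mul_comm, Nat.mul_add_div (by positivity), Nat.div_eq_of_lt j.2, add_zero]
      · simp only [Fin.mk.injEq] at h
        exact Fin.ext (by omega)

theorem le_card_filter_cellRect [DecidableEq (DyadicRectangle 3)] {n : ℕ} {R : DyadicRectangle 3} (hR : R ∈ hyperbolic 3 n) :
    (2 ^ (n + 1)) ^ 3 ≤ 2 ^ n * (Finset.univ.filter fun u : Fin 3 → Fin (2 ^ (n + 1)) =>
      cellRect (n + 1) (scales R) u = R).card := by
  obtain ⟨hsum, p, hp, hRp⟩ := exists_of_mem_hyperbolic hR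
  have hle := fun i => (lt_succ_of_sum_eq hsum i).le
  have hsub : (Fintype.piFinset fun i => Finset.univ.filter fun v : Fin (2 ^ (n + 1)) =>
      v.1 / 2 ^ (n + 1 - scales R i) = p i) ⊆ Finset.univ.filter
        fun u : Fin 3 → Fin (2 ^ (n + 1)) => cellRect (n + 1) (scales R) u = R := by
    intro u hu
    simp only [Fintype.mem_piFinset, Finset.mem_filter, Finset.mem_univ, true_and] at hu ⊢
    rw [hRp]
    funext i
    simp only [cellRect]
    rw [← hRp, hu i]
  refine le_trans ?_ (Nat.mul_le_mul_left _ (Finset.card_le_card hsub))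
  rw [Fintype.card_piFinset]
  refine le_trans ?_ (Nat.mul_le_mul_left _ (Finset.prod_le_prod' fun i _ =>
    le_card_filter_div (hle i) (hp i)))
  have e : 2 ^ n = ∏ i, 2 ^ scales R i := by rw [Finset.prod_pow_eq_pow_sum, hsum]
  rw [e, ← Finset.prod_mul_distrib]
  simp only [← pow_add, Nat.add_sub_cancel' (hle _)]
  simp

/-- Each rectangle contains at least the fraction 2^(-n) of all cells, and on them `|cellHaar|`
equals `|α R|`; only this direction is needed. -/
theorem sum_abs_le_sum_avg {n : ℕ} (α : DyadicRectangle 3 → ℝ) :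
    (2 : ℝ) ^ (-(n : ℤ)) * ∑ R ∈ hyperbolic 3 n, |α R| ≤
      ∑ r ∈ Finset.Nat.antidiagonalTuple 3 n, avg fun u => |cellHaar (n + 1) α r u| := by
  classical
  rw [sum_hyperbolic_eq, Finset.mul_sum]
  refine Finset.sum_le_sum fun r hr => ?_
  have hr := Finset.Nat.mem_antidiagonalTuple.1 hr
  simp only [abs_cellHaar]
  have hcard : (Fintype.card (Fin 3 → Fin (2 ^ (n + 1))) : ℝ) = ((2 ^ (n + 1)) ^ 3 : ℕ) := by
    simp
  rw [avg, hcard, le_div_iff₀ (by positivity), zpow_neg, zpow_natCast, inv_mul_eq_div,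
    div_mul_eq_mul_div, div_le_iff₀ (by positivity)]
  have hfib : ∑ u, |α (cellRect (n + 1) r u)| = ∑ R ∈ hyperbolic 3 n with scales R = r,
      ∑ u with cellRect (n + 1) r u = R, |α (cellRect (n + 1) r u)| :=
    (Finset.sum_fiberwise_of_maps_to (fun u _ => Finset.mem_filter.2
      ⟨cellRect_mem_hyperbolic hr u, scales_cellRect r u⟩) _).symm
  rw [hfib, Finset.sum_mul, Finset.sum_mul]
  refine Finset.sum_le_sum fun R hR => ?_
  obtain ⟨hR', rfl⟩ := Finset.mem_filter.1 hR
  have hc : (((2 ^ (n + 1)) ^ 3 : ℕ) : ℝ) ≤ (2 ^ n * (Finset.univ.filter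
      fun u : Fin 3 → Fin (2 ^ (n + 1)) => cellRect (n + 1) (scales R) u = R).card : ℕ) :=
    Nat.cast_le.2 (le_card_filter_cellRect hR')
  have hconst : ∑ u with cellRect (n + 1) (scales R) u = R, |α (cellRect (n + 1) (scales R) u)| =
      (Finset.univ.filter fun u : Fin 3 → Fin (2 ^ (n + 1)) =>
        cellRect (n + 1) (scales R) u = R).card * |α R| := by
    rw [← nsmul_eq_mul, ← Finset.sum_const]
    exact Finset.sum_congr rfl fun u hu => by rw [(Finset.mem_filter.1 hu).2]
  rw [hconst]
  calc |α R| * (((2 ^ (n + 1)) ^ 3 : ℕ) : ℝ) ≤ _ := mul_le_mul_of_nonneg_left hc (abs_nonneg _)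
    _ = _ := by push_cast; ring

theorem abs_haar_le (I : DyadicInterval) (x : ℝ) : |I.haar x| ≤ 2 := by
  have h : ∀ s : Set ℝ, |s.indicator (1 : ℝ → ℝ) x| ≤ 1 := by
    intro s
    by_cases hx : x ∈ s <;> simp [hx]
  rw [DyadicInterval.haar]
  refine (abs_add_le _ _).trans ?_
  rw [abs_neg]
  linarith [h I.left.toSet, h I.right.toSet]

/-- Needed because `toReal` sends `⊤` to 0. -/
theorem eLpNorm_hyperbolicHaarSum_ne_top {n : ℕ} (α : DyadicRectangle 3 → ℝ) :
    MeasureTheory.eLpNorm (hyperbolicHaarSum n α) ∞ MeasureTheory.volume ≠ ⊤ := by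
  rw [MeasureTheory.eLpNorm_exponent_top]
  refine (MeasureTheory.eLpNormEssSup_lt_top_of_ae_bound (C := ∑ R ∈ hyperbolic 3 n, |α R| * 2 ^ 3)
    (Filter.Eventually.of_forall fun x => ?_)).ne
  rw [Real.norm_eq_abs, hyperbolicHaarSum]
  refine (Finset.abs_sum_le_sum_abs _ _).trans (Finset.sum_le_sum fun R _ => ?_)
  rw [abs_mul, DyadicRectangle.haar, Finset.abs_prod]
  gcongr
  refine (Finset.prod_le_prod (fun _ _ => abs_nonneg _) fun i _ => abs_haar_le (R i) (x i)).trans ?_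
  simp

theorem volume_cell_ne_zero {N : ℕ} (u : Fin 3 → Fin (2 ^ N)) :
    MeasureTheory.volume (cell N u) ≠ 0 := by
  rw [cell, Real.volume_pi_Ico]
  refine Finset.prod_ne_zero_iff.2 fun i _ => ?_
  rw [Ne, ENNReal.ofReal_eq_zero, not_le, sub_pos]
  gcongr
  linarith

/-- The Haar sum is constant on a cell and the cell has positive measure, so its value there is
bounded by the essential supremum. -/
theorem abs_sum_cellHaar_le {n : ℕ} (α : DyadicRectangle 3 → ℝ) (u : Fin 3 → Fin (2 ^ (n + 1))) :
    |∑ r ∈ Finset.Nat.antidiagonalTuple 3 n, cellHaar (n + 1) α r u| ≤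
      (MeasureTheory.eLpNorm (hyperbolicHaarSum n α) ∞ MeasureTheory.volume).toReal := by
  have hae := MeasureTheory.ae_le_eLpNormEssSup (f := hyperbolicHaarSum n α)
    (μ := MeasureTheory.volume)
  obtain ⟨x, hx, hle⟩ : ∃ x ∈ cell (n + 1) u, ‖hyperbolicHaarSum n α x‖ₑ ≤
      MeasureTheory.eLpNormEssSup (hyperbolicHaarSum n α) MeasureTheory.volume := by
    by_contra! hcon
    refine volume_cell_ne_zero u (MeasureTheory.measure_mono_null (fun x hx => ?_) hae)
    exact not_le.2 (hcon x hx)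
  rw [← hyperbolicHaarSum_eq_of_mem_cell α u hx, ← Real.norm_eq_abs, ← toReal_enorm]
  refine ENNReal.toReal_mono (eLpNorm_hyperbolicHaarSum_ne_top α) ?_
  rwa [MeasureTheory.eLpNorm_exponent_top]

theorem sum_abs_le_rpow {n : ℕ} (α : DyadicRectangle 3 → ℝ) :
    (2 : ℝ) ^ (-(n : ℤ)) * ∑ R ∈ hyperbolic 3 n, |α R| ≤
      100 ^ 1001 * ((n : ℝ) + 1) ^ (1 - 1 / 1000 : ℝ) *
        (MeasureTheory.eLpNorm (hyperbolicHaarSum n α) ∞ MeasureTheory.volume).toReal := by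
  refine (sum_abs_le_sum_avg α).trans ?_
  -- The sign is taken to be 1 where `α R = 0`, so that the family squares to 1 everywhere.
  refine sum_avg_abs_le_rpow (T := cellFlip (n + 1))
    (f := cellHaar (n + 1) fun R => if α R < 0 then -1 else 1)
    (isSignFamily_cellHaar fun R => by split_ifs <;> norm_num)
    (fun r hr => Finset.Nat.mem_antidiagonalTuple.1 hr)
    (fun r hr => isHaar_cellHaar α (lt_succ_of_sum_eq (Finset.Nat.mem_antidiagonalTuple.1 hr)))
    (fun r _ u => ?_) (abs_sum_cellHaar_le α)
  rw [abs_cellHaar, cellHaar, cellHaar, mul_mul_mul_comm, ← sq, prod_digitSign_sq, mul_one]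
  split_ifs with h
  · rw [abs_of_neg h, mul_neg_one]
  · rw [abs_of_nonneg (not_lt.1 h), mul_one]

end DyadicModel

theorem theorem1p5 :
    ∃ ε : ℝ, 0 < ε ∧ ∃ K : ℝ, 0 < K ∧
      ∀ n : ℕ, 1 ≤ n → ∀ α : DyadicRectangle 3 → ℝ,
        (2 : ℝ) ^ (-(n : ℤ)) * ∑ R ∈ DyadicRectangle.hyperbolic 3 n, |α R| ≤
          K * (n : ℝ) ^ (1 - ε) *
            (MeasureTheory.eLpNorm (hyperbolicHaarSum n α) ∞ MeasureTheory.volume).toReal := by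
  -- The factor 2 pays for replacing `n + 1` by `n`, as n + 1 ≤ 2n.
  refine ⟨1 / 1000, by norm_num, 100 ^ 1001 * 2, by positivity, fun n hn α => ?_⟩
  refine (sum_abs_le_rpow α).trans ?_
  rw [mul_assoc ((100 : ℝ) ^ 1001) 2]
  gcongr
  have hn' : (1 : ℝ) ≤ n := by exact_mod_cast hn
  calc ((n : ℝ) + 1) ^ (1 - 1 / 1000 : ℝ) ≤ (2 * n) ^ (1 - 1 / 1000 : ℝ) := by
        gcongr
        linarith
    _ = 2 ^ (1 - 1 / 1000 : ℝ) * (n : ℝ) ^ (1 - 1 / 1000 : ℝ) :=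
        Real.mul_rpow (by norm_num) (by positivity)
    _ ≤ 2 ^ (1 : ℝ) * (n : ℝ) ^ (1 - 1 / 1000 : ℝ) := by
        gcongr <;> norm_num
    _ = _ := by rw [Real.rpow_one]
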